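/- Let $n\ge 1$ and $K\in\{0,-1,1\}$. Let $\bar{\mathbb M}^{n+1}(K)$ be the model of the space form of curvature $K$ with metric $\bar g=e^{2u}\langle\cdot,\cdot\rangle$, where $e^{u}=1$ on $\mathbb R^{n+1}$ for $K=0$, $e^{u}=\frac{2}{1-|x|^2}$ on the open unit ball for $K=-1$, and $e^{u}=\frac{2}{1+|x|^2}$ on $\mathbb R^{n+1}$ for $K=1$ (the sphere minus a point). Let $B$ be the closed geodesic ball of radius $R$ about the origin, where $R=1$ if $K=0$, $R\in(0,\infty)$ if $K=-1$, and $R\in(0,\pi)$ if $K=1$. As a set, $B$ is the Euclidean ball of radius $\rho$ about the origin, with $\rho=1$, $\rho=\sqrt{\frac{\cosh R-1}{\cosh R+1}}$, $\rho=\sqrt{\frac{1-\cos R}{1+\cos R}}$ for $K=0,-1,1$ respectively. For $a\in\mathbb R^{n+1}$ put $$V_a=\begin{cases}\langle x,a\rangle,&K=0,\\[2pt] \frac{2\langle x,a\rangle}{1-|x|^2},&K=-1,\\[2pt] \frac{2\langle x,a\rangle}{1+|x|^2},&K=1,\end{cases}\qquad X_a=c\left[\langle x,a\rangle x-\tfrac12(|x|^2+\rho^2)a\right],\qquad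 c=\begin{cases}1,&K=0,\\[2pt]\frac{2}{1-\rho^2},&K=-1,\\[2pt]\frac{2}{1+\rho^2},&K=1.\end{cases}$$ Let $M$ be a compact smooth $n$-manifold with (possibly empty) boundary, let $x:M\to B$ be a smooth immersion with $x(\operatorname{int}M)\subset\operatorname{int}B$ and $x(\partial M)\subset\partial B$, and let $\nu$ be a smooth unit normal field along $x$ with respect to $\bar g$. Assume that $x$ meets $\partial B$ orthogonally, that is, $\bar g(\nu,\bar N)=0$ along $\partial M$, where $\bar N$ is the outward unit normal of $\partial B$. Let $h(Y,Z)=\bar g(\bar\nabla_Y\nu,Z)$ be the second fundamental form, where $\bar\nabla$ is the Levi-Civita connection of $\bar g$, and let $dA$ be the area element of the induced metric. Let $\sigma_k$ be the $k$-th elementary symmetric function of the principal curvatures (the eigenvalues of $h$ with respect to the induced metric), with $\sigma_0=1$. Then for every $a\in\mathbb R^{n+1}$: 1. Suppose that $x$ is an embedding, and let $\Sigma=x(M)$. Let $\Omega$ be a connected component of $B\setminus\Sigma$ that is bounded by all of $\Sigma$ (together with a part of $\partial B$), with $\nu$ along $\Sigma$ pointing out of $\Omega$. Then $$\int_\Omega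 V_a\,d\Omega=\frac1{n+1}\int_\Sigma \bar g(X_a,\nu)\,dA,$$ where $d\Omega$ is the volume element of $\bar g$. 2. For each $k=1,\dots,n$ (whether or not $x$ is an embedding), $$\int_M V_a\,\sigma_{k-1}\,dA=\frac{k}{n+1-k}\int_M\sigma_k\,\bar g(X_a,\nu)\,dA.$$ All the integrands above are integrable. -/

import Mathlib

open Set Filter Topology MeasureTheory
open scoped Manifold ContDiff

noncomputable section

namespace SpaceForm

/-! ### The conformally flat models of the space forms of curvature `K = 0, -1, 1`

The curvature is a `SignType`: `.zero`, `.neg`, `.pos` stand for `0`, `-1`, `1`.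
The models are `ℝ^m` with the flat metric, the unit ball with the Poincaré metric, and `ℝ^m` with
the round metric (the sphere minus one point), where `m = n + 1`. -/

section Ambient

variable {m : ℕ}

/-- The factor `e^u`, where the metric of the model is `e^{2u}` times the Euclidean one. -/
def conformalFactor (K : SignType) (y : EuclideanSpace ℝ (Fin m)) : ℝ :=
  match K with
  | .zero => 1
  | .neg => 2 / (1 - ‖y‖ ^ 2)
  | .pos => 2 / (1 + ‖y‖ ^ 2)

/-- The metric `ḡ = e^{2u} δ` at the point `y`. -/
def metric (K : SignType) (y v w : EuclideanSpace ℝ (Fin m)) : ℝ :=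
  conformalFactor K y ^ 2 * inner ℝ v w

/-- The open subset of `ℝ^m` on which the model lives. -/
def modelDomain (m : ℕ) (K : SignType) : Set (EuclideanSpace ℝ (Fin m)) :=
  match K with
  | .zero => univ
  | .neg => Metric.ball 0 1
  | .pos => univ

/-- Christoffel symbols of `ḡ = e^{2u} δ` as a bilinear expression:
`∇̄_v w = D_v w + Γ(v, w)` with `Γ(v, w) = du(v) w + du(w) v - ⟨v, w⟩ grad u`. -/
def christoffel (K : SignType) (y v w : EuclideanSpace ℝ (Fin m)) : EuclideanSpace ℝ (Fin m) :=
  let u : EuclideanSpace ℝ (Fin m) → ℝ := fun z => Real.log (conformalFactor K z)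
  (fderiv ℝ u y v) • w + (fderiv ℝ u y w) • v - (inner ℝ v w : ℝ) • gradient u y

/-- The connection is torsion free. -/
theorem christoffel_symm (K : SignType) (y v w : EuclideanSpace ℝ (Fin m)) :
    christoffel K y v w = christoffel K y w v := by
  simp only [christoffel, real_inner_comm v w]
  abel

theorem conformalFactor_pos {K : SignType} {y : EuclideanSpace ℝ (Fin m)}
    (hy : y ∈ modelDomain m K) : 0 < conformalFactor K y := by
  match K with
  | .zero => simp [conformalFactor]
  | .neg =>
    have h : ‖y‖ < 1 := by simpa [modelDomain] using hy
    have : 0 < 1 - ‖y‖ ^ 2 := by nlinarith [norm_nonneg y]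
    simp only [conformalFactor]
    positivity
  | .pos => simp only [conformalFactor]; positivity

theorem differentiableAt_conformalFactor {K : SignType} {y : EuclideanSpace ℝ (Fin m)}
    (hy : y ∈ modelDomain m K) : DifferentiableAt ℝ (conformalFactor (m := m) K) y := by
  have hn : DifferentiableAt ℝ (fun z : EuclideanSpace ℝ (Fin m) => ‖z‖ ^ 2) y :=
    (contDiff_norm_sq ℝ (n := 1)).differentiable (by norm_num) y
  match K with
  | .zero => exact differentiableAt_const _
  | .neg =>
    have h : ‖y‖ < 1 := by simpa [modelDomain] using hy
    have h0 : 1 - ‖y‖ ^ 2 ≠ 0 := by nlinarith [norm_nonneg y]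
    have h1 := ((hn.const_sub 1).fun_inv h0).const_mul 2
    exact h1
  | .pos =>
    have h0 : 1 + ‖y‖ ^ 2 ≠ 0 := by positivity
    have h1 := ((hn.const_add 1).fun_inv h0).const_mul 2
    exact h1

/-- The connection is compatible with the metric; with `christoffel_symm` this says that it is the
Levi-Civita connection of `ḡ`. -/
theorem fderiv_metric {K : SignType} {y : EuclideanSpace ℝ (Fin m)} (hy : y ∈ modelDomain m K)
    (v w z : EuclideanSpace ℝ (Fin m)) :
    fderiv ℝ (fun p => metric K p w z) y v =
      metric K y (christoffel K y v w) z + metric K y w (christoffel K y v z) := by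
  have hd := differentiableAt_conformalFactor hy
  have hp := conformalFactor_pos hy
  have hlog : fderiv ℝ (fun p => Real.log (conformalFactor K p)) y
      = (conformalFactor K y)⁻¹ • fderiv ℝ (conformalFactor (m := m) K) y :=
    (hd.hasFDerivAt.log hp.ne').fderiv
  have hm : fderiv ℝ (fun p => metric K p w z) y v
      = 2 * conformalFactor K y * fderiv ℝ (conformalFactor (m := m) K) y v * inner ℝ w z := by
    have := ((hd.hasFDerivAt.pow 2).mul_const (inner ℝ w z : ℝ)).fderiv
    have h2 : (fun p => metric K p w z) =
        fun p => (conformalFactor (m := m) K p) ^ 2 * (inner ℝ w z : ℝ) := rfl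
    rw [h2, this]
    simp
    ring
  have hg : ∀ q, inner ℝ (gradient (fun p => Real.log (conformalFactor K p)) y) q
      = fderiv ℝ (fun p => Real.log (conformalFactor K p)) y q := by
    intro q
    simp [gradient]
  have hg' : ∀ q, inner ℝ q (gradient (fun p => Real.log (conformalFactor K p)) y)
      = fderiv ℝ (fun p => Real.log (conformalFactor K p)) y q := by
    intro q
    rw [real_inner_comm, hg]
  rw [hm]
  simp only [metric, christoffel, inner_add_left, inner_sub_left, inner_add_right, inner_sub_right,
    inner_smul_left, inner_smul_right, hg, hg']
  rw [hlog]
  simp only [smul_apply, smul_eq_mul, conj_trivial, real_inner_comm v w,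
    real_inner_comm z w, real_inner_comm z v]
  field_simp
  ring

/-- The Riemannian volume measure of `ḡ`, with density `√(det ḡ_ij)`. -/
def volumeMeasure (K : SignType) : Measure (EuclideanSpace ℝ (Fin m)) :=
  volume.withDensity fun y => ENNReal.ofReal <| Real.sqrt <|
    (Matrix.of fun i j : Fin m =>
      metric K y (EuclideanSpace.single i 1) (EuclideanSpace.single j 1)).det

/-- The admissible geodesic radii: `R = 1` if `K = 0` (the Euclidean unit ball), `R ∈ (0, ∞)` if
`K = -1`, `R ∈ (0, π)` if `K = 1`. -/
def AdmissibleRadius (K : SignType) (R : ℝ) : Prop :=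
  match K with
  | .zero => R = 1
  | .neg => 0 < R
  | .pos => 0 < R ∧ R < Real.pi

/-- The Euclidean radius, in the model, of the geodesic ball of radius `R` about the origin. -/
def modelRadius (K : SignType) (R : ℝ) : ℝ :=
  match K with
  | .zero => R
  | .neg => Real.sqrt ((Real.cosh R - 1) / (Real.cosh R + 1))
  | .pos => Real.sqrt ((1 - Real.cos R) / (1 + Real.cos R))

/-- The closed geodesic ball `B` of radius `R` about the origin. -/
def geodesicBall (m : ℕ) (K : SignType) (R : ℝ) : Set (EuclideanSpace ℝ (Fin m)) :=
  Metric.closedBall 0 (modelRadius K R)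

/-- The outward unit normal `N̄` of `∂B` with respect to `ḡ`, at a point `y ∈ ∂B`. -/
def ballNormal (K : SignType) (y : EuclideanSpace ℝ (Fin m)) : EuclideanSpace ℝ (Fin m) :=
  (conformalFactor K y * ‖y‖)⁻¹ • y

/-- The function `V_a`. -/
def V (K : SignType) (a y : EuclideanSpace ℝ (Fin m)) : ℝ :=
  match K with
  | .zero => inner ℝ y a
  | .neg => 2 * inner ℝ y a / (1 - ‖y‖ ^ 2)
  | .pos => 2 * inner ℝ y a / (1 + ‖y‖ ^ 2)

/-- The conformal Killing field `X_a` of the ball of geodesic radius `R`. -/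
def X (K : SignType) (R : ℝ) (a y : EuclideanSpace ℝ (Fin m)) : EuclideanSpace ℝ (Fin m) :=
  match K with
  | .zero => (inner ℝ y a : ℝ) • y - ((1 / 2 : ℝ) * (‖y‖ ^ 2 + 1)) • a
  | .neg => (2 / (1 - modelRadius .neg R ^ 2)) •
      ((inner ℝ y a : ℝ) • y - ((1 / 2 : ℝ) * (‖y‖ ^ 2 + modelRadius .neg R ^ 2)) • a)
  | .pos => (2 / (1 + modelRadius .pos R ^ 2)) •
      ((inner ℝ y a : ℝ) • y - ((1 / 2 : ℝ) * (‖y‖ ^ 2 + modelRadius .pos R ^ 2)) • a)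

end Ambient

/-! ### Immersed hypersurfaces

`M` is a smooth `n`-manifold with (possibly empty) boundary, modelled on the Euclidean half space,
and `x : M → ℝ^{n+1}` is an immersion into the model. -/

section Hypersurface

variable {n : ℕ} [NeZero n] {M : Type*} [TopologicalSpace M]
  [ChartedSpace (EuclideanHalfSpace n) M]

/-- The differential of `x : M → ℝ^m` at `p`. -/
def differential {m : ℕ} (x : M → EuclideanSpace ℝ (Fin m)) (p : M) (v : TangentSpace (𝓡∂ n) p) :
    EuclideanSpace ℝ (Fin m) :=
  mfderiv (𝓡∂ n) 𝓘(ℝ, EuclideanSpace ℝ (Fin m)) x p v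

/-- The standard basis of the tangent space at `p` (in the preferred chart at `p`). -/
def tangentBasis (p : M) (i : Fin n) : TangentSpace (𝓡∂ n) p :=
  (EuclideanSpace.single i 1 : EuclideanSpace ℝ (Fin n))

/-- The induced metric (first fundamental form) `g = x^* ḡ` at `p`. -/
def inducedMetric (K : SignType) (x : M → EuclideanSpace ℝ (Fin (n + 1))) (p : M)
    (v w : TangentSpace (𝓡∂ n) p) : ℝ :=
  metric K (x p) (differential x p v) (differential x p w)

/-- The covariant derivative `∇̄_v ν` of a vector field `ν` along `x`. -/
def covDeriv (K : SignType) (x ν : M → EuclideanSpace ℝ (Fin (n + 1))) (p : M)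
    (v : TangentSpace (𝓡∂ n) p) : EuclideanSpace ℝ (Fin (n + 1)) :=
  differential ν p v + christoffel K (x p) (differential x p v) (ν p)

/-- The second fundamental form `h(v, w) = ḡ(∇̄_v ν, dx w)`. -/
def secondFundamentalForm (K : SignType) (x ν : M → EuclideanSpace ℝ (Fin (n + 1))) (p : M)
    (v w : TangentSpace (𝓡∂ n) p) : ℝ :=
  metric K (x p) (covDeriv K x ν p v) (differential x p w)

/-- The matrix `g⁻¹ h` of the shape operator at `p` in the basis `tangentBasis p`. -/
def shapeMatrix (K : SignType) (x ν : M → EuclideanSpace ℝ (Fin (n + 1))) (p : M) :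
    Matrix (Fin n) (Fin n) ℝ :=
  (Matrix.of fun i j => inducedMetric K x p (tangentBasis p i) (tangentBasis p j))⁻¹ *
    Matrix.of fun i j => secondFundamentalForm K x ν p (tangentBasis p i) (tangentBasis p j)

/-- The principal curvatures at `p`: the eigenvalues of the shape operator, with multiplicity. -/
def principalCurvatures (K : SignType) (x ν : M → EuclideanSpace ℝ (Fin (n + 1))) (p : M) :
    Multiset ℝ :=
  (shapeMatrix K x ν p).charpoly.roots

/-- The `k`-th mean curvature `σ_k`, the `k`-th elementary symmetric function of the principal
curvatures (`σ_0 = 1`, not normalized). -/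
def sigma (K : SignType) (x ν : M → EuclideanSpace ℝ (Fin (n + 1))) (k : ℕ) (p : M) : ℝ :=
  (principalCurvatures K x ν p).esymm k

/-- The density `√(det g_ij)` of the induced metric in the coordinates `y` given by the preferred
chart at `q`, where `g_ij = ḡ(∂_i x, ∂_j x)`. -/
def chartDensity (K : SignType) (x : M → EuclideanSpace ℝ (Fin (n + 1))) (q : M)
    (y : EuclideanSpace ℝ (Fin n)) : ℝ :=
  let xq : EuclideanSpace ℝ (Fin n) → EuclideanSpace ℝ (Fin (n + 1)) :=
    x ∘ (extChartAt (𝓡∂ n) q).symm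
  Real.sqrt (Matrix.of fun i j : Fin n =>
    metric K (xq y)
      (fderivWithin ℝ xq (range (𝓡∂ n)) y (EuclideanSpace.single i 1))
      (fderivWithin ℝ xq (range (𝓡∂ n)) y (EuclideanSpace.single j 1))).det

/-- The area measure `√(det g_ij) dy` of the chart domain at `q`, as a measure on `M` (zero outside
the chart domain). -/
def chartArea [MeasurableSpace M] (K : SignType) (x : M → EuclideanSpace ℝ (Fin (n + 1)))
    (q : M) : Measure M :=
  ((volume.restrict (extChartAt (𝓡∂ n) q).target).withDensity
    fun y => ENNReal.ofReal (chartDensity K x q y)).map (extChartAt (𝓡∂ n) q).symm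

/-- The Riemannian area measure `dA` of the induced metric on `M`. By change of variables the
measures `chartArea K x q` agree on overlaps of charts, so their supremum is the one measure on `M`
that restricts to `chartArea K x q` on the chart domain at `q`, for each `q`. -/
def areaMeasure [MeasurableSpace M] (K : SignType) (x : M → EuclideanSpace ℝ (Fin (n + 1))) :
    Measure M :=
  ⨆ q : M, chartArea K x q

/-- `x : M → B` is a smooth immersion that maps the interior of `M` into the interior of `B` and
`∂M` into `∂B`, `ν` is a smooth unit normal field along `x`, and `x` meets `∂B` orthogonally
(`ν ⊥ N̄` along `∂M`; equivalently the outward conormal of `∂M` in `M` is `N̄`). -/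
structure IsFreeBoundaryImmersion (K : SignType) (R : ℝ)
    (x ν : M → EuclideanSpace ℝ (Fin (n + 1))) : Prop where
  contMDiff : ContMDiff (𝓡∂ n) 𝓘(ℝ, EuclideanSpace ℝ (Fin (n + 1))) ∞ x
  injective_differential : ∀ p : M, Function.Injective (differential (n := n) x p)
  interior_mem : ∀ p ∈ (𝓡∂ n).interior M, x p ∈ interior (geodesicBall (n + 1) K R)
  boundary_mem : ∀ p ∈ (𝓡∂ n).boundary M, x p ∈ frontier (geodesicBall (n + 1) K R)
  contMDiff_normal : ContMDiff (𝓡∂ n) 𝓘(ℝ, EuclideanSpace ℝ (Fin (n + 1))) ∞ ν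
  unit : ∀ p : M, metric K (x p) (ν p) (ν p) = 1
  normal : ∀ (p : M) (v : TangentSpace (𝓡∂ n) p), metric K (x p) (ν p) (differential x p v) = 0
  orthogonal : ∀ p ∈ (𝓡∂ n).boundary M, metric K (x p) (ν p) (ballNormal K (x p)) = 0

/-- `Ω` is one of the connected components of `B \ Σ`, where `Σ = x(M)`, and all of `Σ` bounds `Ω`,
with `ν` as the normal that points out of `Ω`. -/
def IsEnclosedDomain (K : SignType) (R : ℝ) (x ν : M → EuclideanSpace ℝ (Fin (n + 1)))
    (Ω : Set (EuclideanSpace ℝ (Fin (n + 1)))) : Prop :=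
  (∃ y ∈ geodesicBall (n + 1) K R \ range x,
    Ω = connectedComponentIn (geodesicBall (n + 1) K R \ range x) y) ∧
  ∀ p ∈ (𝓡∂ n).interior M, ∀ᶠ t in 𝓝[>] (0 : ℝ), x p - t • ν p ∈ Ω ∧ x p + t • ν p ∉ Ω

end Hypersurface

end SpaceForm

end

open Set Filter Topology MeasureTheory
open scoped Manifold ContDiff

noncomputable section

namespace SpaceForm

/-! ### Determinants with one row replaced, and the algebra of the flux form. -/

section Algebra

open Matrix

variable {ι : Type*} [Fintype ι]

/-! Write λ = e^u, N = λν for the Euclidean unit normal, ξ_i = ∂_i x, and w_i = λ(ξ_i + t ∇̄_i ν),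
which works out to λ(1 - tK⟨x, N⟩) ξ_i + t ∂_i N. All computations are Euclidean, and the three
space forms are treated at once through the single law dλ = -Kλ²⟨y, ·⟩. The parameter t packs the
mean curvatures together: det(N, w_1, …, w_n) equals λ^n det(N, ξ_1, …, ξ_n) P(t) with P(t) = Σ σ_k
t^k (`chartParallelDet_eq`).

The Minkowski formulas come from one divergence. The form with components λ det(N, w_1, …, X_a, …,
w_n), with X_a in slot i, has as divergence the signed area density times V_a (nP - tP') - ḡ(X_a, ν)
P' (`divergence_algebra`, `IsPatch.divergence_flux`). That X_a is conformal Killing enters because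
its derivative is a skew map plus a scalar, and the skew part contributes nothing. The Codazzi
equation enters because ∂_i w_j is symmetric in i, j up to the term ⟨w_i, -Kλx⟩ ξ_j. Along ∂M the
flux vanishes: X_a, N and the derivatives w_j in directions tangent to ∂M are all orthogonal to x
(`IsPatch.flux_eq_zero_of_boundary`). Summing over a partition of unity, the integral of V_a (nP -
tP') - ḡ(X_a, ν) P' is zero for every t (`integral_fluxDensity`); its coefficient of t^(k-1) is
(n+1-k) ∫ V_a σ_{k-1} - k ∫ σ_k ḡ(X_a, ν).

The volume formula is the divergence theorem on Ω for λ^(n+1) X_a, whose Euclidean divergence is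
(n+1) λ^(n+1) V_a (`divergence_conformal_X`); ∂B contributes nothing because X_a is tangent to it.
To avoid the corners of Ω along ∂Σ, the divergence theorem is proved only for fields with compact
support in the open ball (`IsEnclosedDomain.integral_divergence`), where Ω is locally everything,
nothing, or one side of Σ. The field is then cut off near ∂B. Since ⟨X_a, y⟩ vanishes to first order
on ∂B, its product with the gradient of the cutoff stays bounded, and dominated convergence finishes
the proof (`tendsto_integral_divergence`). -/

theorem trace_mul_vecMulVec_sub (P : Matrix ι ι ℝ) (hP : P.IsSymm) (a p : ι → ℝ) :
    (P * (vecMulVec a p - vecMulVec p a)).trace = 0 := by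
  have key : ∀ a p : ι → ℝ, (P * vecMulVec a p).trace = p ⬝ᵥ (P *ᵥ a) := by
    intro a p
    rw [mul_vecMulVec, trace_vecMulVec, dotProduct_comm]
  rw [Matrix.mul_sub, trace_sub, key, key, dotProduct_mulVec, ← mulVec_transpose, hP.eq,
    dotProduct_comm, sub_self]
variable [DecidableEq ι]

theorem det_updateRow_eq_dotProduct (M : Matrix ι ι ℝ) (r : ι) (v : ι → ℝ) :
    (M.updateRow r v).det = v ⬝ᵥ fun c => M.adjugate c r := by
  rw [← cramer_transpose_apply, cramer_eq_adjugate_mulVec, ← adjugate_transpose]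
  simp [mulVec, dotProduct, mul_comm]

theorem sum_mul_det_updateRow (M : Matrix ι ι ℝ) (v u : ι → ℝ) :
    ∑ r, u r * (M.updateRow r v).det = v ⬝ᵥ (M.adjugate *ᵥ u) := by
  simp only [det_updateRow_eq_dotProduct, dotProduct, mulVec, Finset.mul_sum]
  rw [Finset.sum_comm]
  refine Finset.sum_congr rfl fun c _ => Finset.sum_congr rfl fun r _ => ?_
  ring

/-- Cramer's rule in the form adj(M) M = det M. It moves the replaced row `v` from slot to slot, as
the derivatives of the rows of the flux require. -/
theorem sum_mulVec_mul_det_updateRow (M : Matrix ι ι ℝ) (v b : ι → ℝ) :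
    ∑ r, (M *ᵥ b) r * (M.updateRow r v).det = (v ⬝ᵥ b) * M.det := by
  rw [sum_mul_det_updateRow, mulVec_mulVec, adjugate_mul, smul_mulVec, one_mulVec,
    dotProduct_smul, smul_eq_mul, mul_comm]

theorem sum_det_updateRow (M B : Matrix ι ι ℝ) :
    ∑ r, (M.updateRow r (B r)).det = (M.adjugate * B).trace := by
  simp only [det_updateRow_eq_dotProduct, dotProduct, trace, diag, mul_apply]
  rw [Finset.sum_comm]
  refine Finset.sum_congr rfl fun c _ => Finset.sum_congr rfl fun r _ => ?_
  ring

/-- Because adj(XW) = adj(W) adj(X) and adj(X) X = det X, the frame `X` factors out and only the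
trace of ambient operators remains. -/
theorem sum_det_updateRow_mul (X W Z : Matrix ι ι ℝ) :
    ∑ r, ((X * W).updateRow r ((X * Z) r)).det = X.det * (W.adjugate * Z).trace := by
  rw [sum_det_updateRow, adjugate_mul_distrib, Matrix.mul_assoc, ← Matrix.mul_assoc X.adjugate,
    adjugate_mul, smul_mul, Matrix.one_mul, Matrix.mul_smul, trace_smul, smul_eq_mul]

/-- If all rows but one are orthogonal to `v`, the determinant only sees the `v`-component of the
remaining row. -/
theorem det_updateRow_of_orthogonal (M : Matrix ι ι ℝ) (r : ι) (v y : ι → ℝ)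
    (hv : v ⬝ᵥ v = 1) (h : ∀ s, s ≠ r → M s ⬝ᵥ v = 0) :
    (M.updateRow r y).det = (y ⬝ᵥ v) * (M.updateRow r v).det := by
  have hy : y = (y - (y ⬝ᵥ v) • v) + (y ⬝ᵥ v) • v := by simp
  have h0 : (M.updateRow r (y - (y ⬝ᵥ v) • v)).det = 0 := by
    apply Matrix.exists_mulVec_eq_zero_iff.1
    refine ⟨v, ?_, ?_⟩
    · rintro rfl
      simp at hv
    · ext s
      by_cases hs : s = r
      · subst hs
        have : (y - (y ⬝ᵥ v) • v) ⬝ᵥ v = 0 := by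
          rw [sub_dotProduct, smul_dotProduct, hv, smul_eq_mul, mul_one, sub_self]
        change (M.updateRow s _ s) ⬝ᵥ v = 0
        rw [updateRow_self, this]
      · simpa [mulVec, updateRow_ne hs] using h s hs
  conv_lhs => rw [hy]
  rw [det_updateRow_add, h0, det_updateRow_smul, zero_add]

variable {n : ℕ}

/-- The determinants with one skewed row sum to zero: the trace of the (symmetric) adjugate against
a skew operator. -/
theorem sum_det_updateRow_skew (Ξ A M : Matrix (Fin (n + 1)) (Fin (n + 1)) ℝ) (α t : ℝ)
    (hdet : Ξ.det ≠ 0) (hN : Ξ *ᵥ Ξ 0 = Pi.single 0 1) (hsymm : (A * Ξᵀ).IsSymm)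
    (hM0 : M 0 = Ξ 0) (hM : ∀ i : Fin n, M i.succ = α • Ξ i.succ + t • A i.succ)
    (hA0 : A 0 = 0) (a p : Fin (n + 1) → ℝ) :
    ∑ i : Fin n, (M.updateRow i.succ ((Ξ i.succ ⬝ᵥ a) • p - (p ⬝ᵥ Ξ i.succ) • a)).det = 0 := by
  set N := Ξ 0 with hNdef
  have hu : IsUnit Ξ.det := isUnit_iff_ne_zero.2 hdet
  -- `S` is the Weingarten map extended by zero on the normal; it is symmetric because it equals Ξ⁻¹
  -- (A Ξᵀ) Ξ⁻ᵀ.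
  set S := Ξ⁻¹ * A with hS
  have hΞS : Ξ * S = A := by rw [hS, ← Matrix.mul_assoc, mul_nonsing_inv _ hu, Matrix.one_mul]
  have hSsymm : S.IsSymm := by
    have h1 : S = Ξ⁻¹ * (A * Ξᵀ) * (Ξ⁻¹)ᵀ := by
      rw [Matrix.mul_assoc, Matrix.mul_assoc, ← transpose_mul, nonsing_inv_mul _ hu,
        transpose_one, Matrix.mul_one]
    unfold Matrix.IsSymm
    rw [h1]
    simp only [transpose_mul, transpose_transpose]
    have h2 := hsymm.eq
    rw [transpose_mul, transpose_transpose] at h2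
    rw [h2, Matrix.mul_assoc, Matrix.mul_assoc, Matrix.mul_assoc]
  -- The last term repairs row 0: as Ξ N = e_0, it adds (1 - α) N there and nothing elsewhere, so
  -- that M = Ξ W with W symmetric.
  set W := α • (1 : Matrix (Fin (n + 1)) (Fin (n + 1)) ℝ) + t • S + (1 - α) • vecMulVec N N with hW
  have hWsymm : W.IsSymm := by
    unfold Matrix.IsSymm
    rw [hW]
    simp [transpose_add, hSsymm.eq, transpose_smul, transpose_vecMulVec]
  have hMW : M = Ξ * W := by
    rw [hW, Matrix.mul_add, Matrix.mul_add, Matrix.mul_smul, Matrix.mul_smul, Matrix.mul_smul, hΞS,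
      Matrix.mul_one, mul_vecMulVec, hN]
    ext r c
    refine Fin.cases ?_ (fun i => ?_) r
    · rw [hM0]
      simp [hA0, vecMulVec_apply, hNdef]
      ring
    · rw [hM]
      simp [vecMulVec_apply]
  have hrowN : ∀ s, M s ⬝ᵥ N = if s = 0 then 1 else 0 := by
    have hAN : A *ᵥ N = 0 := by
      ext s
      have h3 := congrFun (congrFun hsymm.eq 0) s
      have : (A * Ξᵀ) s 0 = 0 := by
        rw [transpose_apply] at h3
        rw [h3, mul_apply]
        simp [hA0]
      simpa [mul_apply, mulVec, dotProduct] using this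
    intro s
    refine Fin.cases ?_ (fun i => ?_) s
    · have := congrFun hN 0
      simpa [hM0, mulVec] using this
    · have h4 := congrFun hN i.succ
      have h5 := congrFun hAN i.succ
      simp only [mulVec] at h4 h5
      simp [hM, add_dotProduct, smul_dotProduct, h4, h5]
  have hall := sum_det_updateRow_mul Ξ W (vecMulVec a p - vecMulVec p a)
  have hadj : (W.adjugate).IsSymm := by
    unfold Matrix.IsSymm
    rw [adjugate_transpose, hWsymm.eq]
  rw [trace_mul_vecMulVec_sub _ hadj, mul_zero, ← hMW, Fin.sum_univ_succ] at hall
  have hrow : ∀ r, (Ξ * (vecMulVec a p - vecMulVec p a)) r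
      = (Ξ r ⬝ᵥ a) • p - (p ⬝ᵥ Ξ r) • a := by
    intro r
    ext c
    rw [Matrix.mul_sub, mul_vecMulVec, mul_vecMulVec]
    simp [vecMulVec_apply, mulVec, dotProduct_comm p]
  have hNN : N ⬝ᵥ N = 1 := by simpa [hM0] using hrowN 0
  -- The sum over all rows vanishes. Row 0 vanishes by itself, since the N-component of (N·a) p -
  -- (p·N) a is zero, so the remaining rows sum to zero too.
  have h0 : (M.updateRow 0 ((Ξ * (vecMulVec a p - vecMulVec p a)) 0)).det = 0 := by
    rw [det_updateRow_of_orthogonal M 0 N _ hNN (fun s hs => by simp [hrowN, hs]), hrow,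
      sub_dotProduct, smul_dotProduct, smul_dotProduct, dotProduct_comm a, smul_eq_mul,
      smul_eq_mul, ← hNdef, dotProduct_comm p]
    ring
  rw [h0, zero_add] at hall
  simpa only [hrow] using hall

/-- The algebraic identity behind the divergence of the `(n-1)`-form `λ det(N, X, w, …, w)`. -/
theorem divergence_algebra (Ξ A M : Matrix (Fin (n + 1)) (Fin (n + 1)) ℝ) (α t : ℝ)
    (hdet : Ξ.det ≠ 0) (hN : Ξ *ᵥ Ξ 0 = Pi.single 0 1) (hsymm : (A * Ξᵀ).IsSymm)
    (hM0 : M 0 = Ξ 0) (hM : ∀ i : Fin n, M i.succ = α • Ξ i.succ + t • A i.succ)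
    (hA0 : A 0 = 0) (a p Y b : Fin (n + 1) → ℝ) (c : ℝ) :
    ∑ i : Fin n, (((M.updateRow i.succ Y).updateRow 0 (A i.succ)).det
      + (M.updateRow i.succ
          (c • ((Ξ i.succ ⬝ᵥ a) • p + (p ⬝ᵥ a) • Ξ i.succ - (p ⬝ᵥ Ξ i.succ) • a))).det
      + ∑ j ∈ Finset.univ.erase i,
          (M i.succ ⬝ᵥ b) * ((M.updateRow i.succ Y).updateRow j.succ (Ξ j.succ)).det
      + (Ξ i.succ ⬝ᵥ b) * (M.updateRow i.succ Y).det)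
    = (c * (p ⬝ᵥ a) + Y ⬝ᵥ b) * ∑ i : Fin n, (M.updateRow i.succ (Ξ i.succ)).det
      - (Y ⬝ᵥ Ξ 0) * ∑ i : Fin n,
        (M.updateRow i.succ (A i.succ + (Ξ 0 ⬝ᵥ b) • Ξ i.succ)).det := by
  -- The four summands on the left come from differentiating N, the field X, the rows w_j and the
  -- factor λ. The vector `b` stands for -Kλx, for which ∂_i λ = λ⟨ξ_i, b⟩.
  set N := Ξ 0 with hNdef
  have hNN : N ⬝ᵥ N = 1 := by simpa [mulVec] using congrFun hN 0
  have hΞN : ∀ i : Fin n, Ξ i.succ ⬝ᵥ N = 0 := fun i => by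
    simpa [mulVec] using congrFun hN i.succ
  have hAN : ∀ s, A s ⬝ᵥ N = 0 := by
    intro s
    have h3 := congrFun (congrFun hsymm.eq 0) s
    have : (A * Ξᵀ) s 0 = 0 := by
      rw [transpose_apply] at h3
      rw [h3, mul_apply]
      simp [hA0]
    simpa [mul_apply, dotProduct] using this
  have hMN : ∀ s, s ≠ 0 → M s ⬝ᵥ N = 0 := by
    intro s hs
    obtain ⟨i, rfl⟩ := Fin.exists_succ_eq.2 hs
    simp [hM, add_dotProduct, smul_dotProduct, hΞN, hAN]
  -- All rows except the one holding Y are orthogonal to N, so Y may be replaced by (Y·N) N; a row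
  -- swap then accounts for the sign.
  have e1 : ∀ i : Fin n, ((M.updateRow i.succ Y).updateRow 0 (A i.succ)).det
      = -((Y ⬝ᵥ N) * (M.updateRow i.succ (A i.succ)).det) := by
    intro i
    have hne : (0 : Fin (n + 1)) ≠ i.succ := (Fin.succ_ne_zero i).symm
    rw [updateRow_comm _ (Ne.symm hne) , det_updateRow_of_orthogonal _ i.succ N Y hNN]
    · have : ((M.updateRow 0 (A i.succ)).updateRow i.succ N)
          = (M.updateRow i.succ (A i.succ)).submatrix (Equiv.swap 0 i.succ) id := by
        ext r c
        by_cases h0 : r = 0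
        · subst h0
          simp [updateRow_ne hne]
        · by_cases h1 : r = i.succ
          · subst h1
            simp [updateRow_ne hne, hM0, hNdef]
          · rw [updateRow_ne h1, updateRow_ne h0, submatrix_apply,
              Equiv.swap_apply_of_ne_of_ne h0 h1, updateRow_ne h1]
            rfl
      rw [this, det_permute, Equiv.Perm.sign_swap hne]
      simp
    · intro s hs
      by_cases h0 : s = 0
      · subst h0
        simp [hAN]
      · rw [updateRow_ne h0]
        exact hMN s h0
  -- The row is a skew image of ξ_i plus the multiple (p·a) ξ_i; the skew parts cancel in the sum.
  have e2 : ∑ i : Fin n, (M.updateRow i.succ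
          (c • ((Ξ i.succ ⬝ᵥ a) • p + (p ⬝ᵥ a) • Ξ i.succ - (p ⬝ᵥ Ξ i.succ) • a))).det
      = c * (p ⬝ᵥ a) * ∑ i : Fin n, (M.updateRow i.succ (Ξ i.succ)).det := by
    have hsk := sum_det_updateRow_skew Ξ A M α t hdet hN hsymm hM0 hM hA0 a p
    have : ∀ i : Fin n, (M.updateRow i.succ
          (c • ((Ξ i.succ ⬝ᵥ a) • p + (p ⬝ᵥ a) • Ξ i.succ - (p ⬝ᵥ Ξ i.succ) • a))).det
        = c * (M.updateRow i.succ ((Ξ i.succ ⬝ᵥ a) • p - (p ⬝ᵥ Ξ i.succ) • a)).det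
          + c * (p ⬝ᵥ a) * (M.updateRow i.succ (Ξ i.succ)).det := by
      intro i
      have h1 : (Ξ i.succ ⬝ᵥ a) • p + (p ⬝ᵥ a) • Ξ i.succ - (p ⬝ᵥ Ξ i.succ) • a
          = ((Ξ i.succ ⬝ᵥ a) • p - (p ⬝ᵥ Ξ i.succ) • a) + (p ⬝ᵥ a) • Ξ i.succ := by abel
      rw [h1, det_updateRow_smul, det_updateRow_add, det_updateRow_smul]
      ring
    simp only [this, Finset.sum_add_distrib, ← Finset.mul_sum, hsk]
    ring
  -- Cramer's rule for the matrix with ξ_j in row j: row 0 gives the normal part of Y, row j gives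
  -- the term that cancels against the derivative of λ, and the other rows are the wanted sum.
  have e3 : ∀ j : Fin n, ∑ i ∈ Finset.univ.erase j,
        (M i.succ ⬝ᵥ b) * ((M.updateRow i.succ Y).updateRow j.succ (Ξ j.succ)).det
      = (Y ⬝ᵥ b - (N ⬝ᵥ b) * (Y ⬝ᵥ N)) * (M.updateRow j.succ (Ξ j.succ)).det
        - (Ξ j.succ ⬝ᵥ b) * (M.updateRow j.succ Y).det := by
    intro j
    set Mj := M.updateRow j.succ (Ξ j.succ) with hMj
    have h := sum_mulVec_mul_det_updateRow Mj Y b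
    rw [Fin.sum_univ_succ, ← Finset.add_sum_erase _ _ (Finset.mem_univ j)] at h
    have hne : (0 : Fin (n + 1)) ≠ j.succ := (Fin.succ_ne_zero j).symm
    have hMj0 : Mj 0 = N := by rw [hMj, updateRow_ne hne, hM0]
    have h0 : (Mj.updateRow 0 Y).det = (Y ⬝ᵥ N) * Mj.det := by
      rw [det_updateRow_of_orthogonal Mj 0 N Y hNN, ← hMj0, updateRow_eq_self]
      intro s hs
      by_cases h1 : s = j.succ
      · subst h1; simp [hMj, hΞN]
      · rw [hMj, updateRow_ne h1]; exact hMN s hs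
    have hj : Mj.updateRow j.succ Y = M.updateRow j.succ Y := by rw [hMj, updateRow_idem]
    have hb0 : (Mj *ᵥ b) 0 = N ⬝ᵥ b := by rw [mulVec, hMj0]
    have hbj : (Mj *ᵥ b) j.succ = Ξ j.succ ⬝ᵥ b := by rw [mulVec, hMj, updateRow_self]
    have hrest : ∀ i ∈ Finset.univ.erase j, (Mj *ᵥ b) i.succ * (Mj.updateRow i.succ Y).det
        = (M i.succ ⬝ᵥ b) * ((M.updateRow i.succ Y).updateRow j.succ (Ξ j.succ)).det := by
      intro i hi
      have hij : i.succ ≠ j.succ := fun h => (Finset.ne_of_mem_erase hi) (Fin.succ_injective _ h)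
      rw [hMj, mulVec, updateRow_ne hij, updateRow_comm _ hij]
    rw [Finset.sum_congr rfl hrest, h0, hj, hb0, hbj] at h
    linear_combination h
  have e3' : ∑ i : Fin n, ∑ j ∈ Finset.univ.erase i,
        (M i.succ ⬝ᵥ b) * ((M.updateRow i.succ Y).updateRow j.succ (Ξ j.succ)).det
      = (Y ⬝ᵥ b - (N ⬝ᵥ b) * (Y ⬝ᵥ N)) * ∑ j : Fin n, (M.updateRow j.succ (Ξ j.succ)).det
        - ∑ j : Fin n, (Ξ j.succ ⬝ᵥ b) * (M.updateRow j.succ Y).det := by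
    rw [Finset.mul_sum, ← Finset.sum_sub_distrib, ← Finset.sum_congr rfl fun j _ => e3 j]
    rw [Finset.sum_comm' (t' := Finset.univ) (s' := fun j => Finset.univ.erase j)]
    intro x y
    simp [ne_comm]
  have e4 : ∑ i : Fin n, (M.updateRow i.succ (A i.succ + (N ⬝ᵥ b) • Ξ i.succ)).det
      = ∑ i : Fin n, (M.updateRow i.succ (A i.succ)).det
        + (N ⬝ᵥ b) * ∑ i : Fin n, (M.updateRow i.succ (Ξ i.succ)).det := by
    simp only [det_updateRow_add, det_updateRow_smul, Finset.sum_add_distrib, ← Finset.mul_sum]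
  simp only [Finset.sum_add_distrib]
  rw [e2, e3', e4]
  simp only [e1, Finset.sum_neg_distrib, ← Finset.mul_sum]
  ring

/-- Euler's identity for the determinant, homogeneous in the last `n` rows. -/
theorem sum_det_updateRow_self_succ (M : Matrix (Fin (n + 1)) (Fin (n + 1)) ℝ) :
    ∑ i : Fin n, (M.updateRow i.succ (M i.succ)).det = n * M.det := by
  simp [updateRow_eq_self]

/-- The matrix with first row `N` and further rows `v i`. -/
def frameMatrix (N : Fin (n + 1) → ℝ) (v : Fin n → Fin (n + 1) → ℝ) :
    Matrix (Fin (n + 1)) (Fin (n + 1)) ℝ :=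
  Matrix.of (Fin.cons N v)

@[simp] theorem frameMatrix_zero (N : Fin (n + 1) → ℝ) (v : Fin n → Fin (n + 1) → ℝ) :
    frameMatrix N v 0 = N := rfl

@[simp] theorem frameMatrix_succ (N : Fin (n + 1) → ℝ) (v : Fin n → Fin (n + 1) → ℝ) (i : Fin n) :
    frameMatrix N v i.succ = v i := rfl

/-- The determinant as a continuous multilinear function of the rows. -/
def detMultilinear (ι : Type*) [Fintype ι] [DecidableEq ι] :
    ContinuousMultilinearMap ℝ (fun _ : ι => ι → ℝ) ℝ :=
  ⟨(Matrix.detRowAlternating (n := ι) (R := ℝ)).toMultilinearMap, by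
    change Continuous fun M : ι → ι → ℝ => Matrix.det (Matrix.of M)
    fun_prop⟩

variable {G : Type*} [NormedAddCommGroup G] [NormedSpace ℝ G]

/-- The derivative of a determinant whose rows vary with derivatives `g'`. -/
def detDeriv (M : Matrix ι ι ℝ) (g' : ι → G →L[ℝ] (ι → ℝ)) : G →L[ℝ] ℝ :=
  ∑ r, ((detMultilinear ι).toContinuousLinearMap M r) ∘L (g' r)

theorem detDeriv_apply (M : Matrix ι ι ℝ) (g' : ι → G →L[ℝ] (ι → ℝ)) (v : G) :
    detDeriv M g' v = ∑ r, (M.updateRow r (g' r v)).det := by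
  rw [detDeriv, _root_.sum_apply]
  rfl

theorem hasFDerivWithinAt_det {M : G → Matrix ι ι ℝ} {g' : ι → G →L[ℝ] (ι → ℝ)} {s : Set G} {y : G}
    (h : ∀ r, HasFDerivWithinAt (fun z => M z r) (g' r) s y) :
    HasFDerivWithinAt (fun z => (M z).det) (detDeriv (M y) g') s y :=
  HasFDerivWithinAt.multilinear_comp (detMultilinear ι) h

theorem hasDerivAt_det_frameMatrix (N : Fin (n + 1) → ℝ) (v w : Fin n → Fin (n + 1) → ℝ) (t : ℝ) :
    HasDerivAt (fun s : ℝ => (frameMatrix N (v + s • w)).det)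
      (∑ i : Fin n, ((frameMatrix N (v + t • w)).updateRow i.succ (w i)).det) t := by
  let g' : Fin (n + 1) → Fin (n + 1) → ℝ := Fin.cons 0 w
  have hg : ∀ r, HasFDerivWithinAt (fun s : ℝ => frameMatrix N (v + s • w) r)
      ((ContinuousLinearMap.id ℝ ℝ).smulRight (g' r)) univ t := by
    intro r
    rw [hasFDerivWithinAt_univ]
    refine Fin.cases ?_ (fun i => ?_) r
    · simpa [g'] using hasFDerivAt_const (𝕜 := ℝ) N t
    · simpa [g'] using (((hasFDerivAt_id (𝕜 := ℝ) t).smul_const (w i)).const_add (v i))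
  have h := (hasFDerivWithinAt_univ.1 (hasFDerivWithinAt_det hg)).hasDerivAt
  refine h.congr_deriv ?_
  rw [detDeriv_apply, Fin.sum_univ_succ]
  have h0 : ((frameMatrix N (v + t • w)).updateRow 0
      (((ContinuousLinearMap.id ℝ ℝ).smulRight (g' 0)) 1)).det = 0 := by
    apply det_eq_zero_of_row_eq_zero 0
    simp [g']
  rw [h0, zero_add]
  simp [g']

/-- Recombining the tangential rows while keeping N is left multiplication by the block matrix
diag(1, B). -/
theorem frameMatrix_mul (N : Fin (n + 1) → ℝ) (v : Fin n → Fin (n + 1) → ℝ)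
    (B : Matrix (Fin n) (Fin n) ℝ) :
    (frameMatrix N fun i => ∑ j, B i j • v j) =
      (frameMatrix (Pi.single 0 1) fun i => Fin.cons 0 (B i)) * frameMatrix N v := by
  ext r c
  rw [mul_apply, Fin.sum_univ_succ]
  refine Fin.cases ?_ (fun i => ?_) r
  · simp
  · simp [Finset.sum_apply]

theorem det_frameMatrix_single (B : Matrix (Fin n) (Fin n) ℝ) :
    (frameMatrix (Pi.single 0 1) fun i => Fin.cons 0 (B i)).det = B.det := by
  rw [det_succ_row_zero, Fin.sum_univ_succ]
  have : (frameMatrix (Pi.single 0 1) fun i => Fin.cons 0 (B i)).submatrix Fin.succ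
      (Fin.succAbove 0) = B := by
    ext i j
    simp
  rw [this]
  simp

/-- The change of frame `v ↦ B v` multiplies the determinant by `det B`. -/
theorem det_frameMatrix_mul (N : Fin (n + 1) → ℝ) (v : Fin n → Fin (n + 1) → ℝ)
    (B : Matrix (Fin n) (Fin n) ℝ) :
    (frameMatrix N fun i => ∑ j, B i j • v j).det = B.det * (frameMatrix N v).det := by
  rw [frameMatrix_mul, det_mul, det_frameMatrix_single]

theorem sum_mul_det_updateRow_succ (M : Matrix (Fin (n + 1)) (Fin (n + 1)) ℝ) (Y : Fin (n + 1) → ℝ)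
    (l : Fin n → ℝ) :
    ∑ i : Fin n, l i * (M.updateRow i.succ Y).det = Y ⬝ᵥ (M.adjugate *ᵥ Fin.cons 0 l) := by
  rw [← sum_mul_det_updateRow, Fin.sum_univ_succ]
  simp

/-- The pairing of a covector `l` with the flux form transforms like a density under a change of
frame: the block matrix diag(1, B) that acts on `l` meets its own adjugate, which leaves det B. This
makes the pairing of dφ with the flux independent of the chart. -/
theorem sum_mul_det_frameMatrix_updateRow_mul (N Y : Fin (n + 1) → ℝ) (v : Fin n → Fin (n + 1) → ℝ)
    (l : Fin n → ℝ) (B : Matrix (Fin n) (Fin n) ℝ) :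
    ∑ i : Fin n, (∑ j, B i j * l j) *
        ((frameMatrix N fun i => ∑ j, B i j • v j).updateRow i.succ Y).det
      = B.det * ∑ i : Fin n, l i * ((frameMatrix N v).updateRow i.succ Y).det := by
  set B' := frameMatrix (Pi.single 0 1) fun i => Fin.cons 0 (B i) with hB'
  have h1 : (Fin.cons 0 fun i => ∑ j, B i j * l j : Fin (n + 1) → ℝ) = B' *ᵥ Fin.cons 0 l := by
    ext r
    rw [mulVec, dotProduct, Fin.sum_univ_succ]
    refine Fin.cases ?_ (fun i => ?_) r <;> simp [hB']
  rw [sum_mul_det_updateRow_succ, sum_mul_det_updateRow_succ, frameMatrix_mul, ← hB', h1,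
    adjugate_mul_distrib, mulVec_mulVec, Matrix.mul_assoc, adjugate_mul, hB',
    det_frameMatrix_single, Matrix.mul_smul, Matrix.mul_one, smul_mulVec, dotProduct_smul,
    smul_eq_mul]

end Algebra

end SpaceForm

end

open Set Filter Topology MeasureTheory
open scoped Manifold ContDiff

noncomputable section

namespace SpaceForm

/-! ### Characteristic polynomials and the generating polynomial of the σ_k. -/

section Curvatures

open Matrix

/-- The elementary symmetric functions are taken of the multiset of real roots, so the expansion
needs the characteristic polynomial to split; otherwise roots would be missing. -/
theorem det_one_add_smul_eq_sum_esymm {ι : Type*} [Fintype ι] [DecidableEq ι] (A : Matrix ι ι ℝ)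
    (hA : A.charpoly.Splits) (t : ℝ) :
    (1 + t • A).det = ∑ k ∈ Finset.range (Fintype.card ι + 1), A.charpoly.roots.esymm k * t ^ k := by
  have hcard : Multiset.card A.charpoly.roots = Fintype.card ι := by
    rw [← Polynomial.Splits.natDegree_eq_card_roots hA, Matrix.charpoly_natDegree_eq_dim]
  by_cases ht : t = 0
  · subst ht
    rw [Finset.sum_range_succ']
    simp [Multiset.esymm]
  have hprod : A.charpoly = (A.charpoly.roots.map fun r => Polynomial.X - Polynomial.C r).prod :=
    Polynomial.Splits.eq_prod_roots_of_monic hA A.charpoly_monic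
  -- For t ≠ 0 the determinant is, up to the factor (-t)^n, the characteristic polynomial at -1/t.
  have h1 : (1 + t • A) = (-t) • (Matrix.scalar ι (-t⁻¹) - A) := by
    ext i j
    by_cases hij : i = j
    · subst hij
      simp
      field_simp
      ring
    · simp [hij]
  have h2 : (Matrix.scalar ι (-t⁻¹) - A).det
      = (-1) ^ Fintype.card ι *
        ((A.charpoly.roots.map fun r => Polynomial.X + Polynomial.C r).prod).eval t⁻¹ := by
    rw [← Matrix.eval_charpoly, ← hcard]
    conv_lhs => rw [hprod]
    generalize A.charpoly.roots = s
    induction s using Multiset.induction_on with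
    | empty => simp
    | cons a s ih =>
      simp only [Multiset.map_cons, Multiset.prod_cons, Polynomial.eval_mul, Multiset.card_cons, ih]
      simp [pow_succ]
      ring
  rw [h1, Matrix.det_smul, h2, Multiset.prod_X_add_C_eq_sum_esymm, Polynomial.eval_finsetSum,
    Finset.mul_sum, Finset.mul_sum, hcard]
  refine Finset.sum_congr rfl fun k hk => ?_
  have hk' : k ≤ Fintype.card ι := by simpa [Nat.lt_succ_iff] using hk
  obtain ⟨d, hd⟩ := Nat.exists_eq_add_of_le hk'
  rw [hd]
  simp only [Polynomial.eval_mul, Polynomial.eval_C, Polynomial.eval_pow, Polynomial.eval_X,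
    Nat.add_sub_cancel_left]
  rw [neg_pow t, pow_add t, inv_pow]
  have : ((-1 : ℝ) ^ (k + d)) * (-1) ^ (k + d) = 1 := by
    rw [← mul_pow]; simp
  have htd : t ^ d ≠ 0 := pow_ne_zero _ ht
  field_simp
  linear_combination (A.charpoly.roots.esymm k) * this

open scoped MatrixOrder in
-- With C the square root of G⁻¹, the matrices C(CH) and (CH)C have the same characteristic
-- polynomial, and CHC is symmetric. Hence the shape operator has all its eigenvalues real.
theorem splits_charpoly_inv_mul {ι : Type*} [Fintype ι] [DecidableEq ι] {G H : Matrix ι ι ℝ}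
    (hG : G.PosDef) (hH : H.IsSymm) : (G⁻¹ * H).charpoly.Splits := by
  have hpos : (0 : Matrix ι ι ℝ) ≤ G⁻¹ := Matrix.nonneg_iff_posSemidef.2 hG.inv.posSemidef
  set C := CFC.sqrt G⁻¹ with hC
  have hCC : C * C = G⁻¹ := CFC.sqrt_mul_sqrt_self G⁻¹ hpos
  have hCh : C.IsHermitian := (Matrix.nonneg_iff_posSemidef.1 (CFC.sqrt_nonneg G⁻¹)).1
  rw [← hCC, Matrix.mul_assoc, Matrix.charpoly_mul_comm]
  apply Matrix.IsHermitian.splits_charpoly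
  have hHh : H.IsHermitian := by
    rw [Matrix.IsHermitian, Matrix.conjTranspose_eq_transpose_of_trivial]
    exact hH
  have := Matrix.isHermitian_conjTranspose_mul_mul C hHh
  rw [hCh.eq] at this
  exact this

variable {n : ℕ}

/-- The product of one frame with the transpose of the other has the row inner products as entries.
Its column 0 is e_0, because every w_i is orthogonal to N, so only the n × n block survives. -/
theorem det_frameMatrix_mul_det_frameMatrix (N : Fin (n + 1) → ℝ)
    (v w : Fin n → Fin (n + 1) → ℝ) (hN : N ⬝ᵥ N = 1) (hw : ∀ i, w i ⬝ᵥ N = 0) :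
    (frameMatrix N w).det * (frameMatrix N v).det = (Matrix.of fun i j => w i ⬝ᵥ v j).det := by
  rw [← Matrix.det_transpose (frameMatrix N v), ← Matrix.det_mul, ← Matrix.det_transpose,
    Matrix.det_succ_row_zero, Fin.sum_univ_succ]
  have h0 : ∀ r, (frameMatrix N w * (frameMatrix N v)ᵀ)ᵀ 0 r = if r = 0 then 1 else 0 := by
    intro r
    refine Fin.cases ?_ (fun i => ?_) r
    · simpa [Matrix.mul_apply, dotProduct] using hN
    · simpa [Matrix.mul_apply, dotProduct] using hw i
  have hsub : (frameMatrix N w * (frameMatrix N v)ᵀ)ᵀ.submatrix Fin.succ (Fin.succAbove 0)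
      = (Matrix.of fun i j => w i ⬝ᵥ v j)ᵀ := by
    ext i j
    simp only [Matrix.submatrix_apply, Matrix.transpose_apply, Matrix.mul_apply,
      Fin.succAbove_zero, frameMatrix_succ, Matrix.of_apply, dotProduct]
  simp only [h0, hsub]
  simp [Fin.succ_ne_zero]

end Curvatures

/-! ### The conformal factor, the connection, and the fields V_a and X_a. -/

section Geometry

variable {m : ℕ}

/-- The curvature as a real number. -/
def curv (K : SignType) : ℝ := match K with
  | .zero => 0
  | .neg => -1
  | .pos => 1

theorem contDiffAt_conformalFactor {K : SignType} {y : EuclideanSpace ℝ (Fin m)}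
    (hy : y ∈ modelDomain m K) : ContDiffAt ℝ ∞ (conformalFactor (m := m) K) y := by
  have hn : ContDiffAt ℝ ∞ (fun z : EuclideanSpace ℝ (Fin m) => ‖z‖ ^ 2) y :=
    (contDiff_norm_sq ℝ).contDiffAt
  match K with
  | .zero => exact contDiffAt_const
  | .neg =>
    have h : ‖y‖ < 1 := by simpa [modelDomain] using hy
    have h0 : 1 - ‖y‖ ^ 2 ≠ 0 := by nlinarith [norm_nonneg y]
    exact contDiffAt_const.div (contDiffAt_const.sub hn) h0
  | .pos =>
    have h0 : 1 + ‖y‖ ^ 2 ≠ 0 := by positivity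
    exact contDiffAt_const.div (contDiffAt_const.add hn) h0

/-- For K = ±1 the factor is 2/(1 + K|y|²), and for K = 0 it is constant. This common law is what
allows the later computations to avoid a case distinction on K. -/
theorem fderiv_conformalFactor {K : SignType} {y : EuclideanSpace ℝ (Fin m)}
    (hy : y ∈ modelDomain m K) (v : EuclideanSpace ℝ (Fin m)) :
    fderiv ℝ (conformalFactor (m := m) K) y v
      = -curv K * conformalFactor K y ^ 2 * inner ℝ y v := by
  have hn : HasFDerivAt (fun z : EuclideanSpace ℝ (Fin m) => ‖z‖ ^ 2) (2 • innerSL ℝ y) y :=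
    (hasStrictFDerivAt_norm_sq y).hasFDerivAt
  match K with
  | .zero =>
    change fderiv ℝ (fun _ : EuclideanSpace ℝ (Fin m) => (1 : ℝ)) y v = _
    simp [curv]
  | .neg =>
    have h : ‖y‖ < 1 := by simpa [modelDomain] using hy
    have h0 : 1 - ‖y‖ ^ 2 ≠ 0 := by nlinarith [norm_nonneg y]
    have h1 := (((hasDerivAt_inv h0).comp_hasFDerivAt y (hn.const_sub 1)).const_mul 2).fderiv
    have h2 : conformalFactor (m := m) .neg = fun z => 2 * (1 - ‖z‖ ^ 2)⁻¹ := rfl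
    rw [h2]
    refine (congrArg (fun L => L v) h1).trans ?_
    simp [curv]
    field_simp
  | .pos =>
    have h0 : 1 + ‖y‖ ^ 2 ≠ 0 := by positivity
    have h1 := (((hasDerivAt_inv h0).comp_hasFDerivAt y (hn.const_add 1)).const_mul 2).fderiv
    have h2 : conformalFactor (m := m) .pos = fun z => 2 * (1 + ‖z‖ ^ 2)⁻¹ := rfl
    rw [h2]
    refine (congrArg (fun L => L v) h1).trans ?_
    simp [curv]
    field_simp

theorem christoffel_eq {K : SignType} {y : EuclideanSpace ℝ (Fin m)}
    (hy : y ∈ modelDomain m K) (v w : EuclideanSpace ℝ (Fin m)) :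
    christoffel K y v w = (-curv K * conformalFactor K y) •
      ((inner ℝ y v : ℝ) • w + (inner ℝ y w : ℝ) • v - (inner ℝ v w : ℝ) • y) := by
  have hd := differentiableAt_conformalFactor hy
  have hp := conformalFactor_pos hy
  have hlog : ∀ v, fderiv ℝ (fun p => Real.log (conformalFactor K p)) y v
      = -curv K * conformalFactor K y * inner ℝ y v := by
    intro v
    rw [(hd.hasFDerivAt.log hp.ne').fderiv, _root_.smul_apply, fderiv_conformalFactor hy,
      smul_eq_mul]
    field_simp
  have hgrad : gradient (fun p => Real.log (conformalFactor K p)) y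
      = (-curv K * conformalFactor K y) • y := by
    apply ext_inner_right ℝ
    intro q
    rw [gradient, InnerProductSpace.toDual_symm_apply, hlog, inner_smul_left]
    simp
  simp only [christoffel, hlog, hgrad]
  module

theorem modelRadius_pos {K : SignType} {R : ℝ} (hR : AdmissibleRadius K R) :
    0 < modelRadius K R := by
  match K with
  | .zero => rw [show R = 1 from hR]; exact one_pos
  | .neg =>
    have h : 0 < R := hR
    have : 1 < Real.cosh R := Real.one_lt_cosh.2 h.ne'
    exact Real.sqrt_pos.2 (div_pos (by linarith) (by linarith))
  | .pos =>
    obtain ⟨h0, h1⟩ : 0 < R ∧ R < Real.pi := hR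
    have h2 : Real.cos R < 1 := by
      rw [← Real.cos_zero]
      exact Real.cos_lt_cos_of_nonneg_of_le_pi le_rfl h1.le h0
    have h3 : -1 < Real.cos R := by
      rw [← Real.cos_pi]
      exact Real.cos_lt_cos_of_nonneg_of_le_pi h0.le le_rfl h1
    exact Real.sqrt_pos.2 (div_pos (by linarith) (by linarith))

theorem modelRadius_neg_lt_one (R : ℝ) : modelRadius .neg R < 1 := by
  have h := Real.cosh_pos R
  rw [modelRadius, Real.sqrt_lt' one_pos, one_pow, div_lt_one (by linarith)]
  linarith

theorem geodesicBall_subset_modelDomain (m : ℕ) (K : SignType) (R : ℝ) :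
    geodesicBall m K R ⊆ modelDomain m K := by
  match K with
  | .zero => exact subset_univ _
  | .neg => exact Metric.closedBall_subset_ball (modelRadius_neg_lt_one R)
  | .pos => exact subset_univ _

/-- The constant `c` in the definition of `X_a`. -/
def fieldConst (K : SignType) (R : ℝ) : ℝ := match K with
  | .zero => 1
  | .neg => 2 / (1 - modelRadius .neg R ^ 2)
  | .pos => 2 / (1 + modelRadius .pos R ^ 2)

theorem X_eq {K : SignType} {R : ℝ} (hR : AdmissibleRadius K R) (a y : EuclideanSpace ℝ (Fin m)) :
    X K R a y = fieldConst K R •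
      ((inner ℝ y a : ℝ) • y - ((1 / 2 : ℝ) * (‖y‖ ^ 2 + modelRadius K R ^ 2)) • a) := by
  match K with
  | .zero =>
    -- The flat field is written with radius 1, the only admissible radius for K = 0.
    have : R = 1 := hR
    simp [X, fieldConst, modelRadius, this]
  | .neg => rfl
  | .pos => rfl

/-- The radial component vanishes on |y| = ρ, so X_a is tangent to ∂B. It vanishes to first order
there, which later balances the growing gradient of the cutoff. -/
theorem inner_X {K : SignType} {R : ℝ} (hR : AdmissibleRadius K R)
    (a y : EuclideanSpace ℝ (Fin m)) :
    inner ℝ (X K R a y) y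
      = fieldConst K R * (1 / 2) * inner ℝ y a * (‖y‖ ^ 2 - modelRadius K R ^ 2) := by
  rw [X_eq hR, inner_smul_left, inner_sub_left, inner_smul_left, inner_smul_left,
    real_inner_self_eq_norm_sq, real_inner_comm y a]
  simp
  ring

/-- `V_a` is the conformal factor of `X_a`. -/
theorem V_eq {K : SignType} {R : ℝ} (hR : AdmissibleRadius K R) {a y : EuclideanSpace ℝ (Fin m)}
    (hy : y ∈ modelDomain m K) :
    V K a y = fieldConst K R * inner ℝ y a
      - curv K * conformalFactor K y * inner ℝ (X K R a y) y := by
  rw [inner_X hR]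
  match K with
  | .zero => simp [V, fieldConst, curv]
  | .neg =>
    have h : ‖y‖ < 1 := by simpa [modelDomain] using hy
    have h0 : 1 - ‖y‖ ^ 2 ≠ 0 := by nlinarith [norm_nonneg y]
    have h1 : 1 - modelRadius .neg R ^ 2 ≠ 0 := by
      have h2 := modelRadius_neg_lt_one R
      have h3 := modelRadius_pos hR
      nlinarith
    simp only [V, fieldConst, curv, conformalFactor]
    field_simp
    ring
  | .pos =>
    have h0 : 1 + ‖y‖ ^ 2 ≠ 0 := by positivity
    have h1 : 1 + modelRadius .pos R ^ 2 ≠ 0 := by positivity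
    simp only [V, fieldConst, curv, conformalFactor]
    field_simp
    ring

/-- The derivative is the skew map v ↦ c(⟨a, v⟩ y - ⟨y, v⟩ a) plus the scalar c⟨y, a⟩: X_a is a
conformal Killing field of the Euclidean metric. -/
theorem hasFDerivAt_X {K : SignType} {R : ℝ} (hR : AdmissibleRadius K R)
    (a y : EuclideanSpace ℝ (Fin m)) :
    HasFDerivAt (X K R a) (fieldConst K R • ((innerSL ℝ a).smulRight y
      + (inner ℝ y a : ℝ) • ContinuousLinearMap.id ℝ (EuclideanSpace ℝ (Fin m))
      - (innerSL ℝ y).smulRight a)) y := by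
  have h : X K R a = fun y => fieldConst K R •
      ((inner ℝ a y : ℝ) • y - ((1 / 2 : ℝ) * (‖y‖ ^ 2 + modelRadius K R ^ 2)) • a) := by
    ext1 z
    rw [X_eq hR, real_inner_comm]
  rw [h]
  have hn : HasFDerivAt (fun z : EuclideanSpace ℝ (Fin m) => ‖z‖ ^ 2) (2 • innerSL ℝ y) y :=
    (hasStrictFDerivAt_norm_sq y).hasFDerivAt
  have h1 := ((innerSL ℝ a).hasFDerivAt (x := y)).smul (hasFDerivAt_id (𝕜 := ℝ) y)
  have h2 := (((hn.add_const (modelRadius K R ^ 2)).const_mul (1 / 2 : ℝ)).smul_const a)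
  refine ((h1.sub h2).const_smul (fieldConst K R)).congr_fderiv ?_
  ext1 v
  simp [real_inner_comm y a]
  module

theorem contDiff_X {K : SignType} {R : ℝ} (hR : AdmissibleRadius K R)
    (a : EuclideanSpace ℝ (Fin m)) : ContDiff ℝ ∞ (X K R a) := by
  have h : X K R a = fun y => fieldConst K R •
      ((inner ℝ y a : ℝ) • y - ((1 / 2 : ℝ) * (‖y‖ ^ 2 + modelRadius K R ^ 2)) • a) := by
    ext1 z
    rw [X_eq hR]
  rw [h]
  have hn : ContDiff ℝ ∞ (fun z : EuclideanSpace ℝ (Fin m) => ‖z‖ ^ 2) := contDiff_norm_sq ℝ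
  have hi : ContDiff ℝ ∞ (fun z : EuclideanSpace ℝ (Fin m) => (inner ℝ z a : ℝ)) :=
    contDiff_id.inner ℝ contDiff_const
  exact (contDiff_const (c := fieldConst K R)).smul ((hi.smul contDiff_id).sub
    ((contDiff_const.mul (hn.add contDiff_const)).smul contDiff_const))

theorem continuousOn_V (K : SignType) (a : EuclideanSpace ℝ (Fin m)) :
    ContinuousOn (V K a) (modelDomain m K) := by
  have hi : Continuous (fun z : EuclideanSpace ℝ (Fin m) => (inner ℝ z a : ℝ)) := by fun_prop
  match K with
  | .zero => exact hi.continuousOn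
  | .neg =>
    refine ContinuousOn.div (by fun_prop) (by fun_prop) fun y hy => ?_
    have h : ‖y‖ < 1 := by simpa [modelDomain] using hy
    nlinarith [norm_nonneg y]
  | .pos => exact (Continuous.div (by fun_prop) (by fun_prop) fun y => by positivity).continuousOn

end Geometry

end SpaceForm

end

open Set Filter Topology MeasureTheory
open scoped Manifold ContDiff

noncomputable section

namespace SpaceForm

/-! ### The flux form on a parametrized patch and its pointwise divergence. -/

section Patch

open Matrix

variable {n : ℕ}

theorem ofLp_dotProduct {m : ℕ} (v w : EuclideanSpace ℝ (Fin m)) :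
    v.ofLp ⬝ᵥ w.ofLp = inner ℝ v w := by
  simp [PiLp.inner_apply, dotProduct, mul_comm]

/-- The square matrix whose rows are `N` and the `v i`. -/
def frame (N : EuclideanSpace ℝ (Fin (n + 1))) (v : Fin n → EuclideanSpace ℝ (Fin (n + 1))) :
    Matrix (Fin (n + 1)) (Fin (n + 1)) ℝ :=
  frameMatrix N.ofLp fun i => (v i).ofLp

/-- A double sum of twice updated determinants against a symmetric array vanishes. -/
theorem sum_sum_det_updateRow_symm (M : Matrix (Fin (n + 1)) (Fin (n + 1)) ℝ)
    (Y : Fin (n + 1) → ℝ) (S : Fin n → Fin n → Fin (n + 1) → ℝ) (hS : ∀ i j, S i j = S j i) :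
    ∑ i : Fin n, ∑ j ∈ Finset.univ.erase i,
      ((M.updateRow i.succ Y).updateRow j.succ (S i j)).det = 0 := by
  -- Exchanging rows i and j turns the (i, j) term into minus the (j, i) term, so the double sum
  -- equals its own negative.
  have hswap : ∀ i j : Fin n, i ≠ j → ((M.updateRow i.succ Y).updateRow j.succ (S i j)).det
      = -((M.updateRow j.succ Y).updateRow i.succ (S j i)).det := by
    intro i j hij
    have hne : i.succ ≠ j.succ := fun h => hij (Fin.succ_injective _ h)
    have : ((M.updateRow i.succ Y).updateRow j.succ (S i j))
        = ((M.updateRow j.succ Y).updateRow i.succ (S j i)).submatrix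
          (Equiv.swap i.succ j.succ) id := by
      ext r c
      by_cases h0 : r = j.succ
      · subst h0
        simp [hS i j]
      · by_cases h1 : r = i.succ
        · subst h1
          simp [updateRow_ne hne, updateRow_ne hne.symm]
        · rw [updateRow_ne h0, updateRow_ne h1, submatrix_apply,
            Equiv.swap_apply_of_ne_of_ne h1 h0, updateRow_ne h1, updateRow_ne h0]
          rfl
    rw [this, det_permute, Equiv.Perm.sign_swap hne]
    simp
  set T := ∑ i : Fin n, ∑ j ∈ Finset.univ.erase i,
      ((M.updateRow i.succ Y).updateRow j.succ (S i j)).det with hT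
  have h1 : T = -T := by
    conv_lhs => rw [hT, Finset.sum_comm' (t' := Finset.univ) (s' := fun j => Finset.univ.erase j)
      (fun x y => by simp [ne_comm])]
    rw [hT, ← Finset.sum_neg_distrib]
    refine Finset.sum_congr rfl fun j _ => ?_
    rw [← Finset.sum_neg_distrib]
    refine Finset.sum_congr rfl fun i hi => ?_
    exact hswap i j (Finset.ne_of_mem_erase hi)
  linarith

/-- A parametrized hypersurface patch `x : U → B` with Euclidean unit normal `N`. -/
structure IsPatch (K : SignType) (R : ℝ) (U : Set (EuclideanSpace ℝ (Fin n)))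
    (x N : EuclideanSpace ℝ (Fin n) → EuclideanSpace ℝ (Fin (n + 1))) : Prop where
  uniqueDiffOn : UniqueDiffOn ℝ U
  subset_closure : U ⊆ closure (interior U)
  contDiffOn : ContDiffOn ℝ ∞ x U
  contDiffOn_normal : ContDiffOn ℝ ∞ N U
  mem : ∀ y ∈ U, x y ∈ geodesicBall (n + 1) K R
  unit : ∀ y ∈ U, inner ℝ (N y) (N y) = (1 : ℝ)
  normal : ∀ y ∈ U, ∀ v, inner ℝ (N y) (fderivWithin ℝ x U y v) = (0 : ℝ)
  injective : ∀ y ∈ U, Function.Injective (fderivWithin ℝ x U y)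

/-- The partial derivatives of a map on a patch. -/
def partialDeriv {E : Type*} [NormedAddCommGroup E] [NormedSpace ℝ E]
    (U : Set (EuclideanSpace ℝ (Fin n))) (f : EuclideanSpace ℝ (Fin n) → E) (i : Fin n)
    (y : EuclideanSpace ℝ (Fin n)) : E :=
  fderivWithin ℝ f U y (EuclideanSpace.single i 1)

/-- `λ (1 - t K ⟨x, N⟩)`. -/
def tangentFactor {m : ℕ} (K : SignType) (t : ℝ) (p N : EuclideanSpace ℝ (Fin m)) : ℝ :=
  conformalFactor K p * (1 - t * curv K * inner ℝ p N)

/-- `λ (∂_i x + t ∇̄_i ν)`, for `N = λ ν`. -/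
def parallelDeriv (K : SignType) (t : ℝ) (U : Set (EuclideanSpace ℝ (Fin n)))
    (x N : EuclideanSpace ℝ (Fin n) → EuclideanSpace ℝ (Fin (n + 1))) (i : Fin n)
    (y : EuclideanSpace ℝ (Fin n)) : EuclideanSpace ℝ (Fin (n + 1)) :=
  tangentFactor K t (x y) (N y) • partialDeriv U x i y + t • partialDeriv U N i y

/-- The component of the flux form. -/
def flux (K : SignType) (R : ℝ) (a : EuclideanSpace ℝ (Fin (n + 1))) (t : ℝ)
    (U : Set (EuclideanSpace ℝ (Fin n)))
    (x N : EuclideanSpace ℝ (Fin n) → EuclideanSpace ℝ (Fin (n + 1))) (i : Fin n)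
    (y : EuclideanSpace ℝ (Fin n)) : ℝ :=
  conformalFactor K (x y) * ((frame (N y) fun j => parallelDeriv K t U x N j y).updateRow i.succ
    (X K R a (x y)).ofLp).det

/-- The `t`-derivative of `det (N, w_1, …, w_n)`. -/
def parallelDetDeriv (K : SignType) (t : ℝ) (U : Set (EuclideanSpace ℝ (Fin n)))
    (x N : EuclideanSpace ℝ (Fin n) → EuclideanSpace ℝ (Fin (n + 1)))
    (y : EuclideanSpace ℝ (Fin n)) : ℝ :=
  ∑ i : Fin n, ((frame (N y) fun j => parallelDeriv K t U x N j y).updateRow i.succ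
    (partialDeriv U N i y - (curv K * conformalFactor K (x y) * inner ℝ (x y) (N y)) •
      partialDeriv U x i y).ofLp).det

variable {K : SignType} {R : ℝ} {U : Set (EuclideanSpace ℝ (Fin n))}
  {x N : EuclideanSpace ℝ (Fin n) → EuclideanSpace ℝ (Fin (n + 1))}

theorem contDiffOn_partialDeriv {E : Type*} [NormedAddCommGroup E] [NormedSpace ℝ E]
    {f : EuclideanSpace ℝ (Fin n) → E} (hf : ContDiffOn ℝ ∞ f U) (hU : UniqueDiffOn ℝ U)
    (i : Fin n) : ContDiffOn ℝ ∞ (partialDeriv U f i) U :=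
  (hf.fderivWithin hU (by simp)).clm_apply contDiffOn_const

theorem hasFDerivWithinAt_of_contDiffOn {E : Type*} [NormedAddCommGroup E] [NormedSpace ℝ E]
    {f : EuclideanSpace ℝ (Fin n) → E} (hf : ContDiffOn ℝ ∞ f U)
    {y : EuclideanSpace ℝ (Fin n)} (hy : y ∈ U) :
    HasFDerivWithinAt f (fderivWithin ℝ f U y) U y :=
  (hf.differentiableOn (by simp) y hy).hasFDerivWithinAt

/-- Schwarz's theorem; at boundary points of U it rests on these being limits of interior points. -/
theorem partialDeriv_partialDeriv_comm {E : Type*} [NormedAddCommGroup E] [NormedSpace ℝ E]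
    {f : EuclideanSpace ℝ (Fin n) → E} (hf : ContDiffOn ℝ ∞ f U) (hU : UniqueDiffOn ℝ U)
    (hcl : U ⊆ closure (interior U)) (i j : Fin n) {y : EuclideanSpace ℝ (Fin n)} (hy : y ∈ U) :
    partialDeriv U (partialDeriv U f j) i y = partialDeriv U (partialDeriv U f i) j y := by
  have hsymm := (hf y hy).isSymmSndFDerivWithinAt
    (by rw [minSmoothness_of_isRCLikeNormedField]; exact WithTop.coe_le_coe.2 le_top) hU (hcl hy) hy
  have hd : ∀ i j, partialDeriv U (partialDeriv U f j) i y
      = fderivWithin ℝ (fderivWithin ℝ f U) U y (EuclideanSpace.single i 1)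
        (EuclideanSpace.single j 1) := by
    intro i j
    have h1 : HasFDerivWithinAt (fderivWithin ℝ f U) (fderivWithin ℝ (fderivWithin ℝ f U) U y) U y :=
      hasFDerivWithinAt_of_contDiffOn (hf.fderivWithin hU (by simp)) hy
    have h2 := (h1.clm_apply (hasFDerivWithinAt_const (EuclideanSpace.single j (1 : ℝ)) y U))
    rw [partialDeriv]
    have h3 := h2.fderivWithin (hU y hy)
    rw [show partialDeriv U f j = fun z => fderivWithin ℝ f U z (EuclideanSpace.single j 1) from rfl,
      h3]
    simp
  rw [hd, hd]
  exact hsymm _ _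

theorem IsPatch.mem_domain (h : IsPatch K R U x N) {y} (hy : y ∈ U) :
    x y ∈ modelDomain (n + 1) K :=
  geodesicBall_subset_modelDomain _ _ _ (h.mem y hy)

theorem IsPatch.inner_partialDeriv_normal_self (h : IsPatch K R U x N) {y} (hy : y ∈ U)
    (i : Fin n) : inner ℝ (partialDeriv U N i y) (N y) = (0 : ℝ) := by
  have hN := hasFDerivWithinAt_of_contDiffOn h.contDiffOn_normal hy
  have h1 := hN.inner ℝ hN
  have h2 : HasFDerivWithinAt (fun z => (inner ℝ (N z) (N z) : ℝ)) (0 : _ →L[ℝ] ℝ) U y :=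
    (hasFDerivWithinAt_const (1 : ℝ) y U).congr (fun z hz => h.unit z hz) (h.unit y hy)
  have h3 := congrArg (fun L => L (EuclideanSpace.single i (1 : ℝ)))
    ((h.uniqueDiffOn y hy).eq h1 h2)
  simp at h3
  rw [real_inner_comm] at h3
  rw [partialDeriv]
  linarith

/-- Differentiate ⟨N, ∂_j x⟩ = 0. Together with Schwarz's theorem this yields the symmetry of the
second fundamental form. -/
theorem IsPatch.inner_partialDeriv_normal (h : IsPatch K R U x N) {y} (hy : y ∈ U)
    (i j : Fin n) : inner ℝ (partialDeriv U N i y) (partialDeriv U x j y)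
      = -(inner ℝ (N y) (partialDeriv U (partialDeriv U x j) i y) : ℝ) := by
  have hN := hasFDerivWithinAt_of_contDiffOn h.contDiffOn_normal hy
  have hx := hasFDerivWithinAt_of_contDiffOn
    (contDiffOn_partialDeriv h.contDiffOn h.uniqueDiffOn j) hy
  have h1 := hN.inner ℝ hx
  have h2 : HasFDerivWithinAt (fun z => (inner ℝ (N z) (partialDeriv U x j z) : ℝ))
      (0 : _ →L[ℝ] ℝ) U y :=
    (hasFDerivWithinAt_const (0 : ℝ) y U).congr (fun z hz => h.normal z hz _) (h.normal y hy _)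
  have h3 := congrArg (fun L => L (EuclideanSpace.single i (1 : ℝ)))
    ((h.uniqueDiffOn y hy).eq h1 h2)
  simp at h3
  rw [partialDeriv, partialDeriv, partialDeriv] at *
  linarith

theorem IsPatch.inner_partialDeriv_normal_symm (h : IsPatch K R U x N) {y} (hy : y ∈ U)
    (i j : Fin n) : inner ℝ (partialDeriv U N i y) (partialDeriv U x j y)
      = (inner ℝ (partialDeriv U N j y) (partialDeriv U x i y) : ℝ) := by
  rw [h.inner_partialDeriv_normal hy, h.inner_partialDeriv_normal hy,
    partialDeriv_partialDeriv_comm h.contDiffOn h.uniqueDiffOn h.subset_closure i j hy]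

theorem IsPatch.linearIndependent (h : IsPatch K R U x N) {y} (hy : y ∈ U) :
    LinearIndependent ℝ fun i => partialDeriv U x i y := by
  have h1 := (EuclideanSpace.basisFun (Fin n) ℝ).toBasis.linearIndependent.map'
    (fderivWithin ℝ x U y : EuclideanSpace ℝ (Fin n) →ₗ[ℝ] EuclideanSpace ℝ (Fin (n + 1)))
    (LinearMap.ker_eq_bot.2 (h.injective y hy))
  have h2 : (fun i => partialDeriv U x i y) = (fderivWithin ℝ x U y :
      EuclideanSpace ℝ (Fin n) →ₗ[ℝ] EuclideanSpace ℝ (Fin (n + 1))) ∘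
      (EuclideanSpace.basisFun (Fin n) ℝ).toBasis := by
    ext1 i
    simp [partialDeriv]
  rw [h2]
  exact h1

/-- The square of the Euclidean area density is the Gram determinant. -/
theorem IsPatch.det_frame_sq (h : IsPatch K R U x N) {y} (hy : y ∈ U) :
    (frame (N y) fun i => partialDeriv U x i y).det ^ 2
      = (Matrix.gram ℝ fun i => partialDeriv U x i y).det := by
  rw [pow_two, frame, det_frameMatrix_mul_det_frameMatrix]
  · congr 1
    ext i j
    simp [Matrix.gram, ofLp_dotProduct]
  · rw [ofLp_dotProduct, h.unit y hy]
  · intro i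
    rw [ofLp_dotProduct, real_inner_comm, partialDeriv, h.normal y hy]

theorem IsPatch.det_frame_ne_zero (h : IsPatch K R U x N) {y} (hy : y ∈ U) :
    (frame (N y) fun i => partialDeriv U x i y).det ≠ 0 := by
  have h1 := (Matrix.posDef_gram_of_linearIndependent (𝕜 := ℝ) (h.linearIndependent hy)).det_pos
  rw [← h.det_frame_sq hy] at h1
  intro h0
  rw [h0] at h1
  simp at h1

theorem IsPatch.hasFDerivWithinAt_conformalFactor (h : IsPatch K R U x N) {y} (hy : y ∈ U) :
    HasFDerivWithinAt (fun z => conformalFactor K (x z))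
      ((-curv K * conformalFactor K (x y) ^ 2) •
        ((innerSL ℝ (x y)).comp (fderivWithin ℝ x U y))) U y := by
  have h1 := (differentiableAt_conformalFactor (h.mem_domain hy)).hasFDerivAt.comp_hasFDerivWithinAt
    y (hasFDerivWithinAt_of_contDiffOn h.contDiffOn hy)
  refine h1.congr_fderiv ?_
  ext1 v
  simp [fderiv_conformalFactor (h.mem_domain hy)]

/-- Since ⟨∂_i x, N⟩ = 0, both ∂_i λ and ∂_i ⟨x, N⟩ combine into -Kλ⟨x, w_i⟩. That the derivative
depends on i only through w_i is what makes Cramer's rule applicable to the divergence. -/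
theorem IsPatch.tangentFactor_deriv (h : IsPatch K R U x N) (t : ℝ) {y} (hy : y ∈ U) :
    ∃ L : EuclideanSpace ℝ (Fin n) →L[ℝ] ℝ,
      HasFDerivWithinAt (fun z => tangentFactor K t (x z) (N z)) L U y ∧
      ∀ i, L (EuclideanSpace.single i 1) = inner ℝ (parallelDeriv K t U x N i y)
        ((-(curv K * conformalFactor K (x y))) • x y) := by
  have hx := hasFDerivWithinAt_of_contDiffOn h.contDiffOn hy
  have hN := hasFDerivWithinAt_of_contDiffOn h.contDiffOn_normal hy
  have h1 := (h.hasFDerivWithinAt_conformalFactor hy).mul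
    (((hx.inner ℝ hN).const_mul (t * curv K)).const_sub 1)
  refine ⟨_, h1, fun i => ?_⟩
  have h2 : inner ℝ (fderivWithin ℝ x U y (EuclideanSpace.single i 1)) (N y) = (0 : ℝ) := by
    rw [real_inner_comm]
    exact h.normal y hy _
  simp [parallelDeriv, partialDeriv, tangentFactor, inner_add_left, inner_smul_left,
    inner_smul_right, h2]
  rw [real_inner_comm (x y), real_inner_comm (x y)]
  ring

/-- The coordinates of a Euclidean vector, as a continuous linear map. -/
def coordsL (m : ℕ) : EuclideanSpace ℝ (Fin m) →L[ℝ] (Fin m → ℝ) :=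
  (PiLp.continuousLinearEquiv 2 ℝ (fun _ : Fin m => ℝ) : EuclideanSpace ℝ (Fin m) →L[ℝ] _)

@[simp] theorem coordsL_apply {m : ℕ} (v : EuclideanSpace ℝ (Fin m)) : coordsL m v = v.ofLp := rfl

/-- This takes the place of the Codazzi equation: apart from the first term, ∂_i w_j is made of
second derivatives of x and N and is symmetric in i and j. -/
theorem IsPatch.parallelDeriv_deriv (h : IsPatch K R U x N) (t : ℝ) {y} (hy : y ∈ U) (j : Fin n) :
    ∃ L : EuclideanSpace ℝ (Fin n) →L[ℝ] EuclideanSpace ℝ (Fin (n + 1)),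
      HasFDerivWithinAt (parallelDeriv K t U x N j) L U y ∧
      ∀ i, L (EuclideanSpace.single i 1) = (inner ℝ (parallelDeriv K t U x N i y)
          ((-(curv K * conformalFactor K (x y))) • x y) : ℝ) • partialDeriv U x j y
        + (tangentFactor K t (x y) (N y) • partialDeriv U (partialDeriv U x j) i y
          + t • partialDeriv U (partialDeriv U N j) i y) := by
  obtain ⟨L, hL, hL'⟩ := h.tangentFactor_deriv t hy
  have hx := hasFDerivWithinAt_of_contDiffOn
    (contDiffOn_partialDeriv h.contDiffOn h.uniqueDiffOn j) hy
  have hN := hasFDerivWithinAt_of_contDiffOn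
    (contDiffOn_partialDeriv h.contDiffOn_normal h.uniqueDiffOn j) hy
  refine ⟨_, (hL.smul hx).add (hN.const_smul t), fun i => ?_⟩
  simp [hL', partialDeriv]
  abel

/-- The pointwise divergence of the flux. -/
theorem IsPatch.divergence_flux (hR : AdmissibleRadius K R) (h : IsPatch K R U x N)
    (a : EuclideanSpace ℝ (Fin (n + 1))) (t : ℝ) {y} (hy : y ∈ U) :
    ∃ L : Fin n → EuclideanSpace ℝ (Fin n) →L[ℝ] ℝ,
      (∀ i, HasFDerivWithinAt (flux K R a t U x N i) (L i) U y) ∧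
      ∑ i, L i (EuclideanSpace.single i 1)
        = V K a (x y) * (n * (frame (N y) fun j => parallelDeriv K t U x N j y).det
            - t * parallelDetDeriv K t U x N y)
          - conformalFactor K (x y) * inner ℝ (X K R a (x y)) (N y)
            * parallelDetDeriv K t U x N y := by
  choose W hW hW' using fun j => h.parallelDeriv_deriv t hy j
  have hx := hasFDerivWithinAt_of_contDiffOn h.contDiffOn hy
  have hN := hasFDerivWithinAt_of_contDiffOn h.contDiffOn_normal hy
  have hX := (hasFDerivAt_X hR a (x y)).comp_hasFDerivWithinAt y hx
  set DX := (fieldConst K R • ((innerSL ℝ a).smulRight (x y)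
      + (inner ℝ (x y) a : ℝ) • ContinuousLinearMap.id ℝ (EuclideanSpace ℝ (Fin (n + 1)))
      - (innerSL ℝ (x y)).smulRight a)) with hDX
  set M := frame (N y) fun j => parallelDeriv K t U x N j y with hM
  set Ξ := frame (N y) fun j => partialDeriv U x j y with hΞ
  set A := frame 0 fun j => partialDeriv U N j y with hA
  set Y := (X K R a (x y)).ofLp with hY
  set b := ((-(curv K * conformalFactor K (x y))) • x y).ofLp with hb
  let g' : Fin (n + 1) → EuclideanSpace ℝ (Fin n) →L[ℝ] EuclideanSpace ℝ (Fin (n + 1)) :=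
    Fin.cons (fderivWithin ℝ N U y) W
  let rows : Fin n → Fin (n + 1) → EuclideanSpace ℝ (Fin n) →L[ℝ] (Fin (n + 1) → ℝ) := fun i r =>
    (coordsL (n + 1)).comp (Function.update g' i.succ (DX.comp (fderivWithin ℝ x U y)) r)
  have hrows : ∀ i r, HasFDerivWithinAt (fun z =>
      ((frame (N z) fun j => parallelDeriv K t U x N j z).updateRow i.succ
        (X K R a (x z)).ofLp) r) (rows i r) U y := by
    intro i r
    by_cases hr : r = i.succ
    · subst hr
      simp only [updateRow_self, rows, Function.update_self]
      exact (coordsL (n + 1)).hasFDerivAt.comp_hasFDerivWithinAt y hX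
    · simp only [updateRow_ne hr, rows, Function.update_of_ne hr]
      refine (coordsL (n + 1)).hasFDerivAt.comp_hasFDerivWithinAt (f := fun z => (Fin.cons (N z)
        (fun j => parallelDeriv K t U x N j z) : Fin (n + 1) → _) r) y ?_ |>.congr ?_ ?_
      · refine Fin.cases ?_ (fun j => ?_) r
        · exact hN
        · exact hW j
      · intro z _
        refine Fin.cases ?_ (fun j => ?_) r <;> rfl
      · refine Fin.cases ?_ (fun j => ?_) r <;> rfl
  refine ⟨_, fun i => (h.hasFDerivWithinAt_conformalFactor hy).mul
    (hasFDerivWithinAt_det (hrows i)), ?_⟩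
  have hdet : Ξ.det ≠ 0 := h.det_frame_ne_zero hy
  have hΞN : Ξ *ᵥ Ξ 0 = Pi.single 0 1 := by
    ext r
    refine Fin.cases ?_ (fun i => ?_) r
    · simpa [mulVec, hΞ, frame, ofLp_dotProduct] using h.unit y hy
    · simp only [mulVec, hΞ, frame, frameMatrix_succ, frameMatrix_zero, ofLp_dotProduct]
      rw [real_inner_comm, partialDeriv, h.normal y hy]
      simp
  have hsymm : (A * Ξᵀ).IsSymm := by
    have hmul : ∀ r s, (A * Ξᵀ) r s = A r ⬝ᵥ Ξ s := fun r s => rfl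
    ext r s
    rw [transpose_apply, hmul, hmul]
    refine Fin.cases ?_ (fun i => ?_) r <;> refine Fin.cases ?_ (fun j => ?_) s
    · rfl
    · simp only [hA, hΞ, frame, frameMatrix_succ, frameMatrix_zero, ofLp_dotProduct]
      rw [h.inner_partialDeriv_normal_self hy, inner_zero_left]
    · simp only [hA, hΞ, frame, frameMatrix_succ, frameMatrix_zero, ofLp_dotProduct]
      rw [h.inner_partialDeriv_normal_self hy, inner_zero_left]
    · simp only [hA, hΞ, frame, frameMatrix_succ, ofLp_dotProduct]
      exact h.inner_partialDeriv_normal_symm hy j i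
  have hMs : ∀ i : Fin n, M i.succ = tangentFactor K t (x y) (N y) • Ξ i.succ + t • A i.succ :=
    fun i => rfl
  have hdiv := divergence_algebra Ξ A M (tangentFactor K t (x y) (N y)) t hdet hΞN hsymm rfl hMs
    rfl a.ofLp (x y).ofLp Y b (fieldConst K R)
  -- The symmetric part of ∂_i w_j; it cancels in the double sum because determinants are
  -- alternating.
  let S : Fin n → Fin n → Fin (n + 1) → ℝ := fun i j =>
    (tangentFactor K t (x y) (N y) • partialDeriv U (partialDeriv U x j) i y
          + t • partialDeriv U (partialDeriv U N j) i y).ofLp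
  have hS : ∀ i j, S i j = S j i := fun i j => by
    simp only [S]
    rw [partialDeriv_partialDeriv_comm h.contDiffOn h.uniqueDiffOn h.subset_closure i j hy,
      partialDeriv_partialDeriv_comm h.contDiffOn_normal h.uniqueDiffOn h.subset_closure i j hy]
  have hSS := sum_sum_det_updateRow_symm M Y S hS
  have hterm : ∀ i : Fin n, detDeriv (M.updateRow i.succ Y) (rows i) (EuclideanSpace.single i 1)
      = ((M.updateRow i.succ Y).updateRow 0 (A i.succ)).det
      + (M.updateRow i.succ (fieldConst K R • ((Ξ i.succ ⬝ᵥ a.ofLp) • (x y).ofLp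
          + ((x y).ofLp ⬝ᵥ a.ofLp) • Ξ i.succ - ((x y).ofLp ⬝ᵥ Ξ i.succ) • a.ofLp))).det
      + ∑ j ∈ Finset.univ.erase i,
          (M i.succ ⬝ᵥ b) * ((M.updateRow i.succ Y).updateRow j.succ (Ξ j.succ)).det
      + ∑ j ∈ Finset.univ.erase i,
          ((M.updateRow i.succ Y).updateRow j.succ (S i j)).det := by
    intro i
    rw [detDeriv_apply, Fin.sum_univ_succ, ← Finset.add_sum_erase _ _ (Finset.mem_univ i)]
    have h0 : rows i 0 (EuclideanSpace.single i 1) = A i.succ := by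
      simp only [rows]
      rw [Function.update_of_ne (Fin.succ_ne_zero i).symm]
      rfl
    have hi : rows i i.succ (EuclideanSpace.single i 1) = fieldConst K R •
        ((Ξ i.succ ⬝ᵥ a.ofLp) • (x y).ofLp + ((x y).ofLp ⬝ᵥ a.ofLp) • Ξ i.succ
          - ((x y).ofLp ⬝ᵥ Ξ i.succ) • a.ofLp) := by
      simp only [rows, Function.update_self, hΞ, frame, frameMatrix_succ, ofLp_dotProduct]
      rw [real_inner_comm a]
      rfl
    have hj : ∀ j ∈ Finset.univ.erase i,
        ((M.updateRow i.succ Y).updateRow j.succ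
          (rows i j.succ (EuclideanSpace.single i 1))).det
        = (M i.succ ⬝ᵥ b) * ((M.updateRow i.succ Y).updateRow j.succ (Ξ j.succ)).det
          + ((M.updateRow i.succ Y).updateRow j.succ (S i j)).det := by
      intro j hj
      have hne : j.succ ≠ i.succ := fun h => (Finset.ne_of_mem_erase hj) (Fin.succ_injective _ h)
      have : rows i j.succ (EuclideanSpace.single i 1) = (M i.succ ⬝ᵥ b) • Ξ j.succ + S i j := by
        simp only [rows, Function.update_of_ne hne, g', Fin.cons_succ,
          ContinuousLinearMap.comp_apply, hW', coordsL_apply, hM, hΞ, frame, frameMatrix_succ, hb,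
          ofLp_dotProduct, S]
        rfl
      rw [this, det_updateRow_add, det_updateRow_smul]
    rw [h0, hi, updateRow_idem, Finset.sum_congr rfl hj, Finset.sum_add_distrib]
    ring
  have hlam : ∀ i : Fin n, ((-curv K * conformalFactor K (x y) ^ 2) •
        ((innerSL ℝ (x y)).comp (fderivWithin ℝ x U y))) (EuclideanSpace.single i 1)
      = conformalFactor K (x y) * (Ξ i.succ ⬝ᵥ b) := by
    intro i
    simp only [hΞ, frame, frameMatrix_succ, hb, ofLp_dotProduct, inner_smul_right]
    rw [real_inner_comm, partialDeriv]
    simp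
    ring
  have hYb : fieldConst K R * ((x y).ofLp ⬝ᵥ a.ofLp) + Y ⬝ᵥ b = V K a (x y) := by
    rw [V_eq hR (h.mem_domain hy), hY, hb, ofLp_dotProduct, ofLp_dotProduct, inner_smul_right]
    ring
  -- A_i + (N·b) ξ_i = ∂_i N - Kλ⟨x, N⟩ ξ_i is the derivative of w_i with respect to t.
  have hD : ∑ i : Fin n, (M.updateRow i.succ (A i.succ + (Ξ 0 ⬝ᵥ b) • Ξ i.succ)).det
      = parallelDetDeriv K t U x N y := by
    rw [parallelDetDeriv]
    refine Finset.sum_congr rfl fun i _ => ?_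
    have : A i.succ + (Ξ 0 ⬝ᵥ b) • Ξ i.succ = (partialDeriv U N i y -
        (curv K * conformalFactor K (x y) * inner ℝ (x y) (N y)) • partialDeriv U x i y).ofLp := by
      simp only [hΞ, frame, frameMatrix_zero, hb, ofLp_dotProduct, inner_smul_right]
      rw [real_inner_comm, sub_eq_add_neg, ← neg_smul]
      simp [hA, frame]
    rw [this]
  -- Write w_i = λ ξ_i + t(A_i + (N·b) ξ_i) and put it into Euler's identity for the n tangential
  -- rows.
  have hEuler : conformalFactor K (x y) * ∑ i : Fin n, (M.updateRow i.succ (Ξ i.succ)).det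
      = n * M.det - t * parallelDetDeriv K t U x N y := by
    rw [← sum_det_updateRow_self_succ, ← hD, Finset.mul_sum, Finset.mul_sum,
      ← Finset.sum_sub_distrib]
    refine Finset.sum_congr rfl fun i _ => ?_
    have : M i.succ = conformalFactor K (x y) • Ξ i.succ
        + t • (A i.succ + (Ξ 0 ⬝ᵥ b) • Ξ i.succ) := by
      have : Ξ 0 ⬝ᵥ b = -(curv K * conformalFactor K (x y)) * inner ℝ (x y) (N y) := by
        simp only [hΞ, frame, frameMatrix_zero, hb, ofLp_dotProduct, inner_smul_right]
        rw [real_inner_comm]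
      rw [hMs, this, tangentFactor]
      module
    conv_rhs => rw [this]
    rw [det_updateRow_add, det_updateRow_smul, det_updateRow_smul]
    ring
  have hYN : Y ⬝ᵥ Ξ 0 = inner ℝ (X K R a (x y)) (N y) := by
    simp only [hY, hΞ, frame, frameMatrix_zero, ofLp_dotProduct]
  rw [hD, hYb, hYN] at hdiv
  have hfin : ∀ i : Fin n, (conformalFactor K (x y) • detDeriv (M.updateRow i.succ Y) (rows i)
        + (M.updateRow i.succ Y).det • ((-curv K * conformalFactor K (x y) ^ 2) •
        ((innerSL ℝ (x y)).comp (fderivWithin ℝ x U y)))) (EuclideanSpace.single i 1)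
      = conformalFactor K (x y) * (((M.updateRow i.succ Y).updateRow 0 (A i.succ)).det
      + (M.updateRow i.succ (fieldConst K R • ((Ξ i.succ ⬝ᵥ a.ofLp) • (x y).ofLp
          + ((x y).ofLp ⬝ᵥ a.ofLp) • Ξ i.succ - ((x y).ofLp ⬝ᵥ Ξ i.succ) • a.ofLp))).det
      + ∑ j ∈ Finset.univ.erase i,
          (M i.succ ⬝ᵥ b) * ((M.updateRow i.succ Y).updateRow j.succ (Ξ j.succ)).det
      + (Ξ i.succ ⬝ᵥ b) * (M.updateRow i.succ Y).det)
      + conformalFactor K (x y) * ∑ j ∈ Finset.univ.erase i,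
          ((M.updateRow i.succ Y).updateRow j.succ (S i j)).det := by
    intro i
    rw [_root_.add_apply, _root_.smul_apply, _root_.smul_apply, hterm, hlam, smul_eq_mul,
      smul_eq_mul]
    ring
  refine (Finset.sum_congr rfl fun i _ => hfin i).trans ?_
  rw [Finset.sum_add_distrib, ← Finset.mul_sum, ← Finset.mul_sum, hdiv, hSS, ← hEuler]
  ring

end Patch

end SpaceForm

end

open Set Filter Topology MeasureTheory
open scoped Manifold ContDiff

noncomputable section

namespace SpaceForm

/-! ### The divergence theorem on a relatively open subset of the half space. -/

section HalfSpaceDivergence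

/-- The divergence theorem on a relatively open subset `U` of the half space `{y | 0 ≤ y 0}`, for
fields with compact support in `U` that are tangent to the boundary hyperplane. -/
theorem integral_divergence_halfSpace {n : ℕ} [NeZero n] {O U C : Set (EuclideanSpace ℝ (Fin n))}
    (hO : IsOpen O) (hU : U = O ∩ {y | 0 ≤ y 0}) (hUd : UniqueDiffOn ℝ U) (hC : IsCompact C)
    (hCU : C ⊆ U) {Z : Fin n → EuclideanSpace ℝ (Fin n) → ℝ}
    {L : Fin n → EuclideanSpace ℝ (Fin n) → EuclideanSpace ℝ (Fin n) →L[ℝ] ℝ}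
    (hZ : ∀ i, ∀ y ∈ U, HasFDerivWithinAt (Z i) (L i y) U y)
    (hsupp : ∀ i, ∀ y ∈ U, y ∉ C → Z i y = 0)
    (hb : ∀ y ∈ U, y 0 = 0 → Z 0 y = 0)
    (hcont : ContinuousOn (fun y => ∑ i, L i y (EuclideanSpace.single i 1)) C) :
    ∫ y in U, ∑ i, L i y (EuclideanSpace.single i 1) = 0 := by
  obtain ⟨n', rfl⟩ : ∃ n', n = n' + 1 := Nat.exists_eq_succ_of_ne_zero (NeZero.ne n)
  classical
  have hUmeas : MeasurableSet U := by
    rw [hU]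
    exact hO.measurableSet.inter (measurableSet_le measurable_const (by fun_prop))
  have hnear : ∀ y ∈ U, y ∉ C → ∀ᶠ z in 𝓝 y, z ∉ C := fun y _ hyC =>
    hC.isClosed.isOpen_compl.mem_nhds hyC
  -- Off the compact set the field vanishes locally in U, and unique differentiability forces the
  -- chosen derivatives to vanish as well.
  have hL0 : ∀ i, ∀ y ∈ U, y ∉ C → L i y = 0 := by
    intro i y hy hyC
    refine (hUd y hy).eq (hZ i y hy) ?_
    refine (hasFDerivWithinAt_const (0 : ℝ) y U).congr_of_eventuallyEq ?_ (hsupp i y hy hyC)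
    filter_upwards [nhdsWithin_le_nhds (hnear y hy hyC), self_mem_nhdsWithin] with z hz hzU
    exact hsupp i z hzU hz
  set g := fun y => ∑ i, L i y (EuclideanSpace.single i (1 : ℝ)) with hg
  -- Extension by zero. Across the hyperplane y 0 = 0 this may jump, so regularity is claimed only
  -- on the closed half space.
  let f : Fin (n' + 1) → EuclideanSpace ℝ (Fin (n' + 1)) → ℝ := fun i => U.indicator (Z i)
  let f' : Fin (n' + 1) → EuclideanSpace ℝ (Fin (n' + 1)) →
    EuclideanSpace ℝ (Fin (n' + 1)) →L[ℝ] ℝ := fun i => U.indicator (L i)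
  have hfC : ∀ i y, y ∉ C → f i y = 0 := by
    intro i y hy
    by_cases hyU : y ∈ U
    · simp only [f, indicator_of_mem hyU, hsupp i y hyU hy]
    · simp only [f, indicator_of_notMem hyU]
  have hgC : C.indicator g = fun y => ∑ i, f' i y (EuclideanSpace.single i 1) := by
    ext y
    by_cases hy : y ∈ C
    · simp only [indicator_of_mem hy, f', indicator_of_mem (hCU hy), hg]
    · rw [indicator_of_notMem hy]
      symm
      refine Finset.sum_eq_zero fun i _ => ?_
      by_cases hyU : y ∈ U
      · simp [f', indicator_of_mem hyU, hL0 i y hyU hy]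
      · simp [f', indicator_of_notMem hyU]
  have hint : Integrable (C.indicator g) :=
    (integrable_indicator_iff hC.measurableSet).2 (hcont.integrableOn_compact hC)
  have h1 : ∫ y in U, g y = ∫ y, C.indicator g y := by
    rw [← integral_indicator hUmeas, hgC]
    congr 1
    ext y
    by_cases hy : y ∈ U
    · simp only [indicator_of_mem hy, f', hg]
    · simp [indicator_of_notMem hy, f']
  obtain ⟨r, hr0, hr⟩ : ∃ r : ℝ, 0 < r ∧ C ⊆ Metric.ball 0 r := by
    obtain ⟨r, hr⟩ := hC.isBounded.subset_ball 0
    exact ⟨max r 1, by positivity, hr.trans (Metric.ball_subset_ball (le_max_left _ _))⟩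
  have hcoord : ∀ y ∈ C, ∀ i, |y i| < r := by
    intro y hy i
    have h2 : ‖y‖ < r := by simpa using hr hy
    have h3 := PiLp.norm_apply_le y i
    rw [Real.norm_eq_abs] at h3
    linarith
  -- The box is [0, r] × [-r, r]^n'. Its face y 0 = 0 lies in the boundary hyperplane, where the
  -- normal component vanishes; every other face misses C.
  let a : Fin (n' + 1) → ℝ := Function.update (fun _ => -r) 0 0
  let b : Fin (n' + 1) → ℝ := fun _ => r
  have ha0 : a 0 = 0 := by simp [a]
  have hai : ∀ i, i ≠ 0 → a i = -r := fun i hi => by simp [a, Function.update_of_ne hi]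
  have hle : a ≤ b := by
    intro i
    by_cases hi : i = 0
    · subst hi; rw [ha0]; exact hr0.le
    · rw [hai i hi]; simp only [b]; linarith
  let T : (Fin (n' + 1) → ℝ) ≃L[ℝ] EuclideanSpace ℝ (Fin (n' + 1)) :=
    (PiLp.continuousLinearEquiv 2 ℝ (fun _ : Fin (n' + 1) => ℝ)).symm
  have hT : ∀ v i, T v i = v i := fun v i => rfl
  have hTs : ∀ i : Fin (n' + 1), T (Pi.single i 1) = EuclideanSpace.single i 1 := fun i => rfl
  have hvol : MeasurePreserving T :=
    EuclideanSpace.volume_preserving_symm_measurableEquiv_toLp (Fin (n' + 1)) |>.symm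
  have hbox : ∀ v, T v ∈ C → v ∈ Icc a b := by
    intro v hv
    have hv0 : 0 ≤ v 0 := by
      have := hCU hv
      rw [hU] at this
      exact this.2
    rw [mem_Icc, Pi.le_def, Pi.le_def]
    refine ⟨fun i => ?_, fun i => ?_⟩
    · by_cases hi : i = 0
      · subst hi; rw [ha0]; exact hv0
      · rw [hai i hi]; exact (abs_lt.1 (hcoord _ hv i)).1.le
    · exact (abs_lt.1 (hcoord _ hv i)).2.le
  have h2 : ∫ y, C.indicator g y = ∫ v in Icc a b, ∑ i, (f' i (T v)).comp
      (T : (Fin (n' + 1) → ℝ) →L[ℝ] EuclideanSpace ℝ (Fin (n' + 1))) (Pi.single i 1) := by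
    rw [← hvol.integral_comp T.toHomeomorph.measurableEmbedding,
      ← setIntegral_eq_integral_of_forall_compl_eq_zero (s := Icc a b), hgC]
    · simp [hTs]
    · intro v hv
      exact indicator_of_notMem (fun h => hv (hbox v h)) _
  -- The box theorem asks for continuity on the closed box and differentiability only in its
  -- interior, so one-sided derivatives at y 0 = 0 cause no trouble and the exceptional set is
  -- empty.
  rw [h1, h2, integral_divergence_of_hasFDerivAt_off_countable' a b hle (fun i v => f i (T v))
    (fun i v => (f' i (T v)).comp (T : (Fin (n' + 1) → ℝ) →L[ℝ] EuclideanSpace ℝ (Fin (n' + 1)))) ∅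
    countable_empty]
  · refine Finset.sum_eq_zero fun i _ => ?_
    have hfront : ∀ v, f i (T (Fin.insertNth i (b i) v)) = 0 := by
      intro v
      refine hfC i _ fun hmem => ?_
      have := hcoord _ hmem i
      rw [hT, Fin.insertNth_apply_same] at this
      simp only [b, abs_of_pos hr0, lt_irrefl] at this
    have hback : ∀ v, f i (T (Fin.insertNth i (a i) v)) = 0 := by
      intro v
      by_cases hi : i = 0
      · subst hi
        by_cases hmem : T (Fin.insertNth 0 (a 0) v) ∈ U
        · simp only [f, indicator_of_mem hmem]
          refine hb _ hmem ?_
          rw [hT, Fin.insertNth_apply_same, ha0]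
        · simp only [f, indicator_of_notMem hmem]
      · refine hfC i _ fun hmem => ?_
        have := hcoord _ hmem i
        rw [hT, Fin.insertNth_apply_same, hai i hi, abs_neg, abs_of_pos hr0] at this
        exact lt_irrefl _ this
    simp [hfront, hback]
  · intro i
    have hfcont : ContinuousOn (f i) {y | 0 ≤ y 0} := by
      intro y hy
      by_cases hyU : y ∈ U
      · have hyO : y ∈ O := by rw [hU] at hyU; exact hyU.1
        have h3 : ContinuousWithinAt (f i) U y :=
          ((hZ i y hyU).continuousWithinAt).congr (fun z hz => indicator_of_mem hz _)
            (indicator_of_mem hyU _)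
        rw [hU, inter_comm] at h3
        exact (continuousWithinAt_inter (hO.mem_nhds hyO)).1 h3
      · have hyC : y ∉ C := fun h => hyU (hCU h)
        have h3 : f i =ᶠ[𝓝 y] fun _ => 0 := by
          filter_upwards [hC.isClosed.isOpen_compl.mem_nhds hyC] with z hz
          exact hfC i z hz
        exact (continuousAt_const.congr h3.symm).continuousWithinAt
    refine hfcont.comp T.continuous.continuousOn fun v hv => ?_
    have := (mem_Icc.1 hv).1 0
    rw [ha0] at this
    exact this
  · rintro v ⟨hv, -⟩ i
    have hv0 : 0 < T v 0 := by
      have := (hv 0 (mem_univ _)).1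
      rwa [ha0] at this
    refine HasFDerivAt.comp (g := f i) v ?_ T.hasFDerivAt
    by_cases hyU : T v ∈ U
    · have hnhds : U ∈ 𝓝 (T v) := by
        have hyO : T v ∈ O := by rw [hU] at hyU; exact hyU.1
        rw [hU]
        refine inter_mem (hO.mem_nhds hyO) ?_
        filter_upwards [(isOpen_lt continuous_const (by fun_prop :
          Continuous fun y : EuclideanSpace ℝ (Fin (n' + 1)) => y 0)).mem_nhds hv0] with z hz
        exact le_of_lt hz
      have h3 := (hZ i _ hyU).hasFDerivAt hnhds
      simp only [f', indicator_of_mem hyU]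
      refine h3.congr_of_eventuallyEq ?_
      filter_upwards [hnhds] with z hz
      exact indicator_of_mem hz _
    · simp only [f', indicator_of_notMem hyU]
      have hyC : T v ∉ C := fun h => hyU (hCU h)
      refine (hasFDerivAt_const (0 : ℝ) (T v)).congr_of_eventuallyEq ?_
      filter_upwards [hC.isClosed.isOpen_compl.mem_nhds hyC] with z hz
      exact hfC i z hz
  · have h3 := (hvol.integrable_comp_emb T.toHomeomorph.measurableEmbedding).2 hint
    rw [hgC] at h3
    refine Integrable.integrableOn ?_
    simpa [Function.comp_def, hTs] using h3

end HalfSpaceDivergence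

end SpaceForm

end

open Set Filter Topology MeasureTheory
open scoped Manifold ContDiff

noncomputable section

namespace SpaceForm

/-! ### The boundary flux and the integrated identity on a patch. -/

section PatchIntegral

open Matrix

variable {n : ℕ} {K : SignType} {R : ℝ} {U : Set (EuclideanSpace ℝ (Fin n))}
  {x N : EuclideanSpace ℝ (Fin n) → EuclideanSpace ℝ (Fin (n + 1))}

theorem continuousOn_frame {α : Type*} [TopologicalSpace α] {s : Set α}
    {N : α → EuclideanSpace ℝ (Fin (n + 1))} {v : Fin n → α → EuclideanSpace ℝ (Fin (n + 1))}
    (hN : ContinuousOn N s) (hv : ∀ i, ContinuousOn (v i) s) :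
    ContinuousOn (fun y => frame (N y) fun j => v j y) s := by
  refine continuousOn_pi.2 fun r => ?_
  refine Fin.cases ?_ (fun j => ?_) r
  · exact (coordsL (n + 1)).continuous.comp_continuousOn hN
  · exact (coordsL (n + 1)).continuous.comp_continuousOn (hv j)

theorem continuousOn_det_updateRow {ι α : Type*} [Fintype ι] [DecidableEq ι] [TopologicalSpace α]
    {s : Set α} {M : α → Matrix ι ι ℝ} {v : α → ι → ℝ} (r : ι) (hM : ContinuousOn M s)
    (hv : ContinuousOn v s) : ContinuousOn (fun y => ((M y).updateRow r (v y)).det) s := by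
  refine (continuous_id.matrix_det).comp_continuousOn ?_
  refine continuousOn_pi.2 fun i => ?_
  by_cases hi : i = r
  · subst hi
    exact hv.congr fun y _ => updateRow_self
  · exact (continuousOn_pi.1 hM i).congr fun y _ => updateRow_ne hi

theorem IsPatch.continuousOn_conformalFactor (h : IsPatch K R U x N) :
    ContinuousOn (fun y => conformalFactor K (x y)) U := fun _ hy =>
  (h.hasFDerivWithinAt_conformalFactor hy).continuousWithinAt

theorem IsPatch.continuousOn_parallelDeriv (h : IsPatch K R U x N) (t : ℝ) (i : Fin n) :
    ContinuousOn (parallelDeriv K t U x N i) U := fun _ hy =>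
  (h.parallelDeriv_deriv t hy i).choose_spec.1.continuousWithinAt

theorem IsPatch.continuousOn_det_frame (h : IsPatch K R U x N) (t : ℝ) :
    ContinuousOn (fun y => (frame (N y) fun j => parallelDeriv K t U x N j y).det) U :=
  (continuous_id.matrix_det).comp_continuousOn
    (continuousOn_frame h.contDiffOn_normal.continuousOn fun i => h.continuousOn_parallelDeriv t i)

theorem IsPatch.continuousOn_det_frame_partialDeriv (h : IsPatch K R U x N) :
    ContinuousOn (fun y => (frame (N y) fun j => partialDeriv U x j y).det) U :=
  (continuous_id.matrix_det).comp_continuousOn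
    (continuousOn_frame h.contDiffOn_normal.continuousOn fun i =>
      (contDiffOn_partialDeriv h.contDiffOn h.uniqueDiffOn i).continuousOn)

theorem IsPatch.continuousOn_parallelDetDeriv (h : IsPatch K R U x N) (t : ℝ) :
    ContinuousOn (parallelDetDeriv K t U x N) U := by
  refine continuousOn_finsetSum _ fun i _ => ?_
  refine continuousOn_det_updateRow _ (continuousOn_frame h.contDiffOn_normal.continuousOn
    fun i => h.continuousOn_parallelDeriv t i) ?_
  have h1 := (contDiffOn_partialDeriv h.contDiffOn h.uniqueDiffOn i).continuousOn
  have h2 := (contDiffOn_partialDeriv h.contDiffOn_normal h.uniqueDiffOn i).continuousOn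
  have h3 := h.continuousOn_conformalFactor
  have h4 := h.contDiffOn.continuousOn
  have h5 := h.contDiffOn_normal.continuousOn
  have h6 : ContinuousOn (fun _ : EuclideanSpace ℝ (Fin n) => curv K) U := continuousOn_const
  exact (coordsL (n + 1)).continuous.comp_continuousOn <| h2.sub (((h6.mul h3).mul (h4.inner h5)).smul h1)

/-- The flux through the boundary hyperplane vanishes for orthogonal patches. -/
theorem IsPatch.flux_eq_zero_of_boundary [NeZero n] (hR : AdmissibleRadius K R)
    (h : IsPatch K R U x N) {O : Set (EuclideanSpace ℝ (Fin n))}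
    (hO : IsOpen O) (hU : U = O ∩ {y | 0 ≤ y 0})
    (hb : ∀ y ∈ U, y 0 = 0 → ‖x y‖ = modelRadius K R ∧ inner ℝ (N y) (x y) = (0 : ℝ))
    (a : EuclideanSpace ℝ (Fin (n + 1))) (t : ℝ) {y : EuclideanSpace ℝ (Fin n)} (hy : y ∈ U)
    (hy0 : y 0 = 0) : flux K R a t U x N 0 y = 0 := by
  have hyO : y ∈ O := by rw [hU] at hy; exact hy.1
  have hcurve : ∀ j : Fin n, j ≠ 0 → inner ℝ (partialDeriv U x j y) (x y) = (0 : ℝ) ∧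
      inner ℝ (partialDeriv U N j y) (x y) = (0 : ℝ) := by
    intro j hj
    -- For j ≠ 0 this line stays in the boundary hyperplane, so |x|² = ρ² and ⟨N, x⟩ = 0 may be
    -- differentiated along it.
    let c : ℝ → EuclideanSpace ℝ (Fin n) := fun s => y + s • EuclideanSpace.single j 1
    have hc : HasDerivAt c (EuclideanSpace.single j 1) 0 := by
      have := ((hasDerivAt_id (0 : ℝ)).smul_const (EuclideanSpace.single j (1 : ℝ))).const_add y
      rwa [one_smul] at this
    have hc0 : c 0 = y := by simp [c]
    have hcz : ∀ s, c s 0 = 0 := by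
      intro s
      simp [c, hy0, hj.symm]
    have hcU : ∀ᶠ s in 𝓝 (0 : ℝ), c s ∈ U := by
      have : ∀ᶠ s in 𝓝 (0 : ℝ), c s ∈ O := by
        refine hc.continuousAt.eventually_mem (hO.mem_nhds ?_)
        rwa [hc0]
      filter_upwards [this] with s hs
      rw [hU]
      exact ⟨hs, (hcz s).ge⟩
    have hder : ∀ f : EuclideanSpace ℝ (Fin n) → EuclideanSpace ℝ (Fin (n + 1)),
        ContDiffOn ℝ ∞ f U → HasDerivAt (fun s => f (c s)) (partialDeriv U f j y) 0 := by
      intro f hf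
      have h1 : HasFDerivWithinAt f (fderivWithin ℝ f U y) U (c 0) := by
        rw [hc0]
        exact hasFDerivWithinAt_of_contDiffOn hf hy
      have h2 := h1.comp_hasDerivWithinAt (s := c ⁻¹' U) 0 hc.hasDerivWithinAt (fun s hs => hs)
      exact h2.hasDerivAt hcU
    have hx := hder x h.contDiffOn
    have hN := hder N h.contDiffOn_normal
    have h3 : inner ℝ (partialDeriv U x j y) (x y) = (0 : ℝ) := by
      have h4 := hx.inner ℝ hx
      have h5 : HasDerivAt (fun s => (inner ℝ (x (c s)) (x (c s)) : ℝ)) 0 0 := by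
        refine (hasDerivAt_const (0 : ℝ) (modelRadius K R ^ 2)).congr_of_eventuallyEq ?_
        filter_upwards [hcU] with s hs
        rw [real_inner_self_eq_norm_sq, (hb _ hs (hcz s)).1]
      have h6 := h4.unique h5
      rw [hc0, real_inner_comm (partialDeriv U x j y)] at h6
      linarith
    refine ⟨h3, ?_⟩
    have h4 := hN.inner ℝ hx
    have h5 : HasDerivAt (fun s => (inner ℝ (N (c s)) (x (c s)) : ℝ)) 0 0 := by
      refine (hasDerivAt_const (0 : ℝ) (0 : ℝ)).congr_of_eventuallyEq ?_
      filter_upwards [hcU] with s hs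
      exact (hb _ hs (hcz s)).2
    have h6 := h4.unique h5
    rw [hc0, partialDeriv, h.normal y hy, zero_add] at h6
    exact h6
  rw [flux]
  have : ((frame (N y) fun j => parallelDeriv K t U x N j y).updateRow (Fin.succ 0)
      (X K R a (x y)).ofLp).det = 0 := by
    -- The nonzero vector x(y) is orthogonal to every row: to X because X is tangent to ∂B, to N by
    -- the free boundary condition, and to w_j for j ≠ 0 because ∂_j x and ∂_j N are. The row w_0,
    -- which need not be orthogonal to x(y), is the one that X replaces.
    apply Matrix.exists_mulVec_eq_zero_iff.1
    refine ⟨(x y).ofLp, ?_, ?_⟩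
    · intro h0
      have h1 : x y = 0 := by ext i; exact congrFun h0 i
      have h2 := (hb y hy hy0).1
      rw [h1, norm_zero] at h2
      exact (modelRadius_pos hR).ne h2
    · ext r
      change ((frame (N y) fun j => parallelDeriv K t U x N j y).updateRow (Fin.succ 0)
        (X K R a (x y)).ofLp r) ⬝ᵥ (x y).ofLp = 0
      by_cases hr : r = Fin.succ 0
      · subst hr
        rw [updateRow_self, ofLp_dotProduct, inner_X hR, (hb y hy hy0).1]
        ring
      · rw [updateRow_ne hr]
        rcases Fin.eq_zero_or_eq_succ r with rfl | ⟨j, rfl⟩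
        · simpa [frame, ofLp_dotProduct] using (hb y hy hy0).2
        · have hj : j ≠ 0 := fun h => hr (by rw [h])
          simp only [frame, frameMatrix_succ, ofLp_dotProduct, parallelDeriv, inner_add_left,
            inner_smul_left, (hcurve j hj).1, (hcurve j hj).2]
          simp
  rw [this, mul_zero]

/-- The pointwise divergence of the flux form. -/
def fluxDiv (K : SignType) (R : ℝ) (a : EuclideanSpace ℝ (Fin (n + 1))) (t : ℝ)
    (U : Set (EuclideanSpace ℝ (Fin n)))
    (x N : EuclideanSpace ℝ (Fin n) → EuclideanSpace ℝ (Fin (n + 1)))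
    (y : EuclideanSpace ℝ (Fin n)) : ℝ :=
  V K a (x y) * (n * (frame (N y) fun j => parallelDeriv K t U x N j y).det
      - t * parallelDetDeriv K t U x N y)
    - conformalFactor K (x y) * inner ℝ (X K R a (x y)) (N y) * parallelDetDeriv K t U x N y

/-- The area density involves |det(N, ∂_1 x, …, ∂_n x)|, while the flux involves the signed
determinant. The sign is locally constant on the patch, as the determinant is continuous and nowhere
zero, so it may be carried through the divergence theorem. -/
theorem IsPatch.integral_flux [NeZero n] (hR : AdmissibleRadius K R)
    (h : IsPatch K R U x N) {O C : Set (EuclideanSpace ℝ (Fin n))}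
    (hO : IsOpen O) (hU : U = O ∩ {y | 0 ≤ y 0})
    (hb : ∀ y ∈ U, y 0 = 0 → ‖x y‖ = modelRadius K R ∧ inner ℝ (N y) (x y) = (0 : ℝ))
    (hC : IsCompact C) (hCU : C ⊆ U) {φ : EuclideanSpace ℝ (Fin n) → ℝ} (hφ : ContDiffOn ℝ ∞ φ U)
    (hφC : ∀ y ∈ U, y ∉ C → φ y = 0) (a : EuclideanSpace ℝ (Fin (n + 1))) (t : ℝ) :
    ∫ y in U, Real.sign (frame (N y) fun j => partialDeriv U x j y).det *
      (φ y * fluxDiv K R a t U x N y + ∑ i, partialDeriv U φ i y * flux K R a t U x N i y) = 0 := by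
  classical
  set σ := fun y => Real.sign (frame (N y) fun j => partialDeriv U x j y).det with hσ
  choose! L hL hdiv using fun y (hy : y ∈ U) => h.divergence_flux hR a t hy
  have hσloc : ∀ y ∈ U, ∀ᶠ z in 𝓝[U] y, σ z = σ y := by
    intro y hy
    have h1 := h.continuousOn_det_frame_partialDeriv y hy
    rcases (h.det_frame_ne_zero hy).lt_or_gt with h2 | h2
    · filter_upwards [h1.eventually_lt_const h2] with z hz
      simp only [hσ, Real.sign_of_neg hz, Real.sign_of_neg h2]
    · filter_upwards [h1.eventually_const_lt h2] with z hz
      simp only [hσ, Real.sign_of_pos hz, Real.sign_of_pos h2]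
  have hZ : ∀ i, ∀ y ∈ U, HasFDerivWithinAt (fun y => σ y * (φ y * flux K R a t U x N i y))
      (σ y • (φ y • L y i + flux K R a t U x N i y • fderivWithin ℝ φ U y)) U y := by
    intro i y hy
    have h1 := ((hasFDerivWithinAt_of_contDiffOn hφ hy).mul (hL y hy i)).const_mul (σ y)
    refine h1.congr_of_eventuallyEq ?_ rfl
    filter_upwards [hσloc y hy] with z hz
    rw [hz]
    rfl
  have hsum : ∀ y ∈ U, ∑ i, (σ y • (φ y • L y i + flux K R a t U x N i y • fderivWithin ℝ φ U y))
      (EuclideanSpace.single i 1) = σ y *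
      (φ y * fluxDiv K R a t U x N y + ∑ i, partialDeriv U φ i y * flux K R a t U x N i y) := by
    intro y hy
    rw [fluxDiv, ← hdiv y hy, mul_add, Finset.mul_sum, Finset.mul_sum, Finset.mul_sum,
      ← Finset.sum_add_distrib]
    refine Finset.sum_congr rfl fun i _ => ?_
    simp only [partialDeriv, _root_.smul_apply, _root_.add_apply, smul_eq_mul]
    ring
  have hUmeas : MeasurableSet U := by
    rw [hU]
    exact hO.measurableSet.inter (measurableSet_le measurable_const (by fun_prop))
  rw [← setIntegral_congr_fun hUmeas hsum]
  refine integral_divergence_halfSpace hO hU h.uniqueDiffOn hC hCU hZ ?_ ?_ ?_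
  · intro i y hy hyC
    simp [hφC y hy hyC]
  · intro y hy hy0
    simp only [h.flux_eq_zero_of_boundary hR hO hU hb a t hy hy0, mul_zero]
  · refine ContinuousOn.mono ?_ hCU
    refine ContinuousOn.congr ?_ hsum
    have hσc : ContinuousOn σ U := fun y hy =>
      (continuousWithinAt_const (b := σ y)).congr_of_eventuallyEq (hσloc y hy) rfl
    have hVc : ContinuousOn (fun y => V K a (x y)) U :=
      (continuousOn_V K a).comp h.contDiffOn.continuousOn fun y hy => h.mem_domain hy
    have hXc : ContinuousOn (fun y => X K R a (x y)) U :=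
      (contDiff_X hR a).continuous.comp_continuousOn h.contDiffOn.continuousOn
    have hDc : ContinuousOn (fluxDiv K R a t U x N) U :=
      (hVc.mul ((continuousOn_const.mul (h.continuousOn_det_frame t)).sub
        (continuousOn_const.mul (h.continuousOn_parallelDetDeriv t)))).sub
        ((h.continuousOn_conformalFactor.mul (hXc.inner h.contDiffOn_normal.continuousOn)).mul
          (h.continuousOn_parallelDetDeriv t))
    refine hσc.mul ((hφ.continuousOn.mul hDc).add (continuousOn_finsetSum _ fun i _ => ?_))
    exact (contDiffOn_partialDeriv hφ h.uniqueDiffOn i).continuousOn.mul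
      fun y hy => (hL y hy i).continuousWithinAt

end PatchIntegral

end SpaceForm

end

open Set Filter Topology MeasureTheory
open scoped Manifold ContDiff

noncomputable section

namespace SpaceForm

/-! ### Reading the immersion in charts, and change of charts. -/

section Charts

open Matrix

/-- The images of the basis vectors are put in the rows, as in `frame`, hence the transposition. -/
theorem det_eq_det_matrix {m : ℕ} (L : EuclideanSpace ℝ (Fin m) →L[ℝ] EuclideanSpace ℝ (Fin m)) :
    L.det = (Matrix.of fun i j => L (EuclideanSpace.single i 1) j).det := by
  rw [ContinuousLinearMap.det, ← LinearMap.det_toMatrix (EuclideanSpace.basisFun (Fin m) ℝ).toBasis,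
    ← Matrix.det_transpose]
  congr 1

theorem eq_sum_single {m : ℕ} (v : EuclideanSpace ℝ (Fin m)) :
    v = ∑ j, v j • EuclideanSpace.single j (1 : ℝ) := by
  ext i
  simp [Finset.sum_apply, Pi.single_apply]

variable {n : ℕ} [NeZero n] {M : Type*} [TopologicalSpace M]
  [ChartedSpace (EuclideanHalfSpace n) M]

/-- The domain in the half space of the preferred chart at `q`. -/
def chartDom (q : M) : Set (EuclideanSpace ℝ (Fin n)) := (extChartAt (𝓡∂ n) q).target

/-- A map on `M`, read in the preferred chart at `q`. -/
def inChart {E : Type*} (f : M → E) (q : M) : EuclideanSpace ℝ (Fin n) → E :=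
  f ∘ (extChartAt (𝓡∂ n) q).symm

theorem inChart_apply {E : Type*} (f : M → E) (q : M) (y : EuclideanSpace ℝ (Fin n)) :
    inChart f q y = f ((extChartAt (𝓡∂ n) q).symm y) := rfl

theorem inChart_extChartAt {E : Type*} (f : M → E) {q p : M}
    (hp : p ∈ (extChartAt (𝓡∂ n) q).source) :
    inChart (n := n) f q (extChartAt (𝓡∂ n) q p) = f p := by
  rw [inChart_apply, (extChartAt (𝓡∂ n) q).left_inv hp]

/-- An open set that cuts the chart domain out of the half space. -/
def chartOpen (q : M) : Set (EuclideanSpace ℝ (Fin n)) :=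
  (𝓡∂ n).symm ⁻¹' (chartAt (EuclideanHalfSpace n) q).target

theorem isOpen_chartOpen (q : M) : IsOpen (chartOpen (n := n) q) :=
  (chartAt (EuclideanHalfSpace n) q).open_target.preimage (𝓡∂ n).continuous_symm

theorem chartDom_eq (q : M) : chartDom (n := n) q = chartOpen q ∩ {y | 0 ≤ y 0} := by
  rw [chartDom, extChartAt_target, range_modelWithCornersEuclideanHalfSpace]
  rfl

theorem chartDom_eq_range (q : M) : chartDom (n := n) q = range (𝓡∂ n) ∩ chartOpen q := by
  rw [chartDom, extChartAt_target, inter_comm]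
  rfl

theorem chartDom_subset_range (q : M) : chartDom (n := n) q ⊆ range (𝓡∂ n) := by
  rw [chartDom_eq_range]
  exact inter_subset_left

theorem measurableSet_chartDom (q : M) : MeasurableSet (chartDom (n := n) q) := by
  rw [chartDom_eq]
  exact (isOpen_chartOpen q).measurableSet.inter
    (measurableSet_le measurable_const (by fun_prop))

theorem chartOpen_mem_nhds {q : M} {y : EuclideanSpace ℝ (Fin n)} (hy : y ∈ chartDom q) :
    chartOpen q ∈ 𝓝 y := by
  rw [chartDom_eq] at hy
  exact (isOpen_chartOpen q).mem_nhds hy.1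

theorem uniqueDiffOn_chartDom (q : M) : UniqueDiffOn ℝ (chartDom (n := n) q) :=
  uniqueDiffOn_extChartAt_target q

theorem fderivWithin_range_eq {E : Type*} [NormedAddCommGroup E] [NormedSpace ℝ E]
    (f : EuclideanSpace ℝ (Fin n) → E) {q : M} {y : EuclideanSpace ℝ (Fin n)}
    (hy : y ∈ chartDom q) :
    fderivWithin ℝ f (range (𝓡∂ n)) y = fderivWithin ℝ f (chartDom q) y := by
  rw [chartDom_eq_range, fderivWithin_inter (chartOpen_mem_nhds hy)]

variable [IsManifold (𝓡∂ n) ∞ M]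

theorem contDiffOn_inChart {E : Type*} [NormedAddCommGroup E] [NormedSpace ℝ E] {f : M → E}
    (hf : ContMDiff (𝓡∂ n) 𝓘(ℝ, E) ∞ f) (q : M) :
    ContDiffOn ℝ ∞ (inChart f q) (chartDom (n := n) q) := by
  rw [← contMDiffOn_iff_contDiffOn]
  exact hf.comp_contMDiffOn (contMDiffOn_extChartAt_symm q)

/-- The transition map from the chart at `q` to the chart at `q'`. -/
def transition (q q' : M) : EuclideanSpace ℝ (Fin n) → EuclideanSpace ℝ (Fin n) :=
  extChartAt (𝓡∂ n) q' ∘ (extChartAt (𝓡∂ n) q).symm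

/-- The derivative of the transition map. -/
def transitionDeriv (q q' : M) (y : EuclideanSpace ℝ (Fin n)) :
    EuclideanSpace ℝ (Fin n) →L[ℝ] EuclideanSpace ℝ (Fin n) :=
  fderivWithin ℝ (transition q q') ((𝓡∂ n).extendCoordChange (chartAt (EuclideanHalfSpace n) q)
    (chartAt (EuclideanHalfSpace n) q')).source y

theorem mem_extendCoordChange_source {q q' : M} {y : EuclideanSpace ℝ (Fin n)} :
    y ∈ ((𝓡∂ n).extendCoordChange (chartAt (EuclideanHalfSpace n) q)
      (chartAt (EuclideanHalfSpace n) q')).source ↔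
    y ∈ chartDom q ∧ (extChartAt (𝓡∂ n) q).symm y ∈ (extChartAt (𝓡∂ n) q').source := by
  rw [ModelWithCorners.extendCoordChange, PartialEquiv.trans_source]
  rfl

theorem hasFDerivWithinAt_transition {q q' : M} {y : EuclideanSpace ℝ (Fin n)}
    (hy : y ∈ chartDom q) (hy' : (extChartAt (𝓡∂ n) q).symm y ∈ (extChartAt (𝓡∂ n) q').source) :
    HasFDerivWithinAt (transition q q') (transitionDeriv q q' y) (range (𝓡∂ n)) y := by
  have hmem := mem_extendCoordChange_source.2 ⟨hy, hy'⟩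
  have h1 := (𝓡∂ n).contDiffOn_extendCoordChange (n := ∞)
    (IsManifold.chart_mem_maximalAtlas (I := 𝓡∂ n) (n := ∞) q)
    (IsManifold.chart_mem_maximalAtlas (I := 𝓡∂ n) (n := ∞) q')
  have h2 : HasFDerivWithinAt (transition q q') (transitionDeriv q q' y) _ y :=
    (h1.differentiableOn (by simp) y hmem).hasFDerivWithinAt
  exact h2.mono_of_mem_nhdsWithin ((𝓡∂ n).extendCoordChange_source_mem_nhdsWithin hmem)

theorem det_transitionDeriv_ne_zero {q q' : M} {y : EuclideanSpace ℝ (Fin n)}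
    (hy : y ∈ chartDom q) (hy' : (extChartAt (𝓡∂ n) q).symm y ∈ (extChartAt (𝓡∂ n) q').source) :
    (transitionDeriv q q' y).det ≠ 0 := by
  have hmem := mem_extendCoordChange_source.2 ⟨hy, hy'⟩
  obtain ⟨e, he⟩ := (𝓡∂ n).isInvertible_fderivWithin_extendCoordChange (n := ∞) (by simp)
    (IsManifold.chart_mem_maximalAtlas (I := 𝓡∂ n) (n := ∞) q)
    (IsManifold.chart_mem_maximalAtlas (I := 𝓡∂ n) (n := ∞) q') hmem
  have : transitionDeriv q q' y = e := he.symm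
  rw [this]
  exact (e.toLinearEquiv.isUnit_det').ne_zero

theorem transition_mem {q q' : M} {y : EuclideanSpace ℝ (Fin n)}
    (hy' : (extChartAt (𝓡∂ n) q).symm y ∈ (extChartAt (𝓡∂ n) q').source) :
    transition q q' y ∈ chartDom q' :=
  (extChartAt (𝓡∂ n) q').map_source hy'

theorem fderivWithin_inChart_transition {E : Type*} [NormedAddCommGroup E] [NormedSpace ℝ E]
    {f : M → E} (hf : ContMDiff (𝓡∂ n) 𝓘(ℝ, E) ∞ f) {q q' : M} {y : EuclideanSpace ℝ (Fin n)}
    (hy : y ∈ chartDom q) (hy' : (extChartAt (𝓡∂ n) q).symm y ∈ (extChartAt (𝓡∂ n) q').source) :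
    fderivWithin ℝ (inChart f q) (chartDom q) y
      = (fderivWithin ℝ (inChart f q') (chartDom q') (transition q q' y)).comp
        (transitionDeriv q q' y) := by
  have hmem := mem_extendCoordChange_source.2 ⟨hy, hy'⟩
  set S := ((𝓡∂ n).extendCoordChange (chartAt (EuclideanHalfSpace n) q)
      (chartAt (EuclideanHalfSpace n) q')).source with hS
  have h1 : HasFDerivWithinAt (inChart f q') _ (chartDom q') (transition q q' y) :=
    hasFDerivWithinAt_of_contDiffOn (contDiffOn_inChart hf q') (transition_mem hy')
  have hSr : S ⊆ range (𝓡∂ n) := fun z hz =>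
    chartDom_subset_range q (mem_extendCoordChange_source.1 hz).1
  have h2 := h1.comp y ((hasFDerivWithinAt_transition hy hy').mono hSr)
    (fun z hz => transition_mem (mem_extendCoordChange_source.1 hz).2)
  have h3 : HasFDerivWithinAt (inChart f q) _ S y := h2.congr (fun z hz => by
    rw [Function.comp_apply, transition, Function.comp_apply,
      inChart_extChartAt _ (mem_extendCoordChange_source.1 hz).2]
    rfl) (by
    rw [Function.comp_apply, transition, Function.comp_apply, inChart_extChartAt _ hy']
    rfl)
  have h4 := h3.mono_of_mem_nhdsWithin ((𝓡∂ n).extendCoordChange_source_mem_nhdsWithin hmem)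
  exact (h4.mono (chartDom_subset_range q)).fderivWithin (uniqueDiffOn_chartDom q y hy)

/-- Change of frame between charts. -/
theorem partialDeriv_inChart_transition {E : Type*} [NormedAddCommGroup E] [NormedSpace ℝ E]
    {f : M → E} (hf : ContMDiff (𝓡∂ n) 𝓘(ℝ, E) ∞ f) {q q' : M} {y : EuclideanSpace ℝ (Fin n)}
    (hy : y ∈ chartDom q) (hy' : (extChartAt (𝓡∂ n) q).symm y ∈ (extChartAt (𝓡∂ n) q').source)
    (i : Fin n) :
    partialDeriv (chartDom q) (inChart f q) i y
      = ∑ j, transitionDeriv q q' y (EuclideanSpace.single i 1) j •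
        partialDeriv (chartDom q') (inChart f q') j (transition q q' y) := by
  rw [partialDeriv, fderivWithin_inChart_transition hf hy hy', ContinuousLinearMap.comp_apply]
  conv_lhs => rw [eq_sum_single (transitionDeriv q q' y (EuclideanSpace.single i 1))]
  rw [map_sum]
  simp [partialDeriv]

/-- The manifold derivative is by definition read in the preferred chart at p itself. For this
reason pointwise invariants are computed at chart centres and then transported by transition maps.
-/
theorem differential_eq {m : ℕ} {f : M → EuclideanSpace ℝ (Fin m)}
    (hf : ContMDiff (𝓡∂ n) 𝓘(ℝ, EuclideanSpace ℝ (Fin m)) ∞ f) (p : M)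
    (v : TangentSpace (𝓡∂ n) p) :
    differential f p v = fderivWithin ℝ (inChart f p) (chartDom p) (extChartAt (𝓡∂ n) p p) v := by
  rw [differential, (hf.mdifferentiableAt (by simp)).mfderiv,
    ← fderivWithin_range_eq _ (mem_extChartAt_target p)]
  rfl

theorem differential_tangentBasis {m : ℕ} {f : M → EuclideanSpace ℝ (Fin m)}
    (hf : ContMDiff (𝓡∂ n) 𝓘(ℝ, EuclideanSpace ℝ (Fin m)) ∞ f) (p : M) (i : Fin n) :
    differential f p (tangentBasis p i)
      = partialDeriv (chartDom p) (inChart f p) i (extChartAt (𝓡∂ n) p p) :=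
  differential_eq hf p _

/-- Being an interior point can be tested in any chart of the atlas, and no point with y 0 = 0 is
interior to a subset of the half space. -/
theorem mem_boundary_of_chart {q : M} {y : EuclideanSpace ℝ (Fin n)} (hy : y ∈ chartDom q)
    (hy0 : y 0 = 0) : (extChartAt (𝓡∂ n) q).symm y ∈ (𝓡∂ n).boundary M := by
  rw [← ModelWithCorners.compl_interior]
  intro hint
  have hsrc : (extChartAt (𝓡∂ n) q).symm y ∈ (chartAt (EuclideanHalfSpace n) q).source := by
    rw [← extChartAt_source (𝓡∂ n)]
    exact (extChartAt (𝓡∂ n) q).map_target hy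
  have h1 := ((𝓡∂ n).isInteriorPoint_iff_of_mem_atlas (n := ∞) (by simp)
    (chart_mem_atlas _ q) hsrc).1 hint
  have h2 : y ∈ interior (chartDom q) := by
    have : (extChartAt (𝓡∂ n) q) ((extChartAt (𝓡∂ n) q).symm y) = y :=
      (extChartAt (𝓡∂ n) q).right_inv hy
    rw [← this]
    exact h1
  have h3 := interior_mono (chartDom_subset_range q) h2
  rw [interior_range_modelWithCornersEuclideanHalfSpace] at h3
  exact h3.ne' hy0

theorem mem_interior_of_chart {q : M} {y : EuclideanSpace ℝ (Fin n)} (hy : y ∈ chartDom q)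
    (hy0 : 0 < y 0) : (extChartAt (𝓡∂ n) q).symm y ∈ (𝓡∂ n).interior M := by
  have hsrc : (extChartAt (𝓡∂ n) q).symm y ∈ (chartAt (EuclideanHalfSpace n) q).source := by
    rw [← extChartAt_source (𝓡∂ n)]
    exact (extChartAt (𝓡∂ n) q).map_target hy
  refine ((𝓡∂ n).isInteriorPoint_iff_of_mem_atlas (n := ∞) (by simp)
    (chart_mem_atlas _ q) hsrc).2 ?_
  have : (extChartAt (𝓡∂ n) q) ((extChartAt (𝓡∂ n) q).symm y) = y :=
    (extChartAt (𝓡∂ n) q).right_inv hy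
  change (extChartAt (𝓡∂ n) q) ((extChartAt (𝓡∂ n) q).symm y) ∈ interior (chartDom q)
  rw [this, mem_interior_iff_mem_nhds, chartDom_eq]
  refine inter_mem (chartOpen_mem_nhds hy) ?_
  filter_upwards [(isOpen_lt continuous_const (by fun_prop :
    Continuous fun y : EuclideanSpace ℝ (Fin n) => y 0)).mem_nhds hy0] with z hz
  exact le_of_lt hz

/-- The Euclidean unit normal `λ ν`. -/
def euclideanNormal (K : SignType) (x ν : M → EuclideanSpace ℝ (Fin (n + 1))) (p : M) :
    EuclideanSpace ℝ (Fin (n + 1)) := conformalFactor K (x p) • ν p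

variable {K : SignType} {R : ℝ} {x ν : M → EuclideanSpace ℝ (Fin (n + 1))}

theorem IsFreeBoundaryImmersion.mem_ball (hR : AdmissibleRadius K R)
    (hx : IsFreeBoundaryImmersion K R x ν) (p : M) : x p ∈ geodesicBall (n + 1) K R := by
  rcases (𝓡∂ n).isInteriorPoint_or_isBoundaryPoint p with h | h
  · exact interior_subset (hx.interior_mem p h)
  · have h1 := hx.boundary_mem p h
    rw [geodesicBall, frontier_closedBall _ (modelRadius_pos hR).ne'] at h1
    exact Metric.sphere_subset_closedBall h1

theorem IsFreeBoundaryImmersion.mem_domain (hR : AdmissibleRadius K R)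
    (hx : IsFreeBoundaryImmersion K R x ν) (p : M) : x p ∈ modelDomain (n + 1) K :=
  geodesicBall_subset_modelDomain _ _ _ (hx.mem_ball hR p)

theorem IsFreeBoundaryImmersion.contMDiff_euclideanNormal (hR : AdmissibleRadius K R)
    (hx : IsFreeBoundaryImmersion K R x ν) :
    ContMDiff (𝓡∂ n) 𝓘(ℝ, EuclideanSpace ℝ (Fin (n + 1))) ∞ (euclideanNormal K x ν) := by
  have h : ContMDiff (𝓡∂ n) 𝓘(ℝ, ℝ) ∞ fun p => conformalFactor K (x p) := fun p =>
    (contDiffAt_conformalFactor (hx.mem_domain hR p)).comp_contMDiffAt (hx.contMDiff p)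
  exact h.smul hx.contMDiff_normal

/-- The immersion in a chart is a patch. -/
theorem IsFreeBoundaryImmersion.isPatch (hR : AdmissibleRadius K R)
    (hx : IsFreeBoundaryImmersion K R x ν) (q : M) :
    IsPatch K R (chartDom q) (inChart x q) (inChart (euclideanNormal K x ν) q) := by
  -- The hypotheses speak of `differential`, read in the chart centred at the point; the invertible
  -- derivative of the transition map carries them to the chart at q.
  have hfd : ∀ y ∈ chartDom q, ∃ L : EuclideanSpace ℝ (Fin n) →L[ℝ] EuclideanSpace ℝ (Fin n),
      L.det ≠ 0 ∧ ∀ v, fderivWithin ℝ (inChart x q) (chartDom q) y v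
        = differential x ((extChartAt (𝓡∂ n) q).symm y) (L v) := by
    intro y hy
    set p := (extChartAt (𝓡∂ n) q).symm y with hp
    refine ⟨transitionDeriv q p y, det_transitionDeriv_ne_zero hy (mem_extChartAt_source p),
      fun v => ?_⟩
    rw [fderivWithin_inChart_transition hx.contMDiff hy (mem_extChartAt_source p)]
    exact (differential_eq hx.contMDiff p (transitionDeriv q p y v)).symm
  constructor
  · exact uniqueDiffOn_chartDom q
  · exact extChartAt_target_subset_closure_interior
  · exact contDiffOn_inChart hx.contMDiff q
  · exact contDiffOn_inChart (hx.contMDiff_euclideanNormal hR) q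
  · intro y _
    exact hx.mem_ball hR _
  · intro y _
    have := hx.unit ((extChartAt (𝓡∂ n) q).symm y)
    rw [metric] at this
    rw [inChart_apply, euclideanNormal, inner_smul_left, inner_smul_right, ← this]
    simp
    ring
  · intro y hy v
    obtain ⟨L, -, hL⟩ := hfd y hy
    have := hx.normal ((extChartAt (𝓡∂ n) q).symm y) (L v)
    rw [metric] at this
    rw [hL, inChart_apply, euclideanNormal, inner_smul_left]
    have hp := conformalFactor_pos (hx.mem_domain hR ((extChartAt (𝓡∂ n) q).symm y))
    rcases mul_eq_zero.1 this with h | h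
    · exact absurd h (pow_ne_zero _ hp.ne')
    · rw [h, mul_zero]
  · intro y hy
    obtain ⟨L, hL0, hL⟩ := hfd y hy
    have hinj : Function.Injective L := by
      have : (L : EuclideanSpace ℝ (Fin n) →ₗ[ℝ] EuclideanSpace ℝ (Fin n)).det ≠ 0 := hL0
      have h2 := LinearMap.equivOfDetNeZero _ this
      exact (LinearMap.equivOfDetNeZero _ this).injective
    intro v w hvw
    rw [hL, hL] at hvw
    exact hinj (hx.injective_differential _ hvw)

theorem IsFreeBoundaryImmersion.boundary_chart (hR : AdmissibleRadius K R)
    (hx : IsFreeBoundaryImmersion K R x ν) (q : M) :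
    ∀ y ∈ chartDom (n := n) q, y 0 = 0 → ‖inChart x q y‖ = modelRadius K R ∧
      inner ℝ (inChart (euclideanNormal K x ν) q y) (inChart x q y) = (0 : ℝ) := by
  intro y hy hy0
  have hp := mem_boundary_of_chart hy hy0
  set p := (extChartAt (𝓡∂ n) q).symm y
  have h1 : ‖x p‖ = modelRadius K R := by
    have h1 := hx.boundary_mem p hp
    rw [geodesicBall, frontier_closedBall _ (modelRadius_pos hR).ne'] at h1
    simpa using h1
  refine ⟨h1, ?_⟩
  have h2 := hx.orthogonal p hp
  have h3 := conformalFactor_pos (hx.mem_domain hR p)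
  have h4 := modelRadius_pos hR
  rw [metric, ballNormal, inner_smul_right, h1] at h2
  change inner ℝ (euclideanNormal K x ν p) (x p) = (0 : ℝ)
  rw [euclideanNormal, inner_smul_left]
  have h5 : inner ℝ (ν p) (x p) = (0 : ℝ) := by
    rcases mul_eq_zero.1 h2 with h | h
    · exact absurd h (pow_ne_zero _ h3.ne')
    · rcases mul_eq_zero.1 h with h | h
      · exact absurd h (inv_ne_zero (mul_pos h3 h4).ne')
      · exact h
  rw [h5, mul_zero]

end Charts

end SpaceForm

end

open Set Filter Topology MeasureTheory
open scoped Manifold ContDiff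

noncomputable section

namespace SpaceForm

/-! ### The area measure and its chart representations. -/

section Area

open Matrix

theorem det_frame_mul {n : ℕ} (N : EuclideanSpace ℝ (Fin (n + 1)))
    (v : Fin n → EuclideanSpace ℝ (Fin (n + 1))) (B : Matrix (Fin n) (Fin n) ℝ) :
    (frame N fun i => ∑ j, B i j • v j).det = B.det * (frame N v).det := by
  rw [frame, frame, ← det_frameMatrix_mul]
  congr 2
  ext1 i
  simp

variable {n : ℕ} [NeZero n] {M : Type*} [TopologicalSpace M]
  [ChartedSpace (EuclideanHalfSpace n) M]

variable [IsManifold (𝓡∂ n) ∞ M]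
  {K : SignType} {R : ℝ} {x ν : M → EuclideanSpace ℝ (Fin (n + 1))}

/-- The frame determinant `det (N, ∂_1 x, …, ∂_n x)` in the chart at `q`. -/
def chartDet (K : SignType) (x ν : M → EuclideanSpace ℝ (Fin (n + 1))) (q : M)
    (y : EuclideanSpace ℝ (Fin n)) : ℝ :=
  (frame (inChart (euclideanNormal K x ν) q y)
    fun i => partialDeriv (chartDom q) (inChart x q) i y).det

theorem IsFreeBoundaryImmersion.chartDet_ne_zero (hR : AdmissibleRadius K R)
    (hx : IsFreeBoundaryImmersion K R x ν) (q : M) {y : EuclideanSpace ℝ (Fin n)}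
    (hy : y ∈ chartDom q) : chartDet K x ν q y ≠ 0 :=
  (hx.isPatch hR q).det_frame_ne_zero hy

/-- The Gram determinant of the induced metric is λ^(2n) times the Euclidean one, and the latter is
the square of the frame determinant. -/
theorem IsFreeBoundaryImmersion.chartDensity_eq (hR : AdmissibleRadius K R)
    (hx : IsFreeBoundaryImmersion K R x ν) (q : M) {y : EuclideanSpace ℝ (Fin n)}
    (hy : y ∈ chartDom q) :
    chartDensity K x q y = conformalFactor K (inChart x q y) ^ n * |chartDet K x ν q y| := by
  have hp := (hx.isPatch hR q)
  have hpos := conformalFactor_pos (hp.mem_domain hy)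
  have h1 : (Matrix.of fun i j : Fin n => metric K (inChart x q y)
      (fderivWithin ℝ (inChart x q) (range (𝓡∂ n)) y (EuclideanSpace.single i 1))
      (fderivWithin ℝ (inChart x q) (range (𝓡∂ n)) y (EuclideanSpace.single j 1)))
      = conformalFactor K (inChart x q y) ^ 2 •
        Matrix.gram ℝ fun i => partialDeriv (chartDom q) (inChart x q) i y := by
    ext i j
    simp only [Matrix.of_apply, fderivWithin_range_eq _ hy]
    simp [metric, Matrix.gram, partialDeriv]
  have h2 : chartDensity K x q y = Real.sqrt (Matrix.of fun i j : Fin n => metric K (inChart x q y)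
      (fderivWithin ℝ (inChart x q) (range (𝓡∂ n)) y (EuclideanSpace.single i 1))
      (fderivWithin ℝ (inChart x q) (range (𝓡∂ n)) y (EuclideanSpace.single j 1))).det := rfl
  rw [h2, h1, Matrix.det_smul, ← hp.det_frame_sq hy, Fintype.card_fin, ← pow_mul, mul_comm 2 n,
    pow_mul, ← mul_pow, Real.sqrt_sq_eq_abs, abs_mul, abs_of_pos (pow_pos hpos n)]
  rfl

theorem IsFreeBoundaryImmersion.chartDensity_pos (hR : AdmissibleRadius K R)
    (hx : IsFreeBoundaryImmersion K R x ν) (q : M) {y : EuclideanSpace ℝ (Fin n)}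
    (hy : y ∈ chartDom q) : 0 < chartDensity K x q y := by
  rw [hx.chartDensity_eq hR q hy]
  exact mul_pos (pow_pos (conformalFactor_pos ((hx.isPatch hR q).mem_domain hy)) _)
    (abs_pos.2 (hx.chartDet_ne_zero hR q hy))

theorem IsFreeBoundaryImmersion.continuousOn_chartDensity (hR : AdmissibleRadius K R)
    (hx : IsFreeBoundaryImmersion K R x ν) (q : M) :
    ContinuousOn (chartDensity K x q) (chartDom q) := by
  have hp := (hx.isPatch hR q)
  exact ((hp.continuousOn_conformalFactor.pow n).mul
    hp.continuousOn_det_frame_partialDeriv.abs).congr fun y hy => hx.chartDensity_eq hR q hy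

theorem chartDet_transition (hx : ContMDiff (𝓡∂ n) 𝓘(ℝ, EuclideanSpace ℝ (Fin (n + 1))) ∞ x)
    {q q' : M} {y : EuclideanSpace ℝ (Fin n)}
    (hy : y ∈ chartDom q) (hy' : (extChartAt (𝓡∂ n) q).symm y ∈ (extChartAt (𝓡∂ n) q').source) :
    chartDet K x ν q y = (transitionDeriv q q' y).det * chartDet K x ν q' (transition q q' y) := by
  rw [chartDet, chartDet, det_eq_det_matrix, ← det_frame_mul]
  congr 2
  · rw [transition, Function.comp_apply, inChart_extChartAt _ hy']
    rfl
  · ext1 i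
    exact partialDeriv_inChart_transition hx hy hy' i

theorem IsFreeBoundaryImmersion.chartDensity_transition (hR : AdmissibleRadius K R)
    (hx : IsFreeBoundaryImmersion K R x ν) {q q' : M} {y : EuclideanSpace ℝ (Fin n)}
    (hy : y ∈ chartDom q) (hy' : (extChartAt (𝓡∂ n) q).symm y ∈ (extChartAt (𝓡∂ n) q').source) :
    chartDensity K x q y
      = |(transitionDeriv q q' y).det| * chartDensity K x q' (transition q q' y) := by
  rw [hx.chartDensity_eq hR q hy, hx.chartDensity_eq hR q' (transition_mem hy'),
    chartDet_transition hx.contMDiff hy hy', abs_mul]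
  have : inChart x q' (transition q q' y) = inChart x q y := by
    rw [transition, Function.comp_apply, inChart_extChartAt _ hy']
    rfl
  rw [this]
  ring

variable [MeasurableSpace M] [BorelSpace M]

theorem aemeasurable_extChartAt_symm (q : M) :
    AEMeasurable (extChartAt (𝓡∂ n) q).symm (volume.restrict (chartDom q)) :=
  (continuousOn_extChartAt_symm q).aemeasurable (measurableSet_chartDom q)

theorem measurableSet_chart_preimage (q : M) {s : Set M} (hs : MeasurableSet s) :
    MeasurableSet (chartDom (n := n) q ∩ (extChartAt (𝓡∂ n) q).symm ⁻¹' s) := by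
  have h1 := (continuousOn_iff_continuous_domRestrict.1
    (continuousOn_extChartAt_symm (I := 𝓡∂ n) q)).measurable hs
  have h2 := (measurableSet_chartDom (n := n) q).subtype_image h1
  convert h2 using 1
  ext y
  simp [chartDom, Set.domRestrict, and_comm]

theorem chartArea_apply (K : SignType) (x : M → EuclideanSpace ℝ (Fin (n + 1))) (q : M) {s : Set M}
    (hs : MeasurableSet s) :
    chartArea K x q s = ∫⁻ y in chartDom q ∩ (extChartAt (𝓡∂ n) q).symm ⁻¹' s,
      ENNReal.ofReal (chartDensity K x q y) := by
  have hae : AEMeasurable (extChartAt (𝓡∂ n) q).symm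
      ((volume.restrict (chartDom q)).withDensity
        fun y => ENNReal.ofReal (chartDensity K x q y)) :=
    (aemeasurable_extChartAt_symm q).mono_ac (withDensity_absolutelyContinuous _ _)
  rw [chartArea]
  change Measure.map _ ((volume.restrict (chartDom q)).withDensity _) s = _
  have hnull : NullMeasurableSet ((extChartAt (𝓡∂ n) q).symm ⁻¹' s)
      (volume.restrict (chartDom q)) := (aemeasurable_extChartAt_symm q).nullMeasurableSet_preimage hs
  rw [Measure.map_apply_of_aemeasurable hae hs, withDensity_apply₀ _ hnull,
    Measure.restrict_restrict₀ hnull, inter_comm]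

theorem chartArea_inter_source (K : SignType) (x : M → EuclideanSpace ℝ (Fin (n + 1))) (q : M)
    {s : Set M} (hs : MeasurableSet s) :
    chartArea K x q (s ∩ (extChartAt (𝓡∂ n) q).source) = chartArea K x q s := by
  rw [chartArea_apply K x q hs,
    chartArea_apply K x q (hs.inter (isOpen_extChartAt_source q).measurableSet)]
  congr 2
  ext y
  constructor
  · rintro ⟨h1, h2⟩
    exact ⟨h1, h2.1⟩
  · rintro ⟨h1, h2⟩
    exact ⟨h1, h2, (extChartAt (𝓡∂ n) q).map_target h1⟩

/-- The chart measures agree on overlaps. -/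
theorem IsFreeBoundaryImmersion.chartArea_eq (hR : AdmissibleRadius K R)
    (hx : IsFreeBoundaryImmersion K R x ν) (q q' : M) {s : Set M} (hs : MeasurableSet s)
    (hq : s ⊆ (extChartAt (𝓡∂ n) q).source) (hq' : s ⊆ (extChartAt (𝓡∂ n) q').source) :
    chartArea K x q s = chartArea K x q' s := by
  rw [chartArea_apply K x q hs, chartArea_apply K x q' hs]
  set A := chartDom q ∩ (extChartAt (𝓡∂ n) q).symm ⁻¹' s with hA
  have himg : chartDom q' ∩ (extChartAt (𝓡∂ n) q').symm ⁻¹' s = transition q q' '' A := by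
    ext z
    constructor
    · rintro ⟨h1, h2⟩
      refine ⟨extChartAt (𝓡∂ n) q ((extChartAt (𝓡∂ n) q').symm z),
        ⟨(extChartAt (𝓡∂ n) q).map_source (hq h2), ?_⟩, ?_⟩
      · rw [mem_preimage, (extChartAt (𝓡∂ n) q).left_inv (hq h2)]
        exact h2
      · rw [transition, Function.comp_apply, (extChartAt (𝓡∂ n) q).left_inv (hq h2),
          (extChartAt (𝓡∂ n) q').right_inv h1]
    · rintro ⟨y, ⟨h1, h2⟩, rfl⟩
      refine ⟨transition_mem (hq' h2), ?_⟩
      rw [mem_preimage, transition, Function.comp_apply, (extChartAt (𝓡∂ n) q').left_inv (hq' h2)]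
      exact h2
  have hinj : InjOn (transition q q') A := by
    rintro y ⟨h1, h2⟩ z ⟨h3, h4⟩ h
    have h5 := (extChartAt (𝓡∂ n) q').injOn (hq' h2) (hq' h4) h
    exact (extChartAt (𝓡∂ n) q).symm.injOn h1 h3 h5
  have hder : ∀ y ∈ A, HasFDerivWithinAt (transition q q') (transitionDeriv q q' y) A y :=
    fun y hy => (hasFDerivWithinAt_transition hy.1 (hq' hy.2)).mono
      fun z hz => chartDom_subset_range q hz.1
  have hAm : MeasurableSet A := measurableSet_chart_preimage q hs
  rw [himg, lintegral_image_eq_lintegral_abs_det_fderiv_mul volume hAm hder hinj]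
  refine setLIntegral_congr_fun hAm fun y hy => ?_
  rw [hx.chartDensity_transition hR hy.1 (hq' hy.2), ENNReal.ofReal_mul (abs_nonneg _)]

/-- The area measure restricts to the chart measure on each chart domain. -/
theorem IsFreeBoundaryImmersion.areaMeasure_apply [CompactSpace M] (hR : AdmissibleRadius K R)
    (hx : IsFreeBoundaryImmersion K R x ν) (q : M) {s : Set M} (hs : MeasurableSet s)
    (hq : s ⊆ (extChartAt (𝓡∂ n) q).source) :
    areaMeasure K x s = chartArea K x q s := by
  refine le_antisymm ?_ (Measure.le_iff.1 (le_iSup (fun q => chartArea K x q) q) s hs)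
  obtain ⟨t, htc, ht⟩ := countable_cover_nhds (X := M)
    fun p => (isOpen_extChartAt_source (I := 𝓡∂ n) p).mem_nhds (mem_extChartAt_source p)
  have htne : t.Nonempty := by
    rw [nonempty_iff_ne_empty]
    rintro rfl
    have : q ∈ (univ : Set M) := mem_univ q
    rw [← ht] at this
    simp at this
  obtain ⟨c, hc⟩ := htc.exists_eq_range htne
  -- A countable measurable partition of M, each piece lying in one chart domain; `μ` below glues
  -- the chart measures along it.
  set D := disjointed fun k => (extChartAt (𝓡∂ n) (c k)).source with hD
  have hDm : ∀ k, MeasurableSet (D k) := fun k =>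
    MeasurableSet.disjointed (fun k => (isOpen_extChartAt_source (c k)).measurableSet) k
  have hDsub : ∀ k, D k ⊆ (extChartAt (𝓡∂ n) (c k)).source := fun k => disjointed_subset _ k
  have hDd : Pairwise fun i j => Disjoint (D i) (D j) := disjoint_disjointed _
  have hDu : ⋃ k, D k = univ := by
    rw [hD, iUnion_disjointed, ← ht, hc, biUnion_range]
  have hsplit : ∀ (μ : Measure M) {s : Set M}, MeasurableSet s → μ s = ∑' k, μ (s ∩ D k) := by
    intro μ s hs
    rw [← measure_iUnion (fun i j hij => (hDd hij).mono inter_subset_right inter_subset_right)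
      fun k => hs.inter (hDm k), ← inter_iUnion, hDu, inter_univ]
  set μ := Measure.sum fun k => (chartArea K x (c k)).restrict (D k) with hμ
  have hμs : ∀ {s : Set M}, MeasurableSet s → μ s = ∑' k, chartArea K x (c k) (s ∩ D k) := by
    intro s hs
    rw [hμ, Measure.sum_apply _ hs]
    simp only [Measure.restrict_apply hs]
  -- Each chart measure is bounded by μ piece by piece, because chart measures agree on overlaps;
  -- hence so is their supremum.
  have hle : areaMeasure K x ≤ μ := by
    refine iSup_le fun q' => Measure.le_iff.2 fun s hs => ?_
    rw [hsplit _ hs, hμs hs]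
    refine ENNReal.tsum_le_tsum fun k => ?_
    have hm := (hs.inter (hDm k)).inter (isOpen_extChartAt_source (I := 𝓡∂ n) q').measurableSet
    rw [← chartArea_inter_source K x q' (hs.inter (hDm k)),
      hx.chartArea_eq hR q' (c k) hm inter_subset_right
        (inter_subset_left.trans (inter_subset_right.trans (hDsub k)))]
    exact measure_mono inter_subset_left
  refine (Measure.le_iff.1 hle s hs).trans ?_
  rw [hμs hs, hsplit _ hs]
  refine (ENNReal.tsum_le_tsum fun k => ?_)
  rw [hx.chartArea_eq hR (c k) q (hs.inter (hDm k)) (inter_subset_right.trans (hDsub k))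
    (inter_subset_left.trans hq)]

theorem IsFreeBoundaryImmersion.areaMeasure_restrict [CompactSpace M] (hR : AdmissibleRadius K R)
    (hx : IsFreeBoundaryImmersion K R x ν) (q : M) :
    (areaMeasure K x).restrict (extChartAt (𝓡∂ n) q).source = chartArea K x q := by
  ext s hs
  rw [Measure.restrict_apply hs, hx.areaMeasure_apply hR q
    (hs.inter (isOpen_extChartAt_source q).measurableSet) inter_subset_right,
    chartArea_inter_source K x q hs]

/-- Integration over `M` of a function supported in a chart. -/
theorem IsFreeBoundaryImmersion.integral_eq_chart [CompactSpace M] (hR : AdmissibleRadius K R)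
    (hx : IsFreeBoundaryImmersion K R x ν) (q : M) {f : M → ℝ}
    (hf : ContinuousOn f (extChartAt (𝓡∂ n) q).source)
    (hf0 : ∀ p, p ∉ (extChartAt (𝓡∂ n) q).source → f p = 0) :
    (Integrable f (areaMeasure K x) ↔
      IntegrableOn (fun y => chartDensity K x q y * inChart f q y) (chartDom q)) ∧
    ∫ p, f p ∂(areaMeasure K x)
      = ∫ y in chartDom q, chartDensity K x q y * inChart f q y := by
  have hdens : AEMeasurable (fun y => (chartDensity K x q y).toNNReal)
      (volume.restrict (chartDom q)) :=
    ((hx.continuousOn_chartDensity hR q).aemeasurable (measurableSet_chartDom q)).real_toNNReal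
  have hae : AEMeasurable (extChartAt (𝓡∂ n) q).symm
      ((volume.restrict (chartDom q)).withDensity
        fun y => ENNReal.ofReal (chartDensity K x q y)) :=
    (aemeasurable_extChartAt_symm q).mono_ac (withDensity_absolutelyContinuous _ _)
  have hsm : AEStronglyMeasurable f (chartArea K x q) := by
    rw [← hx.areaMeasure_restrict hR q]
    exact hf.aestronglyMeasurable (isOpen_extChartAt_source q).measurableSet
  have hpt : ∀ y ∈ chartDom q, ((chartDensity K x q y).toNNReal : ℝ) • inChart f q y
      = chartDensity K x q y * inChart f q y := fun y hy => by
    rw [Real.coe_toNNReal _ (hx.chartDensity_pos hR q hy).le, smul_eq_mul]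
  constructor
  · rw [← integrableOn_iff_integrable_of_support_subset
      (s := (extChartAt (𝓡∂ n) q).source) (fun p hp => by_contra fun h => hp (hf0 p h)),
      IntegrableOn, hx.areaMeasure_restrict hR q]
    have h1 : Integrable f (chartArea K x q) ↔ Integrable (inChart f q)
        ((volume.restrict (chartDom q)).withDensity
          fun y => ((chartDensity K x q y).toNNReal : ENNReal)) := integrable_map_measure hsm hae
    rw [h1, integrable_withDensity_iff_integrable_coe_smul₀ hdens]
    exact integrableOn_congr_fun hpt (measurableSet_chartDom q)
  · rw [← setIntegral_eq_integral_of_forall_compl_eq_zero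
      (s := (extChartAt (𝓡∂ n) q).source) hf0, hx.areaMeasure_restrict hR q]
    have h1 : ∫ p, f p ∂(chartArea K x q) = ∫ y, inChart f q y
        ∂((volume.restrict (chartDom q)).withDensity
          fun y => ((chartDensity K x q y).toNNReal : ENNReal)) := integral_map hae hsm
    rw [h1, integral_withDensity_eq_integral_smul₀ hdens]
    exact setIntegral_congr_fun (measurableSet_chartDom q) hpt

/-- The density is continuous up to the boundary of the half space, so it is integrable over the
compact half ball around each chart centre; compactness of M then gives finiteness. -/
theorem IsFreeBoundaryImmersion.isFiniteMeasure [CompactSpace M] (hR : AdmissibleRadius K R)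
    (hx : IsFreeBoundaryImmersion K R x ν) : IsFiniteMeasure (areaMeasure K x) := by
  have : IsLocallyFiniteMeasure (areaMeasure K x) := by
    refine ⟨fun q => ?_⟩
    set y₀ := extChartAt (𝓡∂ n) q q with hy₀
    have hy₀U : y₀ ∈ chartDom q := mem_extChartAt_target q
    obtain ⟨r, hr, hrO⟩ := Metric.nhds_basis_closedBall.mem_iff.1 (chartOpen_mem_nhds hy₀U)
    set C := Metric.closedBall y₀ r ∩ {y | 0 ≤ y 0} with hC
    have hCc : IsCompact C := (isCompact_closedBall y₀ r).inter_right
      (isClosed_le continuous_const (by fun_prop))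
    have hCU : C ⊆ chartDom q := by
      rw [chartDom_eq]
      exact inter_subset_inter_left _ hrO
    have hopen : IsOpen ((extChartAt (𝓡∂ n) q).source ∩
        extChartAt (𝓡∂ n) q ⁻¹' Metric.ball y₀ r) :=
      (continuousOn_extChartAt q).isOpen_inter_preimage (isOpen_extChartAt_source q)
        Metric.isOpen_ball
    refine ⟨_, hopen.mem_nhds ⟨mem_extChartAt_source q, Metric.mem_ball_self hr⟩, ?_⟩
    rw [hx.areaMeasure_apply hR q hopen.measurableSet inter_subset_left,
      chartArea_apply K x q hopen.measurableSet]
    have hsub : chartDom q ∩ (extChartAt (𝓡∂ n) q).symm ⁻¹' ((extChartAt (𝓡∂ n) q).source ∩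
        extChartAt (𝓡∂ n) q ⁻¹' Metric.ball y₀ r) ⊆ C := by
      rintro y ⟨h1, h2, h3⟩
      rw [mem_preimage, (extChartAt (𝓡∂ n) q).right_inv h1] at h3
      refine ⟨Metric.ball_subset_closedBall h3, ?_⟩
      rw [chartDom_eq] at h1
      exact h1.2
    refine (lintegral_mono_set hsub).trans_lt ?_
    exact (((hx.continuousOn_chartDensity hR q).mono hCU).integrableOn_compact
      hCc).lintegral_lt_top
  infer_instance

end Area

end SpaceForm

end

open Set Filter Topology MeasureTheory
open scoped Manifold ContDiff

noncomputable section

namespace SpaceForm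

/-! ### The frame determinant as the generating polynomial of the σ_k. -/

section MeanCurvature

open Matrix

variable {n : ℕ} [NeZero n] {M : Type*} [TopologicalSpace M]
  [ChartedSpace (EuclideanHalfSpace n) M]

/-- The polynomial `∑ σ_k t^k` of the mean curvatures. -/
def meanPoly (K : SignType) (x ν : M → EuclideanSpace ℝ (Fin (n + 1))) (t : ℝ) (p : M) : ℝ :=
  ∑ k ∈ Finset.range (n + 1), sigma K x ν k p * t ^ k

/-- The derivative in `t` of the polynomial `∑ σ_k t^k`. -/
def meanPolyDeriv (K : SignType) (x ν : M → EuclideanSpace ℝ (Fin (n + 1))) (t : ℝ) (p : M) : ℝ :=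
  ∑ k ∈ Finset.range (n + 1), sigma K x ν k p * (k * t ^ (k - 1))

theorem hasDerivAt_meanPoly (K : SignType) (x ν : M → EuclideanSpace ℝ (Fin (n + 1))) (t : ℝ)
    (p : M) : HasDerivAt (fun t => meanPoly K x ν t p) (meanPolyDeriv K x ν t p) t :=
  HasDerivAt.fun_sum fun k _ => (hasDerivAt_pow k t).const_mul _

/-- `det (N, w_1, …, w_n)` in the chart at `q`. -/
def chartParallelDet (K : SignType) (x ν : M → EuclideanSpace ℝ (Fin (n + 1))) (t : ℝ) (q : M)
    (y : EuclideanSpace ℝ (Fin n)) : ℝ :=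
  (frame (inChart (euclideanNormal K x ν) q y)
    fun i => parallelDeriv K t (chartDom q) (inChart x q) (inChart (euclideanNormal K x ν) q) i
      y).det

variable [IsManifold (𝓡∂ n) ∞ M]
  {K : SignType} {R : ℝ} {x ν : M → EuclideanSpace ℝ (Fin (n + 1))}

theorem parallelDeriv_transition (hR : AdmissibleRadius K R) (hx : IsFreeBoundaryImmersion K R x ν)
    (t : ℝ) {q q' : M} {y : EuclideanSpace ℝ (Fin n)}
    (hy : y ∈ chartDom q) (hy' : (extChartAt (𝓡∂ n) q).symm y ∈ (extChartAt (𝓡∂ n) q').source)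
    (i : Fin n) :
    parallelDeriv K t (chartDom q) (inChart x q) (inChart (euclideanNormal K x ν) q) i y
      = ∑ j, transitionDeriv q q' y (EuclideanSpace.single i 1) j •
        parallelDeriv K t (chartDom q') (inChart x q') (inChart (euclideanNormal K x ν) q') j
          (transition q q' y) := by
  have h1 : ∀ f : M → EuclideanSpace ℝ (Fin (n + 1)), inChart f q' (transition q q' y)
      = inChart f q y := fun f => by
    rw [transition, Function.comp_apply, inChart_extChartAt _ hy']
    rfl
  simp only [parallelDeriv]
  rw [partialDeriv_inChart_transition hx.contMDiff hy hy',
    partialDeriv_inChart_transition (hx.contMDiff_euclideanNormal hR) hy hy', h1, h1,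
    Finset.smul_sum, Finset.smul_sum, ← Finset.sum_add_distrib]
  refine Finset.sum_congr rfl fun j _ => ?_
  module

theorem chartParallelDet_transition (hR : AdmissibleRadius K R)
    (hx : IsFreeBoundaryImmersion K R x ν)
    (t : ℝ) {q q' : M} {y : EuclideanSpace ℝ (Fin n)}
    (hy : y ∈ chartDom q) (hy' : (extChartAt (𝓡∂ n) q).symm y ∈ (extChartAt (𝓡∂ n) q').source) :
    chartParallelDet K x ν t q y
      = (transitionDeriv q q' y).det * chartParallelDet K x ν t q' (transition q q' y) := by
  rw [chartParallelDet, chartParallelDet, det_eq_det_matrix, ← det_frame_mul]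
  congr 2
  · rw [transition, Function.comp_apply, inChart_extChartAt _ hy']
    rfl
  · ext1 i
    exact parallelDeriv_transition hR hx t hy hy' i

theorem IsPatch.det_parallelDeriv_mul {U : Set (EuclideanSpace ℝ (Fin n))}
    {x N : EuclideanSpace ℝ (Fin n) → EuclideanSpace ℝ (Fin (n + 1))}
    (h : IsPatch K R U x N) (t : ℝ) {y} (hy : y ∈ U) :
    (frame (N y) fun i => parallelDeriv K t U x N i y).det *
      (frame (N y) fun i => partialDeriv U x i y).det
      = (Matrix.of fun i j => (inner ℝ (parallelDeriv K t U x N i y) (partialDeriv U x j y) : ℝ)).det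
      := by
  rw [frame, frame, det_frameMatrix_mul_det_frameMatrix]
  · congr 1
    ext i j
    simp [ofLp_dotProduct]
  · rw [ofLp_dotProduct, h.unit y hy]
  · intro i
    have h1 : inner ℝ (partialDeriv U x i y) (N y) = (0 : ℝ) := by
      rw [real_inner_comm]; exact h.normal y hy _
    rw [ofLp_dotProduct, parallelDeriv, inner_add_left, inner_smul_left, inner_smul_left,
      h.inner_partialDeriv_normal_self hy, h1]
    simp

/-- The second fundamental form in terms of the Euclidean unit normal. -/
theorem secondFundamentalForm_eq (hR : AdmissibleRadius K R) (hx : IsFreeBoundaryImmersion K R x ν)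
    (p : M) (i j : Fin n) :
    secondFundamentalForm K x ν p (tangentBasis p i) (tangentBasis p j)
      = conformalFactor K (x p) *
        (inner ℝ (partialDeriv (chartDom p) (inChart (euclideanNormal K x ν) p) i
            (extChartAt (𝓡∂ n) p p))
          (partialDeriv (chartDom p) (inChart x p) j (extChartAt (𝓡∂ n) p p))
        - curv K * conformalFactor K (x p) * inner ℝ (x p) (euclideanNormal K x ν p) *
          inner ℝ (partialDeriv (chartDom p) (inChart x p) i (extChartAt (𝓡∂ n) p p))
            (partialDeriv (chartDom p) (inChart x p) j (extChartAt (𝓡∂ n) p p))) := by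
  have hy : extChartAt (𝓡∂ n) p p ∈ chartDom p := mem_extChartAt_target p
  have hp := hx.isPatch hR p
  set y := extChartAt (𝓡∂ n) p p with hydef
  have hxy : inChart x p y = x p := inChart_extChartAt x (mem_extChartAt_source p)
  have hνy : inChart ν p y = ν p := inChart_extChartAt ν (mem_extChartAt_source p)
  have hpos := conformalFactor_pos (hx.mem_domain hR p)
  have hnorm : ∀ i, inner ℝ (ν p) (partialDeriv (chartDom p) (inChart x p) i y) = (0 : ℝ) := by
    intro i
    have := hx.normal p (tangentBasis p i)
    rw [metric, differential_tangentBasis hx.contMDiff] at this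
    rcases mul_eq_zero.1 this with h | h
    · exact absurd h (pow_ne_zero _ hpos.ne')
    · exact h
  -- The derivative of N = λν differs from λ ∂_i ν by a multiple of ν, which pairs to zero with ∂_j
  -- x; so does the Christoffel term along ν.
  have hη : ∃ c : ℝ, partialDeriv (chartDom p) (inChart (euclideanNormal K x ν) p) i y
      = conformalFactor K (x p) • partialDeriv (chartDom p) (inChart ν p) i y + c • ν p := by
    have h1 := (hp.hasFDerivWithinAt_conformalFactor hy).smul
      (hasFDerivWithinAt_of_contDiffOn (contDiffOn_inChart hx.contMDiff_normal p) hy)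
    have h2 : HasFDerivWithinAt (inChart (euclideanNormal K x ν) p) _ (chartDom p) y := h1
    refine ⟨(-curv K * conformalFactor K (inChart x p y) ^ 2 *
      inner ℝ (inChart x p y) (partialDeriv (chartDom p) (inChart x p) i y)), ?_⟩
    rw [partialDeriv, h2.fderivWithin (uniqueDiffOn_chartDom p y hy)]
    simp [hxy, hνy, partialDeriv]
  obtain ⟨c, hc⟩ := hη
  rw [secondFundamentalForm, covDeriv, metric, differential_tangentBasis hx.contMDiff,
    differential_tangentBasis hx.contMDiff, differential_tangentBasis hx.contMDiff_normal,
    christoffel_eq (hx.mem_domain hR p), hc]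
  have hn' : inner ℝ (partialDeriv (chartDom p) (inChart x p) i y) (ν p) = (0 : ℝ) := by
    rw [real_inner_comm, hnorm]
  rw [← hydef, hn']
  simp only [inner_add_left, inner_sub_left, inner_smul_left, inner_smul_right, hnorm,
    euclideanNormal, conj_trivial]
  ring

/-- Multiplied by det(N, ξ), the left side becomes the determinant of ⟨w_i, ξ_j⟩ = λ⁻¹(G + tH),
where G and H are the matrices of the two fundamental forms. Factoring G + tH = G(1 + t G⁻¹H) gives
λ^n det(N, ξ)² Σ σ_k t^k, and one nonzero factor det(N, ξ) cancels. -/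
theorem chartParallelDet_self (hR : AdmissibleRadius K R) (hx : IsFreeBoundaryImmersion K R x ν)
    (t : ℝ) (p : M) :
    chartParallelDet K x ν t p (extChartAt (𝓡∂ n) p p)
      = chartDet K x ν p (extChartAt (𝓡∂ n) p p) * conformalFactor K (x p) ^ n
        * meanPoly K x ν t p := by
  have hy : extChartAt (𝓡∂ n) p p ∈ chartDom p := mem_extChartAt_target p
  have hp := hx.isPatch hR p
  have hsff := secondFundamentalForm_eq hR hx p
  set y := extChartAt (𝓡∂ n) p p with hydef
  have hxy : inChart x p y = x p := inChart_extChartAt x (mem_extChartAt_source p)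
  have hNy : inChart (euclideanNormal K x ν) p y = euclideanNormal K x ν p :=
    inChart_extChartAt _ (mem_extChartAt_source p)
  have hpos := conformalFactor_pos (hx.mem_domain hR p)
  set l := conformalFactor K (x p) with hl
  set ξ := fun i => partialDeriv (chartDom p) (inChart x p) i y with hξ
  set G : Matrix (Fin n) (Fin n) ℝ :=
    Matrix.of fun i j => inducedMetric K x p (tangentBasis p i) (tangentBasis p j) with hG
  set H : Matrix (Fin n) (Fin n) ℝ :=
    Matrix.of fun i j => secondFundamentalForm K x ν p (tangentBasis p i) (tangentBasis p j) with hH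
  have hGg : G = l ^ 2 • Matrix.gram ℝ ξ := by
    ext i j
    simp only [hG, Matrix.of_apply, inducedMetric, metric, differential_tangentBasis hx.contMDiff]
    rfl
  have hGpos : G.PosDef := by
    rw [hGg]
    exact (Matrix.posDef_gram_of_linearIndependent (𝕜 := ℝ) (hp.linearIndependent hy)).smul
      (pow_pos hpos 2)
  have hHs : H.IsSymm := by
    ext i j
    simp only [hH, Matrix.transpose_apply, Matrix.of_apply, hsff]
    rw [hp.inner_partialDeriv_normal_symm hy, real_inner_comm (ξ i)]
  have hs : meanPoly K x ν t p = (1 + t • (G⁻¹ * H)).det := by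
    rw [det_one_add_smul_eq_sum_esymm _ (splits_charpoly_inv_mul hGpos hHs), Fintype.card_fin]
    rfl
  have hw : (Matrix.of fun i j => (inner ℝ (parallelDeriv K t (chartDom p) (inChart x p)
      (inChart (euclideanNormal K x ν) p) i y) (ξ j) : ℝ)) = l⁻¹ • (G + t • H) := by
    ext i j
    simp only [hG, hH, Matrix.of_apply, Matrix.smul_apply, Matrix.add_apply, smul_eq_mul, hsff,
      parallelDeriv, inducedMetric, metric, differential_tangentBasis hx.contMDiff, inner_add_left,
      inner_smul_left, tangentFactor, hxy, hNy, conj_trivial]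
    rw [← hydef, ← hl]
    field_simp
    ring
  have hD := hp.det_parallelDeriv_mul t hy
  change chartParallelDet K x ν t p y * chartDet K x ν p y = _ at hD
  have hsq : chartDet K x ν p y ^ 2 = (Matrix.gram ℝ ξ).det := hp.det_frame_sq hy
  have hfac : G + t • H = G * (1 + t • (G⁻¹ * H)) := by
    rw [Matrix.mul_add, Matrix.mul_one, Matrix.mul_smul, ← Matrix.mul_assoc,
      Matrix.mul_nonsing_inv _ (isUnit_iff_ne_zero.2 hGpos.det_pos.ne'), Matrix.one_mul]
  have hne := hx.chartDet_ne_zero hR p hy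
  have hdG : G.det = (l ^ 2) ^ n * chartDet K x ν p y ^ 2 := by
    rw [hGg, Matrix.det_smul, Fintype.card_fin, hsq]
  have hfin : chartParallelDet K x ν t p y * chartDet K x ν p y
      = (chartDet K x ν p y * l ^ n * meanPoly K x ν t p) * chartDet K x ν p y := by
    rw [hD, hw, Matrix.det_smul, Fintype.card_fin, hfac, Matrix.det_mul, ← hs, hdG]
    have : l⁻¹ ^ n * (l ^ 2) ^ n = l ^ n := by
      rw [← mul_pow]
      congr 1
      field_simp
    linear_combination chartDet K x ν p y ^ 2 * meanPoly K x ν t p * this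
  exact mul_right_cancel₀ hne hfin

/-- Both determinants pick up the same factor when passing to the chart centred at the point, where
`chartParallelDet_self` applies. -/
theorem chartParallelDet_eq (hR : AdmissibleRadius K R) (hx : IsFreeBoundaryImmersion K R x ν)
    (t : ℝ) {q : M} {y : EuclideanSpace ℝ (Fin n)} (hy : y ∈ chartDom q) :
    chartParallelDet K x ν t q y = chartDet K x ν q y * conformalFactor K (inChart x q y) ^ n *
      inChart (meanPoly K x ν t) q y := by
  set p := (extChartAt (𝓡∂ n) q).symm y with hp
  have hsrc : (extChartAt (𝓡∂ n) q).symm y ∈ (extChartAt (𝓡∂ n) p).source :=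
    mem_extChartAt_source p
  rw [chartParallelDet_transition hR hx t hy hsrc, chartDet_transition hx.contMDiff hy hsrc]
  have : transition q p y = extChartAt (𝓡∂ n) p p := rfl
  rw [this, chartParallelDet_self hR hx]
  simp only [inChart_apply, ← hp]
  ring

/-- The preceding identity holds for all t, so it may be differentiated in t; the rows w_i are
affine in t. -/
theorem parallelDetDeriv_eq (hR : AdmissibleRadius K R) (hx : IsFreeBoundaryImmersion K R x ν)
    (t : ℝ) {q : M} {y : EuclideanSpace ℝ (Fin n)} (hy : y ∈ chartDom q) :
    parallelDetDeriv K t (chartDom q) (inChart x q) (inChart (euclideanNormal K x ν) q) y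
      = chartDet K x ν q y * conformalFactor K (inChart x q y) ^ n *
      inChart (meanPolyDeriv K x ν t) q y := by
  have h1 : HasDerivAt (fun t => chartParallelDet K x ν t q y)
      (chartDet K x ν q y * conformalFactor K (inChart x q y) ^ n *
      inChart (meanPolyDeriv K x ν t) q y) t := by
    have : (fun t => chartParallelDet K x ν t q y) = fun t => chartDet K x ν q y *
        conformalFactor K (inChart x q y) ^ n * inChart (meanPoly K x ν t) q y := by
      ext1 t
      exact chartParallelDet_eq hR hx t hy
    rw [this]
    exact (hasDerivAt_meanPoly K x ν t _).const_mul _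
  refine HasDerivAt.unique ?_ h1
  set N := inChart (n := n) (euclideanNormal K x ν) q
  set x' := inChart (n := n) x q
  set v : Fin n → Fin (n + 1) → ℝ := fun i =>
    (conformalFactor K (x' y) • partialDeriv (chartDom q) x' i y).ofLp
  set w : Fin n → Fin (n + 1) → ℝ := fun i => (partialDeriv (chartDom q) N i y -
    (curv K * conformalFactor K (x' y) * inner ℝ (x' y) (N y)) •
      partialDeriv (chartDom q) x' i y).ofLp
  have h2 := hasDerivAt_det_frameMatrix (N y).ofLp v w t
  have h3 : ∀ s : ℝ, frameMatrix (N y).ofLp (v + s • w)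
      = frame (N y) fun i => parallelDeriv K s (chartDom q) x' N i y := by
    intro s
    rw [frame]
    congr 1
    ext1 i
    have : conformalFactor K (x' y) • partialDeriv (chartDom q) x' i y + s •
        (partialDeriv (chartDom q) N i y -
          (curv K * conformalFactor K (x' y) * inner ℝ (x' y) (N y)) •
          partialDeriv (chartDom q) x' i y) = parallelDeriv K s (chartDom q) x' N i y := by
      rw [parallelDeriv, tangentFactor]
      module
    exact congrArg WithLp.ofLp this
  simp only [h3] at h2
  exact h2

theorem continuous_of_forall_chart {f : M → ℝ}
    (hf : ∀ q, ContinuousOn (inChart f q) (chartDom (n := n) q)) : Continuous f := by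
  rw [continuous_iff_continuousAt]
  intro q
  have h1 : ContinuousOn (inChart f q ∘ extChartAt (𝓡∂ n) q) (extChartAt (𝓡∂ n) q).source :=
    (hf q).comp (continuousOn_extChartAt q) fun p hp => (extChartAt (𝓡∂ n) q).map_source hp
  have h2 : ContinuousOn f (extChartAt (𝓡∂ n) q).source := h1.congr fun p hp =>
    (inChart_extChartAt f hp).symm
  exact h2.continuousAt ((isOpen_extChartAt_source q).mem_nhds (mem_extChartAt_source q))

theorem continuous_meanPoly (hR : AdmissibleRadius K R) (hx : IsFreeBoundaryImmersion K R x ν)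
    (t : ℝ) : Continuous (meanPoly K x ν t) := by
  refine continuous_of_forall_chart (n := n) fun q => ?_
  have hp := hx.isPatch hR q
  have h1 : ∀ y ∈ chartDom q, chartDet K x ν q y * conformalFactor K (inChart x q y) ^ n ≠ 0 :=
    fun y hy => mul_ne_zero (hx.chartDet_ne_zero hR q hy)
      (pow_ne_zero _ (conformalFactor_pos (hp.mem_domain hy)).ne')
  refine ((hp.continuousOn_det_frame t).div
    (hp.continuousOn_det_frame_partialDeriv.mul (hp.continuousOn_conformalFactor.pow n))
      h1).congr fun y hy => ?_
  refine (eq_div_iff (h1 y hy)).2 ?_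
  rw [mul_comm]
  exact (chartParallelDet_eq hR hx t hy).symm

/-- Continuity is not visible from a multiset of roots. But for each fixed t the polynomial Σ σ_k
t^k is a quotient of continuous determinants, and Lagrange interpolation at the nodes 0, …, n
expresses every σ_k as a fixed linear combination of its values. -/
theorem continuous_sigma (hR : AdmissibleRadius K R) (hx : IsFreeBoundaryImmersion K R x ν)
    {k : ℕ} (hk : k ≤ n) : Continuous (sigma K x ν k) := by
  set P : M → Polynomial ℝ := fun p => ∑ k ∈ Finset.range (n + 1),
    Polynomial.monomial k (sigma K x ν k p) with hP
  set τ : Fin (n + 1) → ℝ := fun i => (i : ℝ) with hτ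
  have hτi : InjOn τ (Finset.univ : Finset (Fin (n + 1))) := by
    intro i _ j _ hij
    simpa [hτ, Fin.val_inj] using hij
  have hdeg : ∀ p, (P p).degree < (Finset.univ : Finset (Fin (n + 1))).card := by
    intro p
    rw [Finset.card_univ, Fintype.card_fin]
    refine (Polynomial.degree_sum_le _ _).trans_lt ?_
    rw [Finset.sup_lt_iff (by exact WithBot.bot_lt_coe _)]
    intro j hj
    exact (Polynomial.degree_monomial_le _ _).trans_lt (by exact_mod_cast Finset.mem_range.1 hj)
  have heval : ∀ p t, (P p).eval t = meanPoly K x ν t p := by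
    intro p t
    simp [hP, Polynomial.eval_finsetSum, Polynomial.eval_monomial, meanPoly]
  have hint : ∀ p, sigma K x ν k p
      = ∑ i, meanPoly K x ν (τ i) p * (Lagrange.basis Finset.univ τ i).coeff k := by
    intro p
    have h1 := congrArg (fun Q => Polynomial.coeff Q k) (Lagrange.eq_interpolate hτi (hdeg p))
    simp only [Lagrange.interpolate_apply, Polynomial.finsetSum_coeff, Polynomial.coeff_C_mul,
      heval] at h1
    rw [← h1]
    simp [hP, Polynomial.coeff_monomial, Nat.lt_succ_iff.2 hk]
  have : sigma K x ν k = fun p => ∑ i, meanPoly K x ν (τ i) p *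
      (Lagrange.basis Finset.univ τ i).coeff k := funext hint
  rw [this]
  exact continuous_finsetSum _ fun i _ => (continuous_meanPoly hR hx _).mul continuous_const

end MeanCurvature

end SpaceForm

end

open Set Filter Topology MeasureTheory
open scoped Manifold ContDiff

noncomputable section

namespace SpaceForm

/-! ### Globalization and the Hsiung-Minkowski formulas. -/

section MinkowskiFormula

open Matrix

variable {n : ℕ} [NeZero n] {M : Type*} [TopologicalSpace M]
  [ChartedSpace (EuclideanHalfSpace n) M]

/-- The pairing of `dφ` with the flux form, relative to the area form. -/
def fluxPairing (K : SignType) (R : ℝ) (a : EuclideanSpace ℝ (Fin (n + 1)))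
    (x ν : M → EuclideanSpace ℝ (Fin (n + 1))) (t : ℝ) (φ : M → ℝ) (p : M) : ℝ :=
  (∑ j, partialDeriv (chartDom p) (inChart φ p) j (extChartAt (𝓡∂ n) p p) *
    flux K R a t (chartDom p) (inChart x p) (inChart (euclideanNormal K x ν) p) j
      (extChartAt (𝓡∂ n) p p)) /
    (chartDet K x ν p (extChartAt (𝓡∂ n) p p) * conformalFactor K (x p) ^ n)

/-- The divergence of the flux form, relative to the area form. -/
def fluxDensity (K : SignType) (R : ℝ) (a : EuclideanSpace ℝ (Fin (n + 1)))
    (x ν : M → EuclideanSpace ℝ (Fin (n + 1))) (t : ℝ) (p : M) : ℝ :=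
  V K a (x p) * (n * meanPoly K x ν t p - t * meanPolyDeriv K x ν t p)
    - metric K (x p) (X K R a (x p)) (ν p) * meanPolyDeriv K x ν t p

variable [IsManifold (𝓡∂ n) ∞ M]
  {K : SignType} {R : ℝ} {x ν : M → EuclideanSpace ℝ (Fin (n + 1))}

theorem metric_normal_eq (x ν : M → EuclideanSpace ℝ (Fin (n + 1))) (p : M)
    (w : EuclideanSpace ℝ (Fin (n + 1))) :
    metric K (x p) w (ν p) = conformalFactor K (x p) * inner ℝ w (euclideanNormal K x ν p) := by
  rw [metric, euclideanNormal, inner_smul_right]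
  ring

theorem fluxDiv_eq (hR : AdmissibleRadius K R) (hx : IsFreeBoundaryImmersion K R x ν)
    (a : EuclideanSpace ℝ (Fin (n + 1))) (t : ℝ) {q : M} {y : EuclideanSpace ℝ (Fin n)}
    (hy : y ∈ chartDom q) :
    fluxDiv K R a t (chartDom q) (inChart x q) (inChart (euclideanNormal K x ν) q) y
      = chartDet K x ν q y * conformalFactor K (inChart x q y) ^ n *
        inChart (fluxDensity K R a x ν t) q y := by
  have h1 := chartParallelDet_eq hR hx t hy
  rw [chartParallelDet] at h1
  rw [fluxDiv, h1, parallelDetDeriv_eq hR hx t hy]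
  simp only [inChart_apply, fluxDensity]
  rw [metric_normal_eq (K := K) x ν]
  ring

/-- The function `fluxPairing` is defined through the chart centred at each point; the covariance of
covector and flux under a change of frame makes the same expression valid in every chart. -/
theorem sum_partialDeriv_mul_flux (hR : AdmissibleRadius K R)
    (hx : IsFreeBoundaryImmersion K R x ν)
    (a : EuclideanSpace ℝ (Fin (n + 1))) (t : ℝ) {φ : M → ℝ} (hφ : ContMDiff (𝓡∂ n) 𝓘(ℝ, ℝ) ∞ φ)
    {q : M} {y : EuclideanSpace ℝ (Fin n)} (hy : y ∈ chartDom q) :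
    ∑ j, partialDeriv (chartDom q) (inChart φ q) j y *
      flux K R a t (chartDom q) (inChart x q) (inChart (euclideanNormal K x ν) q) j y
      = chartDet K x ν q y * conformalFactor K (inChart x q y) ^ n *
        inChart (fluxPairing K R a x ν t φ) q y := by
  set p := (extChartAt (𝓡∂ n) q).symm y with hp
  have hsrc : (extChartAt (𝓡∂ n) q).symm y ∈ (extChartAt (𝓡∂ n) p).source :=
    mem_extChartAt_source p
  have htr : transition q p y = extChartAt (𝓡∂ n) p p := rfl
  have hxp : inChart x q y = x p := rfl
  have hNp : inChart (euclideanNormal K x ν) q y = euclideanNormal K x ν p := rfl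
  have hxp' : inChart x p (extChartAt (𝓡∂ n) p p) = x p :=
    inChart_extChartAt x (mem_extChartAt_source p)
  have hNp' : inChart (euclideanNormal K x ν) p (extChartAt (𝓡∂ n) p p) = euclideanNormal K x ν p :=
    inChart_extChartAt _ (mem_extChartAt_source p)
  have hl := pow_ne_zero n (conformalFactor_pos (hx.mem_domain hR p)).ne'
  have hd := hx.chartDet_ne_zero hR p (mem_extChartAt_target p : extChartAt (𝓡∂ n) p p ∈ chartDom p)
  have hpair : inChart (fluxPairing K R a x ν t φ) q y = fluxPairing K R a x ν t φ p := rfl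
  rw [hpair, fluxPairing, chartDet_transition hx.contMDiff hy hsrc, htr, hxp]
  have hsum : ∑ j, partialDeriv (chartDom q) (inChart φ q) j y *
      flux K R a t (chartDom q) (inChart x q) (inChart (euclideanNormal K x ν) q) j y
      = (transitionDeriv q p y).det *
        ∑ j, partialDeriv (chartDom p) (inChart φ p) j (extChartAt (𝓡∂ n) p p) *
    flux K R a t (chartDom p) (inChart x p) (inChart (euclideanNormal K x ν) p) j
      (extChartAt (𝓡∂ n) p p) := by
    have hB := sum_mul_det_frameMatrix_updateRow_mul (euclideanNormal K x ν p).ofLp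
      (X K R a (x p)).ofLp
      (fun j => (parallelDeriv K t (chartDom p) (inChart x p) (inChart (euclideanNormal K x ν) p) j
        (extChartAt (𝓡∂ n) p p)).ofLp)
      (fun j => partialDeriv (chartDom p) (inChart φ p) j (extChartAt (𝓡∂ n) p p))
      (Matrix.of fun i j => transitionDeriv q p y (EuclideanSpace.single i 1) j)
    have hfr : frame (euclideanNormal K x ν p) (fun i => parallelDeriv K t (chartDom q)
        (inChart x q) (inChart (euclideanNormal K x ν) q) i y) = frameMatrix
        (euclideanNormal K x ν p).ofLp fun i => ∑ j,
          (Matrix.of fun i j => transitionDeriv q p y (EuclideanSpace.single i 1) j) i j •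
          (parallelDeriv K t (chartDom p) (inChart x p) (inChart (euclideanNormal K x ν) p) j
        (extChartAt (𝓡∂ n) p p)).ofLp := by
      rw [frame]
      congr 1
      ext1 i
      rw [parallelDeriv_transition hR hx t hy hsrc, htr]
      simp
    rw [det_eq_det_matrix]
    simp only [flux, hxp, hNp, hxp', hNp', hfr]
    calc _ = conformalFactor K (x p) * ∑ i, (∑ j,
          (Matrix.of fun i j => transitionDeriv q p y (EuclideanSpace.single i 1) j) i j *
          partialDeriv (chartDom p) (inChart φ p) j (extChartAt (𝓡∂ n) p p)) *
          ((frameMatrix (euclideanNormal K x ν p).ofLp fun i => ∑ j,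
          (Matrix.of fun i j => transitionDeriv q p y (EuclideanSpace.single i 1) j) i j •
          (parallelDeriv K t (chartDom p) (inChart x p) (inChart (euclideanNormal K x ν) p) j
        (extChartAt (𝓡∂ n) p p)).ofLp).updateRow i.succ (X K R a (x p)).ofLp).det := by
          rw [Finset.mul_sum]
          refine Finset.sum_congr rfl fun i _ => ?_
          rw [partialDeriv_inChart_transition hφ hy hsrc, htr]
          simp only [smul_eq_mul, Matrix.of_apply]
          ring
      _ = _ := by
          rw [hB, ← mul_assoc, mul_comm (conformalFactor K (x p)), mul_assoc, Finset.mul_sum]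
          congr 1
          refine Finset.sum_congr rfl fun i _ => ?_
          simp only [frame]
          ring
  rw [hsum]
  field_simp

theorem continuousOn_flux {U : Set (EuclideanSpace ℝ (Fin n))}
    {x N : EuclideanSpace ℝ (Fin n) → EuclideanSpace ℝ (Fin (n + 1))} (hR : AdmissibleRadius K R)
    (h : IsPatch K R U x N) (a : EuclideanSpace ℝ (Fin (n + 1))) (t : ℝ) (i : Fin n) :
    ContinuousOn (flux K R a t U x N i) U := fun _ hy =>
  ((h.divergence_flux hR a t hy).choose_spec.1 i).continuousWithinAt

theorem continuous_fluxPairing (hR : AdmissibleRadius K R) (hx : IsFreeBoundaryImmersion K R x ν)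
    (a : EuclideanSpace ℝ (Fin (n + 1))) (t : ℝ) {φ : M → ℝ}
    (hφ : ContMDiff (𝓡∂ n) 𝓘(ℝ, ℝ) ∞ φ) : Continuous (fluxPairing K R a x ν t φ) := by
  refine continuous_of_forall_chart (n := n) fun q => ?_
  have hp := hx.isPatch hR q
  have h1 : ∀ y ∈ chartDom q, chartDet K x ν q y * conformalFactor K (inChart x q y) ^ n ≠ 0 :=
    fun y hy => mul_ne_zero (hx.chartDet_ne_zero hR q hy)
      (pow_ne_zero _ (conformalFactor_pos (hp.mem_domain hy)).ne')
  have h2 : ContinuousOn (fun y => ∑ j, partialDeriv (chartDom q) (inChart φ q) j y *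
      flux K R a t (chartDom q) (inChart x q) (inChart (euclideanNormal K x ν) q) j y)
      (chartDom q) := continuousOn_finsetSum _ fun j _ =>
    (contDiffOn_partialDeriv (contDiffOn_inChart hφ q) (uniqueDiffOn_chartDom q)
      j).continuousOn.mul (continuousOn_flux hR hp a t j)
  refine (h2.div
    (hp.continuousOn_det_frame_partialDeriv.mul (hp.continuousOn_conformalFactor.pow n))
      h1).congr fun y hy => ?_
  refine (eq_div_iff (h1 y hy)).2 ?_
  rw [mul_comm]
  exact (sum_partialDeriv_mul_flux hR hx a t hφ hy).symm

theorem continuous_V_comp (hR : AdmissibleRadius K R) (hx : IsFreeBoundaryImmersion K R x ν)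
    (a : EuclideanSpace ℝ (Fin (n + 1))) : Continuous fun p => V K a (x p) :=
  (continuousOn_V K a).comp_continuous hx.contMDiff.continuous fun p => hx.mem_domain hR p

theorem continuous_metric_X (hR : AdmissibleRadius K R) (hx : IsFreeBoundaryImmersion K R x ν)
    (a : EuclideanSpace ℝ (Fin (n + 1))) :
    Continuous fun p => metric K (x p) (X K R a (x p)) (ν p) := by
  have h1 : Continuous fun p => conformalFactor K (x p) := by
    rw [continuous_iff_continuousAt]
    intro p
    exact (differentiableAt_conformalFactor (hx.mem_domain hR p)).continuousAt.comp
      hx.contMDiff.continuous.continuousAt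
  have h2 := (contDiff_X hR a).continuous.comp hx.contMDiff.continuous
  exact (h1.pow 2).mul (h2.inner hx.contMDiff_normal.continuous)

theorem continuous_meanPolyDeriv (hR : AdmissibleRadius K R)
    (hx : IsFreeBoundaryImmersion K R x ν) (t : ℝ) : Continuous (meanPolyDeriv K x ν t) :=
  continuous_finsetSum _ fun _ hk =>
    (continuous_sigma hR hx (Nat.lt_succ_iff.1 (Finset.mem_range.1 hk))).mul continuous_const

theorem continuous_fluxDensity (hR : AdmissibleRadius K R) (hx : IsFreeBoundaryImmersion K R x ν)
    (a : EuclideanSpace ℝ (Fin (n + 1))) (t : ℝ) : Continuous (fluxDensity K R a x ν t) :=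
  ((continuous_V_comp hR hx a).mul
    ((continuous_const.mul (continuous_meanPoly hR hx t)).sub
      (continuous_const.mul (continuous_meanPolyDeriv hR hx t)))).sub
    ((continuous_metric_X hR hx a).mul (continuous_meanPolyDeriv hR hx t))

theorem fluxPairing_eq_zero (a : EuclideanSpace ℝ (Fin (n + 1))) (t : ℝ) {φ : M → ℝ} {p : M}
    (hp : p ∉ tsupport φ) : fluxPairing K R a x ν t φ p = 0 := by
  have h0 : φ =ᶠ[𝓝 p] fun _ => 0 := notMem_tsupport_iff_eventuallyEq.1 hp
  have h1 : inChart φ p =ᶠ[𝓝[chartDom p] (extChartAt (𝓡∂ n) p p)] fun _ => 0 := by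
    have h2 : Tendsto (extChartAt (𝓡∂ n) p).symm (𝓝[chartDom p] (extChartAt (𝓡∂ n) p p)) (𝓝 p) := by
      have := continuousOn_extChartAt_symm (I := 𝓡∂ n) p _ (mem_extChartAt_target p)
      rw [ContinuousWithinAt, extChartAt_to_inv] at this
      exact this
    exact h2.eventually h0
  have h3 : ∀ j, partialDeriv (chartDom p) (inChart φ p) j (extChartAt (𝓡∂ n) p p) = 0 := by
    intro j
    rw [partialDeriv, h1.fderivWithin_eq_of_mem (mem_extChartAt_target p)]
    simp
  simp only [fluxPairing, h3, zero_mul, Finset.sum_const_zero, zero_div]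

/-- The differentials of a partition of unity add up to d1 = 0. -/
theorem fluxPairing_sum (a : EuclideanSpace ℝ (Fin (n + 1))) (t : ℝ) {ι : Type*} (s : Finset ι)
    {φ : ι → M → ℝ} (hφ : ∀ i, ContMDiff (𝓡∂ n) 𝓘(ℝ, ℝ) ∞ (φ i)) (hs : ∀ p, ∑ i ∈ s, φ i p = 1)
    (p : M) : ∑ i ∈ s, fluxPairing K R a x ν t (φ i) p = 0 := by
  have hy : extChartAt (𝓡∂ n) p p ∈ chartDom p := mem_extChartAt_target p
  have h1 : ∀ j, ∑ i ∈ s, partialDeriv (chartDom p) (inChart (φ i) p) j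
      (extChartAt (𝓡∂ n) p p) = 0 := by
    intro j
    have h2 : HasFDerivWithinAt (fun y => ∑ i ∈ s, inChart (n := n) (φ i) p y)
        (∑ i ∈ s, fderivWithin ℝ (inChart (φ i) p) (chartDom p) (extChartAt (𝓡∂ n) p p))
        (chartDom p) (extChartAt (𝓡∂ n) p p) := HasFDerivWithinAt.fun_sum fun i _ =>
      hasFDerivWithinAt_of_contDiffOn (contDiffOn_inChart (hφ i) p) hy
    have h3 : (fun y => ∑ i ∈ s, inChart (n := n) (φ i) p y) = fun _ => (1 : ℝ) := by
      ext1 y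
      exact hs _
    rw [h3] at h2
    have h4 := (uniqueDiffOn_chartDom p _ hy).eq h2 (hasFDerivWithinAt_const _ _ _)
    have h5 := congrArg (fun L => L (EuclideanSpace.single j (1 : ℝ))) h4
    simpa [partialDeriv, _root_.sum_apply] using h5
  simp only [fluxPairing]
  rw [← Finset.sum_div, Finset.sum_comm]
  simp only [← Finset.sum_mul, h1]
  simp

variable [T2Space M] [CompactSpace M] [MeasurableSpace M] [BorelSpace M]

theorem IsFreeBoundaryImmersion.integrable_of_continuous (hR : AdmissibleRadius K R)
    (hx : IsFreeBoundaryImmersion K R x ν) {f : M → ℝ} (hf : Continuous f) :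
    Integrable f (areaMeasure K x) := by
  have := hx.isFiniteMeasure hR
  exact hf.integrable_of_hasCompactSupport (HasCompactSupport.of_compactSpace f)

/-- The divergence theorem for the flux form, localized in a chart. -/
theorem integral_fluxDensity_chart (hR : AdmissibleRadius K R)
    (hx : IsFreeBoundaryImmersion K R x ν)
    (a : EuclideanSpace ℝ (Fin (n + 1))) (t : ℝ) {φ : M → ℝ} (hφ : ContMDiff (𝓡∂ n) 𝓘(ℝ, ℝ) ∞ φ)
    (q : M) (hq : tsupport φ ⊆ (extChartAt (𝓡∂ n) q).source) :
    ∫ p, (φ p * fluxDensity K R a x ν t p + fluxPairing K R a x ν t φ p) ∂(areaMeasure K x)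
      = 0 := by
  have hc : Continuous fun p => φ p * fluxDensity K R a x ν t p + fluxPairing K R a x ν t φ p :=
    (hφ.continuous.mul (continuous_fluxDensity hR hx a t)).add
      (continuous_fluxPairing hR hx a t hφ)
  rw [(hx.integral_eq_chart hR q hc.continuousOn ?_).2]
  · have hC : IsCompact (extChartAt (𝓡∂ n) q '' tsupport φ) :=
      (isClosed_tsupport φ).isCompact.image_of_continuousOn ((continuousOn_extChartAt q).mono hq)
    have hCU : extChartAt (𝓡∂ n) q '' tsupport φ ⊆ chartDom q := by
      rintro _ ⟨p, hp, rfl⟩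
      exact (extChartAt (𝓡∂ n) q).map_source (hq hp)
    have hmain := (hx.isPatch hR q).integral_flux hR (isOpen_chartOpen q) (chartDom_eq q)
      (hx.boundary_chart hR q) hC hCU (contDiffOn_inChart hφ q) (fun y hy hyC => by
        by_contra h
        refine hyC ⟨_, subset_tsupport φ h, (extChartAt (𝓡∂ n) q).right_inv hy⟩) a t
    rw [← hmain]
    refine setIntegral_congr_fun (measurableSet_chartDom q) fun y hy => ?_
    change _ = Real.sign (chartDet K x ν q y) * _
    rw [fluxDiv_eq hR hx a t hy, sum_partialDeriv_mul_flux hR hx a t hφ hy,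
      hx.chartDensity_eq hR q hy]
    have hs : Real.sign (chartDet K x ν q y) * chartDet K x ν q y = |chartDet K x ν q y| := by
      rcases (hx.chartDet_ne_zero hR q hy).lt_or_gt with h | h
      · rw [Real.sign_of_neg h, abs_of_neg h]; ring
      · rw [Real.sign_of_pos h, abs_of_pos h]; ring
    rw [← hs]
    simp only [inChart_apply]
    ring
  · intro p hp
    have h1 : p ∉ tsupport φ := fun h => hp (hq h)
    rw [image_eq_zero_of_notMem_tsupport h1, fluxPairing_eq_zero a t h1]
    ring

/-- Localize with a partition of unity subordinate to the charts. The extra terms dφ ∧ flux, which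
the local divergence theorem produces, cancel in the sum. -/
theorem integral_fluxDensity (hR : AdmissibleRadius K R) (hx : IsFreeBoundaryImmersion K R x ν)
    (a : EuclideanSpace ℝ (Fin (n + 1))) (t : ℝ) :
    ∫ p, fluxDensity K R a x ν t p ∂(areaMeasure K x) = 0 := by
  obtain ⟨f, hf⟩ := SmoothPartitionOfUnity.exists_isSubordinate_chartAt_source (𝓡∂ n) M
  have hfin : {i | (Function.support (f i)).Nonempty}.Finite :=
    f.locallyFinite.finite_nonempty_of_compact
  set s := hfin.toFinset with hs
  have hsum : ∀ p, ∑ i ∈ s, f i p = 1 := by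
    intro p
    rw [← f.sum_eq_one (mem_univ p), finsum_eq_sum_of_support_subset]
    intro i hi
    simp only [hs, Finite.coe_toFinset, mem_ofPred_eq]
    exact ⟨p, hi⟩
  have hsm : ∀ i, ContMDiff (𝓡∂ n) 𝓘(ℝ, ℝ) ∞ (f i) := fun i => (f i).contMDiff
  have hint : ∀ i, Integrable (fun p => f i p * fluxDensity K R a x ν t p +
      fluxPairing K R a x ν t (f i) p) (areaMeasure K x) := fun i =>
    hx.integrable_of_continuous hR
      (((hsm i).continuous.mul (continuous_fluxDensity hR hx a t)).add
        (continuous_fluxPairing hR hx a t (hsm i)))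
  have h1 : ∀ p, fluxDensity K R a x ν t p = ∑ i ∈ s, (f i p * fluxDensity K R a x ν t p +
      fluxPairing K R a x ν t (f i) p) := by
    intro p
    rw [Finset.sum_add_distrib, fluxPairing_sum a t s hsm hsum, ← Finset.sum_mul, hsum]
    ring
  rw [integral_congr_ae (Eventually.of_forall h1), integral_finsetSum _ fun i _ => hint i]
  refine Finset.sum_eq_zero fun i _ => ?_
  refine integral_fluxDensity_chart hR hx a t (hsm i) i ?_
  rw [extChartAt_source]
  exact hf i

/-- The Hsiung-Minkowski formulas. -/
theorem minkowski_formula (hR : AdmissibleRadius K R) (hx : IsFreeBoundaryImmersion K R x ν)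
    (a : EuclideanSpace ℝ (Fin (n + 1))) {k : ℕ} (hk1 : 1 ≤ k) (hk : k ≤ n) :
    Integrable (fun p => V K a (x p) * sigma K x ν (k - 1) p) (areaMeasure K x) ∧
    Integrable (fun p => sigma K x ν k p * metric K (x p) (X K R a (x p)) (ν p))
      (areaMeasure K x) ∧
    ∫ p, V K a (x p) * sigma K x ν (k - 1) p ∂(areaMeasure K x) =
      (k : ℝ) / ((n : ℝ) + 1 - k) *
        ∫ p, sigma K x ν k p * metric K (x p) (X K R a (x p)) (ν p) ∂(areaMeasure K x) := by
  have hA : ∀ k ≤ n, Integrable (fun p => V K a (x p) * sigma K x ν k p) (areaMeasure K x) :=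
    fun k hk => hx.integrable_of_continuous hR
      ((continuous_V_comp hR hx a).mul (continuous_sigma hR hx hk))
  have hB : ∀ k ≤ n, Integrable (fun p => sigma K x ν k p *
      metric K (x p) (X K R a (x p)) (ν p)) (areaMeasure K x) :=
    fun k hk => hx.integrable_of_continuous hR
      ((continuous_sigma hR hx hk).mul (continuous_metric_X hR hx a))
  refine ⟨hA _ (by omega), hB _ hk, ?_⟩
  set A : ℕ → ℝ := fun k => ∫ p, V K a (x p) * sigma K x ν k p ∂(areaMeasure K x) with hAdef
  set B : ℕ → ℝ := fun k => ∫ p, sigma K x ν k p * metric K (x p) (X K R a (x p)) (ν p)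
    ∂(areaMeasure K x) with hBdef
  -- The integrated identity is a polynomial in t that vanishes for every t, so each of its
  -- coefficients is zero; that of t^(k-1) is the claim.
  have hpoly : ∀ t : ℝ, ∑ k ∈ Finset.range (n + 1), (((n : ℝ) - k) * A k * t ^ k
      - k * B k * t ^ (k - 1)) = 0 := by
    intro t
    rw [← integral_fluxDensity hR hx a t]
    have h1 : ∀ p, fluxDensity K R a x ν t p = ∑ k ∈ Finset.range (n + 1),
        ((((n : ℝ) - k) * t ^ k) * (V K a (x p) * sigma K x ν k p)
        - (k * t ^ (k - 1)) * (sigma K x ν k p * metric K (x p) (X K R a (x p)) (ν p))) := by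
      intro p
      rw [fluxDensity, meanPoly, meanPolyDeriv, Finset.mul_sum, Finset.mul_sum, Finset.mul_sum,
        ← Finset.sum_sub_distrib, Finset.mul_sum, ← Finset.sum_sub_distrib]
      refine Finset.sum_congr rfl fun k _ => ?_
      have : (k : ℝ) * (t * t ^ (k - 1)) = k * t ^ k := by
        rcases k with _ | k
        · simp
        · rw [Nat.add_sub_cancel, pow_succ']
      linear_combination -(V K a (x p) * sigma K x ν k p) * this
    rw [integral_congr_ae (Eventually.of_forall h1), integral_finsetSum]
    · refine Finset.sum_congr rfl fun k hk => ?_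
      have hk' : k ≤ n := Nat.lt_succ_iff.1 (Finset.mem_range.1 hk)
      rw [integral_sub ((hA k hk').const_mul _) ((hB k hk').const_mul _), integral_const_mul,
        integral_const_mul]
      ring
    · intro k hk
      have hk' : k ≤ n := Nat.lt_succ_iff.1 (Finset.mem_range.1 hk)
      exact ((hA k hk').const_mul _).sub ((hB k hk').const_mul _)
  set P : Polynomial ℝ := ∑ k ∈ Finset.range (n + 1),
    (Polynomial.monomial k (((n : ℝ) - k) * A k) - Polynomial.monomial (k - 1) (k * B k)) with hP
  have hP0 : P = 0 := by
    refine Polynomial.funext fun t => ?_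
    rw [Polynomial.eval_zero, ← hpoly t, hP]
    simp [Polynomial.eval_finsetSum, Polynomial.eval_monomial]
  have hc := congrArg (fun Q => Polynomial.coeff Q (k - 1)) hP0
  simp only [hP, Polynomial.finsetSum_coeff, Polynomial.coeff_sub, Polynomial.coeff_monomial,
    Finset.sum_sub_distrib, Polynomial.coeff_zero] at hc
  have e1 : ∑ j ∈ Finset.range (n + 1), (if j = k - 1 then ((n : ℝ) - j) * A j else 0)
      = ((n : ℝ) - (k - 1 : ℕ)) * A (k - 1) := by
    rw [Finset.sum_ite_eq' (Finset.range (n + 1)) (k - 1) fun j => ((n : ℝ) - j) * A j,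
      if_pos (Finset.mem_range.2 (by omega))]
  have e2 : ∑ j ∈ Finset.range (n + 1), (if j - 1 = k - 1 then (j : ℝ) * B j else 0)
      = k * B k := by
    rw [Finset.sum_eq_single_of_mem k (Finset.mem_range.2 (by omega)), if_pos rfl]
    intro j _ hj
    -- With truncated subtraction, j = 0 also satisfies j - 1 = k - 1 when k = 1; the weight j = 0
    -- removes this term.
    by_cases h0 : j = 0
    · simp [h0]
    · rw [if_neg (by omega)]
  rw [e1, e2, Nat.cast_sub hk1, Nat.cast_one] at hc
  have hne : (n : ℝ) + 1 - k ≠ 0 := by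
    have : (k : ℝ) ≤ n := by exact_mod_cast hk
    linarith
  change A (k - 1) = _ * B k
  rw [div_mul_eq_mul_div, eq_div_iff hne]
  linarith

end MinkowskiFormula

end SpaceForm

end

open Set Filter Topology MeasureTheory
open scoped Manifold ContDiff

noncomputable section

namespace SpaceForm

/-! ### Euclidean divergence, a one-dimensional weak derivative, and Fubini along the first
coordinate. -/

section Tube

variable {m n : ℕ}

/-- The Euclidean divergence. -/
def divergence (Z : EuclideanSpace ℝ (Fin m) → EuclideanSpace ℝ (Fin m))
    (y : EuclideanSpace ℝ (Fin m)) : ℝ :=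
  ∑ i, fderiv ℝ Z y (EuclideanSpace.single i 1) i

theorem continuous_divergence {Z : EuclideanSpace ℝ (Fin m) → EuclideanSpace ℝ (Fin m)}
    (hZ : ContDiff ℝ 1 Z) : Continuous (divergence Z) := by
  refine continuous_finsetSum _ fun i _ => ?_
  have h := (hZ.continuous_fderiv (by simp)).clm_apply
    (continuous_const (y := EuclideanSpace.single i (1 : ℝ)))
  exact (EuclideanSpace.proj (𝕜 := ℝ) i).continuous.comp h

theorem divergence_eq_zero {Z : EuclideanSpace ℝ (Fin m) → EuclideanSpace ℝ (Fin m)}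
    {y : EuclideanSpace ℝ (Fin m)} (hy : y ∉ tsupport Z) : divergence Z y = 0 := by
  have h : fderiv ℝ Z y = 0 := by
    by_contra h
    exact hy (support_fderiv_subset ℝ h)
  simp [divergence, h]

theorem hasCompactSupport_divergence {Z : EuclideanSpace ℝ (Fin m) → EuclideanSpace ℝ (Fin m)}
    (hc : HasCompactSupport Z) : HasCompactSupport (divergence Z) :=
  HasCompactSupport.intro hc fun _ hy => divergence_eq_zero hy

/-- Integration by parts of each component against the constant function 1. -/
theorem integral_divergence_eq_zero
    {Z : EuclideanSpace ℝ (Fin m) → EuclideanSpace ℝ (Fin m)} (hZ : ContDiff ℝ 1 Z)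
    (hc : HasCompactSupport Z) : ∫ y, divergence Z y = 0 := by
  have hcomp : ∀ i y, fderiv ℝ Z y (EuclideanSpace.single i 1) i
      = fderiv ℝ (fun y => Z y i) y (EuclideanSpace.single i 1) := by
    intro i y
    have h1 := (EuclideanSpace.proj (𝕜 := ℝ) i).hasFDerivAt.comp y
      (hZ.differentiable (by simp) y).hasFDerivAt
    have h2 : HasFDerivAt (fun y => Z y i) _ y := h1
    rw [h2.fderiv]
    rfl
  have hi : ∀ i, ContDiff ℝ 1 fun y => Z y i := fun i =>
    (EuclideanSpace.proj (𝕜 := ℝ) i).contDiff.comp hZ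
  have hci : ∀ i, HasCompactSupport fun y => Z y i := fun i =>
    hc.comp_left (g := fun v : EuclideanSpace ℝ (Fin m) => v i) rfl
  have hint : ∀ i, Integrable fun y =>
      fderiv ℝ (fun y => Z y i) y (EuclideanSpace.single i (1 : ℝ)) := fun i =>
    (((hi i).continuous_fderiv (by simp)).clm_apply continuous_const).integrable_of_hasCompactSupport
      ((hci i).fderiv_apply ℝ _)
  simp only [divergence, hcomp]
  rw [integral_finsetSum _ fun i _ => hint i]
  refine Finset.sum_eq_zero fun i _ => ?_
  have h := integral_mul_fderiv_eq_neg_fderiv_mul_of_integrable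
    (μ := (volume : Measure (EuclideanSpace ℝ (Fin m)))) (𝕜 := ℝ)
    (f := fun _ => (1 : ℝ)) (g := fun y => Z y i) (v := EuclideanSpace.single i (1 : ℝ))
    (by simp) (by simpa using hint i)
    (by simpa using (hi i).continuous.integrable_of_hasCompactSupport (hci i))
    (fun _ _ => differentiableAt_const _) (fun _ _ => (hi i).differentiable (by simp) _)
  simpa using h

theorem divergence_smul {f : EuclideanSpace ℝ (Fin m) → ℝ}
    {Z : EuclideanSpace ℝ (Fin m) → EuclideanSpace ℝ (Fin m)} {y : EuclideanSpace ℝ (Fin m)}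
    (hf : DifferentiableAt ℝ f y) (hZ : DifferentiableAt ℝ Z y) :
    divergence (fun y => f y • Z y) y = f y * divergence Z y + fderiv ℝ f y (Z y) := by
  have h1 := (hf.hasFDerivAt.smul hZ.hasFDerivAt).fderiv
  have h2 : fderiv ℝ f y (Z y) = ∑ i, Z y i * fderiv ℝ f y (EuclideanSpace.single i 1) := by
    conv_lhs => rw [eq_sum_single (Z y)]
    simp
  rw [h2, divergence, divergence, Finset.mul_sum, ← Finset.sum_add_distrib]
  refine Finset.sum_congr rfl fun i _ => ?_
  change fderiv ℝ (f • Z) y _ i = _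
  rw [h1]
  simp
  ring

theorem continuous_indicator_of_isClosed {α : Type*} [TopologicalSpace α] {U C : Set α}
    (hU : IsOpen U) (hC : IsClosed C) (hCU : C ⊆ U) {f : α → ℝ} (hf : ContinuousOn f U)
    (h0 : ∀ y ∈ U, y ∉ C → f y = 0) : Continuous (U.indicator f) := by
  rw [continuous_iff_continuousAt]
  intro y
  by_cases hy : y ∈ U
  · refine (hf.continuousAt (hU.mem_nhds hy)).congr ?_
    filter_upwards [hU.mem_nhds hy] with z hz
    rw [indicator_of_mem hz]
  · have h1 : ∀ᶠ z in 𝓝 y, U.indicator f z = 0 := by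
      filter_upwards [hC.isOpen_compl.mem_nhds fun h => hy (hCU h)] with z hz
      by_cases hzU : z ∈ U
      · rw [indicator_of_mem hzU, h0 z hzU hz]
      · rw [indicator_of_notMem hzU]
    have h2 : U.indicator f y = 0 := indicator_of_notMem hy _
    rw [ContinuousAt, h2]
    exact tendsto_const_nhds.congr' (h1.mono fun z hz => hz.symm)

/-- A function whose integral against every `C¹` function is minus that of a weak primitive. -/
theorem integral_Iio_eq_of_weak_derivative {A W : ℝ → ℝ} (hA : Continuous A) (hW : Continuous W)
    {L : ℝ} (hL : 0 < L) (hAL : ∀ t, L ≤ |t| → A t = 0) (hWL : ∀ t, L ≤ |t| → W t = 0)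
    (h : ∀ f : ℝ → ℝ, ContDiff ℝ 1 f → ∫ t, f t * A t = -∫ t, deriv f t * W t) :
    ∫ t in Iio 0, A t = W 0 := by
  have hsupp : ∀ {F G : ℝ → ℝ}, (∀ t, L ≤ |t| → G t = 0) →
      ∫ t, F t * G t = ∫ t in (-L)..L, F t * G t := by
    intro F G hG
    rw [intervalIntegral.integral_of_le (by linarith), setIntegral_eq_integral_of_forall_compl_eq_zero]
    intro t ht
    rw [hG t, mul_zero]
    by_contra hlt
    rw [not_le, abs_lt] at hlt
    exact ht ⟨hlt.1, hlt.2.le⟩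
  set P : ℝ → ℝ := fun t => ∫ s in (-L)..t, A s with hP
  have hPd : ∀ t, HasDerivAt P (A t) t := fun t => hA.integral_hasStrictDerivAt (-L) t |>.hasDerivAt
  have hPc : Continuous P := continuous_iff_continuousAt.2 fun t => (hPd t).continuousAt
  -- The test function 1 shows that A has total integral zero, so the primitive P vanishes at both
  -- ends.
  have hPL : P L = 0 := by
    have h1 := h (fun _ => 1) contDiff_const
    have h2 := hsupp (F := fun _ => 1) hAL
    simp only [one_mul, deriv_const', zero_mul, integral_zero, neg_zero] at h1 h2
    rw [hP]
    dsimp only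
    rw [← h2, h1]
  have hPL' : P (-L) = 0 := intervalIntegral.integral_same
  -- The test function is a primitive of P - W. Integration by parts turns the hypothesis into ∫ (P
  -- - W) P = ∫ (P - W) W, hence ∫ (P - W)² = 0 and P = W on [-L, L].
  set f : ℝ → ℝ := fun t => ∫ s in (0 : ℝ)..t, (P s - W s) with hf
  have hfd : ∀ t, HasDerivAt f (P t - W t) t := fun t =>
    (hPc.sub hW).integral_hasStrictDerivAt 0 t |>.hasDerivAt
  have hfd' : deriv f = fun t => P t - W t := funext fun t => (hfd t).deriv
  have hfC : ContDiff ℝ 1 f := contDiff_one_iff_deriv.2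
    ⟨fun t => (hfd t).differentiableAt, by rw [hfd']; exact hPc.sub hW⟩
  have h1 := h f hfC
  rw [hsupp hAL, hsupp hWL, hfd', intervalIntegral.integral_mul_deriv_eq_deriv_mul
    (fun t _ => hfd t) (fun t _ => hPd t) ((hPc.sub hW).intervalIntegrable _ _)
    (hA.intervalIntegrable _ _), hPL, hPL', mul_zero, mul_zero, sub_zero, zero_sub, neg_inj] at h1
  have hsq : ∫ t in (-L)..L, (P t - W t) ^ 2 = 0 := by
    have e1 : IntervalIntegrable (fun t => (P t - W t) * P t) volume (-L) L :=
      ((hPc.sub hW).mul hPc).intervalIntegrable _ _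
    have e2 : IntervalIntegrable (fun t => (P t - W t) * W t) volume (-L) L :=
      ((hPc.sub hW).mul hW).intervalIntegrable _ _
    rw [← sub_eq_zero.2 h1, ← intervalIntegral.integral_sub e1 e2]
    congr 1
    ext1 t
    ring
  have hle : -L ≤ L := by linarith
  have e3 : IntervalIntegrable (fun t => (P t - W t) ^ 2) volume (-L) L :=
    ((hPc.sub hW).pow 2).intervalIntegrable _ _
  rw [intervalIntegral.integral_eq_zero_iff_of_le_of_nonneg_ae hle
    (Eventually.of_forall fun t => sq_nonneg _) e3] at hsq
  rw [restrict_Ioc_eq_restrict_Icc] at hsq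
  have h2 := Measure.eqOn_Icc_of_ae_eq volume (by linarith : (-L) ≠ L) hsq
    ((hPc.sub hW).pow 2).continuousOn continuousOn_const
  have h3 := h2 (x := 0) ⟨by linarith, hL.le⟩
  have h4 : P 0 = W 0 := by
    have : (P 0 - W 0) ^ 2 = 0 := h3
    nlinarith [pow_eq_zero_iff (two_ne_zero) |>.1 this]
  rw [← h4, hP]
  dsimp only
  rw [intervalIntegral.integral_of_le (by linarith), ← integral_Iic_eq_integral_Iio,
    ← setIntegral_eq_of_subset_of_forall_sdiff_eq_zero measurableSet_Iic
      (Ioc_subset_Iic_self (a := -L) (b := (0 : ℝ)))]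
  rintro t ⟨h5, h6⟩
  refine hAL t ?_
  by_contra hlt
  rw [not_le, abs_lt] at hlt
  exact h6 ⟨hlt.1, h5⟩

/-- The vector with first coordinate `t` and remaining coordinates `z`. -/
def consE (p : ℝ × EuclideanSpace ℝ (Fin n)) : EuclideanSpace ℝ (Fin (n + 1)) :=
  WithLp.toLp 2 (Fin.cons p.1 p.2.ofLp)

/-- All coordinates but the first. -/
def tailL (n : ℕ) : EuclideanSpace ℝ (Fin (n + 1)) →L[ℝ] EuclideanSpace ℝ (Fin n) :=
  LinearMap.toContinuousLinearMap
    { toFun := fun v => WithLp.toLp 2 (Fin.tail v.ofLp)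
      map_add' := fun _ _ => rfl
      map_smul' := fun _ _ => rfl }

@[simp] theorem consE_zero (p : ℝ × EuclideanSpace ℝ (Fin n)) : consE p 0 = p.1 := rfl

@[simp] theorem consE_succ (p : ℝ × EuclideanSpace ℝ (Fin n)) (i : Fin n) :
    consE p i.succ = p.2 i := rfl

@[simp] theorem tailL_consE (p : ℝ × EuclideanSpace ℝ (Fin n)) : tailL n (consE p) = p.2 := rfl

@[simp] theorem tailL_apply (v : EuclideanSpace ℝ (Fin (n + 1))) (i : Fin n) :
    tailL n v i = v i.succ := rfl

theorem consE_head_tail (v : EuclideanSpace ℝ (Fin (n + 1))) : consE (v 0, tailL n v) = v := by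
  ext i
  refine Fin.cases rfl (fun j => rfl) i

theorem continuous_consE : Continuous (consE (n := n)) := by
  refine (PiLp.continuous_toLp 2 _).comp (continuous_pi fun i => ?_)
  refine Fin.cases ?_ (fun j => ?_) i
  · exact continuous_fst
  · exact (EuclideanSpace.proj (𝕜 := ℝ) j).continuous.comp continuous_snd

theorem measurePreserving_consE : MeasurePreserving (consE (n := n))
    (volume.prod volume) volume := by
  have h1 : MeasurePreserving (fun p : ℝ × EuclideanSpace ℝ (Fin n) => (p.1, p.2.ofLp))
      (volume.prod volume) (volume.prod volume) :=
    (MeasurePreserving.id volume).prod (PiLp.volume_preserving_ofLp (Fin n))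
  have h2 := (volume_preserving_piFinSuccAbove (fun _ : Fin (n + 1) => ℝ) 0).symm
  have h3 := PiLp.volume_preserving_toLp (Fin (n + 1))
  have h4 := h3.comp (h2.comp h1)
  have h5 : consE (n := n) = WithLp.toLp 2 ∘ (MeasurableEquiv.piFinSuccAbove
      (fun _ : Fin (n + 1) => ℝ) 0).symm ∘ fun p => (p.1, p.2.ofLp) := by
    ext1 p
    ext i
    refine Fin.cases ?_ (fun j => ?_) i <;>
      simp [MeasurableEquiv.piFinSuccAbove, Fin.insertNthEquiv]
  rw [h5]
  exact h4

theorem measurableEmbedding_consE : MeasurableEmbedding (consE (n := n)) := by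
  have hinj : Function.Injective (consE (n := n)) := by
    intro p q h
    have h1 := congrArg (fun v : EuclideanSpace ℝ (Fin (n + 1)) => v 0) h
    have h2 := congrArg (tailL n) h
    exact Prod.ext h1 h2
  exact continuous_consE.measurableEmbedding hinj

theorem integral_consE {f : EuclideanSpace ℝ (Fin (n + 1)) → ℝ} (hf : Integrable f) :
    ∫ v, f v = ∫ t, ∫ z, f (consE (t, z)) := by
  rw [← measurePreserving_consE.integral_comp measurableEmbedding_consE,
    integral_prod (fun p => f (consE p))
      ((measurePreserving_consE.integrable_comp_emb measurableEmbedding_consE).2 hf)]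

/-- All slices vanish off one compact set, the projection of the support, so the integral depends
continuously on t. -/
theorem continuous_integral_consE {f : EuclideanSpace ℝ (Fin (n + 1)) → ℝ} (hf : Continuous f)
    (hc : HasCompactSupport f) : Continuous fun t => ∫ z, f (consE (t, z)) := by
  have h1 : ∀ t, ∫ z, f (consE (t, z)) = ∫ z in tailL n '' tsupport f, f (consE (t, z)) := by
    intro t
    rw [setIntegral_eq_integral_of_forall_compl_eq_zero]
    intro z hz
    by_contra h
    exact hz ⟨_, subset_tsupport f h, rfl⟩
  simp only [h1]
  exact continuous_parametric_integral_of_continuous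
    (f := fun t z => f (consE (t, z))) (hf.comp continuous_consE)
    (IsCompact.image hc (tailL n).continuous)

end Tube

end SpaceForm

end

open Set Filter Topology MeasureTheory
open scoped Manifold ContDiff

noncomputable section

namespace SpaceForm

/-! ### The divergence theorem on one side of a hypersurface, in tube coordinates. -/

section TubeGauss

variable {n : ℕ}

/-- The flux density of `Z` through the level sets of the first coordinate of `e⁻¹`. -/
def tubeFlux (e : OpenPartialHomeomorph (EuclideanSpace ℝ (Fin (n + 1)))
    (EuclideanSpace ℝ (Fin (n + 1))))
    (Z : EuclideanSpace ℝ (Fin (n + 1)) → EuclideanSpace ℝ (Fin (n + 1)))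
    (v : EuclideanSpace ℝ (Fin (n + 1))) : ℝ :=
  |(fderiv ℝ e v).det| * (fderiv ℝ e.symm (e v) (Z (e v))) 0

theorem hasFDerivAt_of_eq_comp {E : Type*} [NormedAddCommGroup E] [NormedSpace ℝ E] {p T : E → ℝ}
    {y : E} {f : ℝ → ℝ} (hf : ContDiff ℝ 1 f) {L : E →L[ℝ] ℝ} (h : HasFDerivAt p L y)
    (hT : ∀ y, T y = f (p y)) : HasFDerivAt T (deriv f (p y) • L) y := by
  have h1 := (hf.differentiable one_ne_zero (p y)).hasDerivAt.comp_hasFDerivAt y h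
  exact h1.congr_of_eventuallyEq (Eventually.of_forall hT)

/-- The field f(p) Z has compact support, so its divergence integrates to zero. With p the tube
coordinate, this is the weak form of the statement that the flux through the levels of p has the
fibre integral of div Z as derivative. -/
theorem integral_divergence_comp_mul {m : ℕ} {U : Set (EuclideanSpace ℝ (Fin m))} (hU : IsOpen U)
    {p : EuclideanSpace ℝ (Fin m) → ℝ} (hp : ContDiffOn ℝ 1 p U)
    {Z : EuclideanSpace ℝ (Fin m) → EuclideanSpace ℝ (Fin m)} (hZ : ContDiff ℝ 1 Z)
    (hc : HasCompactSupport Z) (hsub : tsupport Z ⊆ U) {f : ℝ → ℝ} (hf : ContDiff ℝ 1 f) :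
    ∫ y in U, (f (p y) * divergence Z y + deriv f (p y) * fderiv ℝ p y (Z y)) = 0 := by
  obtain ⟨T, hT⟩ : ∃ T : EuclideanSpace ℝ (Fin m) → ℝ, ∀ y, T y = f (p y) := ⟨_, fun _ => rfl⟩
  have hTc : ContDiffOn ℝ 1 T U := (hf.comp_contDiffOn hp).congr fun y _ => hT y
  have hTd : ∀ y ∈ U, HasFDerivAt T (deriv f (p y) • fderiv ℝ p y) y := fun y hy =>
    hasFDerivAt_of_eq_comp hf
      ((hp.contDiffAt (hU.mem_nhds hy)).differentiableAt one_ne_zero).hasFDerivAt hT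
  have hTZ : ContDiff ℝ 1 fun y => T y • Z y := by
    rw [contDiff_iff_contDiffAt]
    intro y
    by_cases hy : y ∈ tsupport Z
    · exact (hTc.contDiffAt (hU.mem_nhds (hsub hy))).smul hZ.contDiffAt
    · refine (contDiffAt_const (c := 0)).congr_of_eventuallyEq ?_
      filter_upwards [notMem_tsupport_iff_eventuallyEq.1 hy] with z hz
      rw [hz]
      exact smul_zero _
  have hTZc : HasCompactSupport fun y => T y • Z y :=
    HasCompactSupport.intro hc fun y hy => by rw [image_eq_zero_of_notMem_tsupport hy, smul_zero]
  refine Eq.trans ?_ (integral_divergence_eq_zero hTZ hTZc)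
  rw [← integral_indicator hU.measurableSet]
  refine integral_congr_ae (Eventually.of_forall fun y => ?_)
  by_cases hy : y ∈ U
  · have h1 := divergence_smul (hTd y hy).differentiableAt (hZ.differentiable one_ne_zero y)
    rw [indicator_of_mem hy, h1, (hTd y hy).fderiv, hT, _root_.smul_apply, smul_eq_mul]
  · have h1 : y ∉ tsupport fun y => T y • Z y := fun h =>
      hy (hsub (closure_mono (Function.support_smul_subset_right T Z) h))
    rw [indicator_of_notMem hy, divergence_eq_zero h1]

theorem fderiv_apply_coord {m k : ℕ} {F : EuclideanSpace ℝ (Fin m) → EuclideanSpace ℝ (Fin k)}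
    {y : EuclideanSpace ℝ (Fin m)} (hF : DifferentiableAt ℝ F y) (i : Fin k)
    (v : EuclideanSpace ℝ (Fin m)) : fderiv ℝ (fun y => F y i) y v = (fderiv ℝ F y v) i := by
  have h : HasFDerivAt (fun y => F y i) _ y :=
    (EuclideanSpace.proj (𝕜 := ℝ) i).hasFDerivAt.comp y hF.hasFDerivAt
  rw [h.fderiv]
  rfl

/-- The divergence theorem in a tube `e`, for the part of the tube where the first coordinate is
negative. -/
theorem integral_divergence_tube (e : OpenPartialHomeomorph (EuclideanSpace ℝ (Fin (n + 1)))
    (EuclideanSpace ℝ (Fin (n + 1)))) (he : ContDiffOn ℝ 1 e e.source)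
    (hes : ContDiffOn ℝ 1 e.symm e.target)
    {Z : EuclideanSpace ℝ (Fin (n + 1)) → EuclideanSpace ℝ (Fin (n + 1))} (hZ : ContDiff ℝ 1 Z)
    (hc : HasCompactSupport Z) (hsub : tsupport Z ⊆ e.target) :
    ∫ y in e.target ∩ {y | e.symm y 0 < 0}, divergence Z y
      = ∫ z, e.source.indicator (tubeFlux e Z) (consE (0, z)) := by
  set C := e.symm '' tsupport Z with hC
  have hCc : IsCompact C := IsCompact.image_of_continuousOn hc (e.continuousOn_symm.mono hsub)
  have hCs : C ⊆ e.source := by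
    rintro _ ⟨y, hy, rfl⟩
    exact e.map_target (hsub hy)
  have hnotC : ∀ v ∈ e.source, v ∉ C → e v ∉ tsupport Z := fun v hv hvC h =>
    hvC ⟨e v, h, e.left_inv hv⟩
  have hed : ∀ v ∈ e.source, HasFDerivAt e (fderiv ℝ e v) v := fun v hv =>
    ((he.contDiffAt (e.open_source.mem_nhds hv)).differentiableAt (by simp)).hasFDerivAt
  have hesd : ∀ y ∈ e.target, DifferentiableAt ℝ e.symm y := fun y hy =>
    (hes.contDiffAt (e.open_target.mem_nhds hy)).differentiableAt one_ne_zero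
  have hes0 : ContDiffOn ℝ 1 (fun y => e.symm y 0) e.target :=
    (EuclideanSpace.proj (𝕜 := ℝ) (0 : Fin (n + 1))).contDiff.comp_contDiffOn hes
  have hJ : ContinuousOn (fun v => |(fderiv ℝ e v).det|) e.source :=
    (ContinuousLinearMap.continuous_det.comp_continuousOn
      (he.continuousOn_fderiv_of_isOpen e.open_source le_rfl)).abs
  -- The divergence pulled back to tube coordinates with its Jacobian, extended by zero; F is the
  -- same for the flux through the levels of the first coordinate.
  set D := e.source.indicator fun v => |(fderiv ℝ e v).det| * divergence Z (e v) with hD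
  set F := e.source.indicator (tubeFlux e Z) with hF
  have hDc : Continuous D := continuous_indicator_of_isClosed e.open_source hCc.isClosed hCs
    (hJ.mul ((continuous_divergence hZ).comp_continuousOn e.continuousOn))
    fun v hv hvC => by rw [divergence_eq_zero (hnotC v hv hvC), mul_zero]
  have hFc : Continuous F := by
    refine continuous_indicator_of_isClosed e.open_source hCc.isClosed hCs
      (hJ.mul ((EuclideanSpace.proj (𝕜 := ℝ) 0).continuous.comp_continuousOn
        (ContinuousOn.clm_apply ?_ (hZ.continuous.comp_continuousOn e.continuousOn))))
      fun v hv hvC => by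
        rw [tubeFlux, image_eq_zero_of_notMem_tsupport (hnotC v hv hvC), map_zero]
        simp
    exact (hes.continuousOn_fderiv_of_isOpen e.open_target le_rfl).comp e.continuousOn e.mapsTo
  have hDC : HasCompactSupport D := HasCompactSupport.intro hCc fun v hv => by
    by_cases hs : v ∈ e.source
    · rw [hD, indicator_of_mem hs, divergence_eq_zero (hnotC v hs hv), mul_zero]
    · rw [hD, indicator_of_notMem hs]
  have hFC : HasCompactSupport F := HasCompactSupport.intro hCc fun v hv => by
    by_cases hs : v ∈ e.source
    · rw [hF, indicator_of_mem hs, tubeFlux, image_eq_zero_of_notMem_tsupport (hnotC v hs hv),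
        map_zero]
      simp
    · rw [hF, indicator_of_notMem hs]
  have hcv : ∀ g : EuclideanSpace ℝ (Fin (n + 1)) → ℝ,
      ∫ y in e.target, g y = ∫ v in e.source, |(fderiv ℝ e v).det| * g (e v) := by
    intro g
    rw [← e.image_source_eq_target]
    exact integral_image_eq_integral_abs_det_fderiv_smul volume e.open_source.measurableSet
      (fun v hv => (hed v hv).hasFDerivWithinAt) e.injOn g
  have hfib : ∀ (f : ℝ → ℝ) (G : EuclideanSpace ℝ (Fin (n + 1)) → ℝ),
      Integrable (fun v => f (v 0) * G v) →
      ∫ v, f (v 0) * G v = ∫ t, f t * ∫ z, G (consE (t, z)) := by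
    intro f G hint
    rw [integral_consE hint]
    simp only [consE_zero, integral_const_mul]
  have hcont0 : Continuous fun v : EuclideanSpace ℝ (Fin (n + 1)) => v 0 :=
    (EuclideanSpace.proj (𝕜 := ℝ) 0).continuous
  have hintc : ∀ (f : ℝ → ℝ) (G : EuclideanSpace ℝ (Fin (n + 1)) → ℝ), Continuous f →
      Continuous G → HasCompactSupport G → Integrable (fun v => f (v 0) * G v) :=
    fun f G hf hG hGc =>
    ((hf.comp hcont0).mul hG).integrable_of_hasCompactSupport hGc.mul_left
  have hDint : ∀ f : ℝ → ℝ, Integrable (fun v => f (v 0) * D v) →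
      ∫ y in e.target, f (e.symm y 0) * divergence Z y
        = ∫ t, f t * ∫ z, D (consE (t, z)) := by
    intro f hint
    rw [hcv, ← hfib f D hint, ← integral_indicator e.open_source.measurableSet]
    congr 1
    ext1 v
    by_cases hv : v ∈ e.source
    · rw [indicator_of_mem hv, hD, indicator_of_mem hv, e.left_inv hv]
      ring
    · rw [indicator_of_notMem hv, hD, indicator_of_notMem hv, mul_zero]
  -- Change of variables and Fubini turn the weak identity on the tube into one on the line. Only C¹
  -- regularity of e is used; differentiating the flux density in t directly would involve second
  -- derivatives of e.
  have hweak : ∀ f : ℝ → ℝ, ContDiff ℝ 1 f →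
      ∫ t, f t * ∫ z, D (consE (t, z)) = -∫ t, deriv f t * ∫ z, F (consE (t, z)) := by
    intro f hf
    have hf' : Continuous (deriv f) := hf.continuous_deriv le_rfl
    have h0 := integral_divergence_comp_mul e.open_target hes0 hZ hc hsub hf
    rw [hcv,
      ← integral_indicator e.open_source.measurableSet] at h0
    have h1 : ∀ v, e.source.indicator (fun v => |(fderiv ℝ e v).det| *
        (f (e.symm (e v) 0) * divergence Z (e v) +
          deriv f (e.symm (e v) 0) * fderiv ℝ (fun y => e.symm y 0) (e v) (Z (e v)))) v
        = f (v 0) * D v + deriv f (v 0) * F v := by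
      intro v
      by_cases hv : v ∈ e.source
      · rw [indicator_of_mem hv, hD, hF, indicator_of_mem hv, indicator_of_mem hv, e.left_inv hv,
          tubeFlux, fderiv_apply_coord (hesd _ (e.map_source hv))]
        ring
      · rw [indicator_of_notMem hv, hD, hF, indicator_of_notMem hv, indicator_of_notMem hv]
        ring
    simp only [h1] at h0
    rw [integral_add (hintc f D hf.continuous hDc hDC) (hintc _ F hf' hFc hFC),
      hfib f D (hintc f D hf.continuous hDc hDC), hfib _ F (hintc _ F hf' hFc hFC)] at h0
    linarith
  obtain ⟨L, hL⟩ := hCc.isBounded.exists_norm_le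
  have hout : ∀ (G : EuclideanSpace ℝ (Fin (n + 1)) → ℝ), (∀ v, v ∉ C → G v = 0) →
      ∀ t, max L 0 + 1 ≤ |t| → ∫ z, G (consE (t, z)) = 0 := by
    intro G hG t ht
    have : ∀ z, G (consE (t, z)) = 0 := by
      intro z
      refine hG _ fun h => ?_
      have h1 := hL _ h
      have h2 : |t| ≤ ‖consE (t, z)‖ := by
        have := EuclideanSpace.norm_eq (consE (t, z))
        have h3 := PiLp.norm_apply_le (consE (t, z)) 0
        rwa [consE_zero, Real.norm_eq_abs] at h3
      have := le_max_left L 0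
      linarith
    simp [this]
  have hDout : ∀ v, v ∉ C → D v = 0 := fun v hv => by
    by_cases hs : v ∈ e.source
    · rw [hD, indicator_of_mem hs, divergence_eq_zero (hnotC v hs hv), mul_zero]
    · rw [hD, indicator_of_notMem hs]
  have hFout : ∀ v, v ∉ C → F v = 0 := fun v hv => by
    by_cases hs : v ∈ e.source
    · rw [hF, indicator_of_mem hs, tubeFlux, image_eq_zero_of_notMem_tsupport (hnotC v hs hv),
        map_zero]
      simp
    · rw [hF, indicator_of_notMem hs]
  have hmain := integral_Iio_eq_of_weak_derivative (continuous_integral_consE hDc hDC)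
    (continuous_integral_consE hFc hFC) (L := max L 0 + 1)
    (by have := le_max_right L 0; linarith) (hout D hDout) (hout F hFout) hweak
  rw [← hmain, ← integral_indicator measurableSet_Iio]
  -- The indicator of t < 0 is not an admissible C¹ test function, but the fibre formula `hDint`
  -- needs only integrability.
  have hind : Integrable fun v : EuclideanSpace ℝ (Fin (n + 1)) =>
      (Iio (0 : ℝ)).indicator (fun _ => (1 : ℝ)) (v 0) * D v := by
    have h1 := (hDc.integrable_of_hasCompactSupport (μ := volume) hDC).indicator
      (measurableSet_lt hcont0.measurable measurable_const :
        MeasurableSet {v : EuclideanSpace ℝ (Fin (n + 1)) | v 0 < 0})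
    refine h1.congr (Eventually.of_forall fun v => ?_)
    by_cases hv : v 0 < 0
    · simp [hv]
    · simp [hv]
  have h2 := hDint _ hind
  have hmT : MeasurableSet (e.target ∩ {y | e.symm y 0 < 0}) := by
    have h3 : ContinuousOn (fun y => e.symm y 0) e.target :=
      hcont0.comp_continuousOn e.continuousOn_symm
    exact (h3.isOpen_inter_preimage e.open_target isOpen_Iio).measurableSet
  calc ∫ y in e.target ∩ {y | e.symm y 0 < 0}, divergence Z y
      = ∫ y in e.target, (Iio (0 : ℝ)).indicator (fun _ => (1 : ℝ)) (e.symm y 0) *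
          divergence Z y := by
        rw [← integral_indicator hmT, ← integral_indicator e.open_target.measurableSet]
        congr 1
        ext1 y
        by_cases hy : y ∈ e.target
        · by_cases hy0 : e.symm y 0 < 0
          · rw [indicator_of_mem (show y ∈ e.target ∩ {y | e.symm y 0 < 0} from ⟨hy, hy0⟩), indicator_of_mem hy,
              indicator_of_mem (show e.symm y 0 ∈ Iio 0 from hy0), one_mul]
          · rw [indicator_of_notMem (fun h => hy0 h.2), indicator_of_mem hy,
              indicator_of_notMem (show e.symm y 0 ∉ Iio 0 from hy0), zero_mul]
        · rw [indicator_of_notMem (fun h => hy h.1), indicator_of_notMem hy]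
    _ = _ := by
        rw [h2]
        congr 1
        ext1 t
        by_cases ht : t ∈ Iio (0 : ℝ)
        · rw [indicator_of_mem ht, indicator_of_mem ht, one_mul]
        · rw [indicator_of_notMem ht, indicator_of_notMem ht, zero_mul]

end TubeGauss

end SpaceForm

end

open Set Filter Topology MeasureTheory
open scoped Manifold ContDiff

noncomputable section

namespace SpaceForm

/-! ### The tube map around the hypersurface. -/

section TubeMap

open Matrix

variable {n : ℕ} [NeZero n] {M : Type*} [TopologicalSpace M]
  [ChartedSpace (EuclideanHalfSpace n) M]

/-- The normal exponential map (Euclidean) in the chart at `q`; the first coordinate is the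
distance. -/
def tubeMap (K : SignType) (x ν : M → EuclideanSpace ℝ (Fin (n + 1))) (q : M)
    (v : EuclideanSpace ℝ (Fin (n + 1))) : EuclideanSpace ℝ (Fin (n + 1)) :=
  inChart x q (tailL n v) + v 0 • inChart (euclideanNormal K x ν) q (tailL n v)

/-- The derivative of the tube map at a point of the hypersurface. -/
def tubeDeriv (K : SignType) (x ν : M → EuclideanSpace ℝ (Fin (n + 1))) (q : M)
    (z : EuclideanSpace ℝ (Fin n)) :
    EuclideanSpace ℝ (Fin (n + 1)) →L[ℝ] EuclideanSpace ℝ (Fin (n + 1)) :=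
  (fderivWithin ℝ (inChart x q) (chartDom q) z).comp (tailL n) +
    (EuclideanSpace.proj (0 : Fin (n + 1))).smulRight (inChart (euclideanNormal K x ν) q z)

theorem tubeDeriv_apply (K : SignType) (x ν : M → EuclideanSpace ℝ (Fin (n + 1))) (q : M)
    (z : EuclideanSpace ℝ (Fin n)) (u : EuclideanSpace ℝ (Fin (n + 1))) :
    tubeDeriv K x ν q z u = fderivWithin ℝ (inChart x q) (chartDom q) z (tailL n u) +
      u 0 • inChart (euclideanNormal K x ν) q z := rfl

theorem tubeMap_consE_zero (K : SignType) (x ν : M → EuclideanSpace ℝ (Fin (n + 1))) (q : M)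
    (z : EuclideanSpace ℝ (Fin n)) : tubeMap K x ν q (consE (0, z)) = inChart x q z := by
  simp [tubeMap]

variable [IsManifold (𝓡∂ n) ∞ M]
  {K : SignType} {R : ℝ} {x ν : M → EuclideanSpace ℝ (Fin (n + 1))}

theorem contDiffOn_tubeMap (hR : AdmissibleRadius K R) (hx : IsFreeBoundaryImmersion K R x ν)
    (q : M) : ContDiffOn ℝ ∞ (tubeMap K x ν q) (tailL n ⁻¹' interior (chartDom q)) := by
  have hx' := (contDiffOn_inChart hx.contMDiff q).mono interior_subset
  have hN' := (contDiffOn_inChart (hx.contMDiff_euclideanNormal hR) q).mono interior_subset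
  have h0 : ContDiff ℝ ∞ fun v : EuclideanSpace ℝ (Fin (n + 1)) => v 0 :=
    (EuclideanSpace.proj (𝕜 := ℝ) (0 : Fin (n + 1))).contDiff
  exact (hx'.comp (tailL n).contDiff.contDiffOn (fun v hv => hv)).add
    (h0.contDiffOn.smul (hN'.comp (tailL n).contDiff.contDiffOn (fun v hv => hv)))

theorem hasFDerivAt_tubeMap (hR : AdmissibleRadius K R) (hx : IsFreeBoundaryImmersion K R x ν)
    (q : M) {z : EuclideanSpace ℝ (Fin n)} (hz : z ∈ interior (chartDom q)) :
    HasFDerivAt (tubeMap K x ν q) (tubeDeriv K x ν q z) (consE (0, z)) := by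
  have hnhds : chartDom q ∈ 𝓝 z := mem_interior_iff_mem_nhds.1 hz
  have hx' : HasFDerivAt (inChart x q) (fderivWithin ℝ (inChart x q) (chartDom q) z)
      (tailL n (consE (0, z))) :=
    (hasFDerivWithinAt_of_contDiffOn (contDiffOn_inChart hx.contMDiff q)
      (interior_subset hz)).hasFDerivAt hnhds
  have hN' : HasFDerivAt (inChart (euclideanNormal K x ν) q)
      (fderivWithin ℝ (inChart (euclideanNormal K x ν) q) (chartDom q) z)
      (tailL n (consE (0, z))) :=
    (hasFDerivWithinAt_of_contDiffOn (contDiffOn_inChart (hx.contMDiff_euclideanNormal hR) q)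
      (interior_subset hz)).hasFDerivAt hnhds
  have h0 : HasFDerivAt (fun v : EuclideanSpace ℝ (Fin (n + 1)) => v 0)
      (EuclideanSpace.proj (𝕜 := ℝ) (0 : Fin (n + 1))) (consE (0, z)) :=
    (EuclideanSpace.proj (𝕜 := ℝ) (0 : Fin (n + 1))).hasFDerivAt
  have h1 := (hx'.comp _ (tailL n).hasFDerivAt).add
    (h0.smul (hN'.comp _ (tailL n).hasFDerivAt))
  refine HasFDerivAt.congr_fderiv (f := tubeMap K x ν q) h1 ?_
  ext1 u
  simp [tubeDeriv_apply]

/-- At distance zero the standard basis is sent to N and the ∂_i x, which are the rows of the frame.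
-/
theorem det_tubeDeriv (K : SignType) (x ν : M → EuclideanSpace ℝ (Fin (n + 1))) (q : M)
    (z : EuclideanSpace ℝ (Fin n)) : (tubeDeriv K x ν q z).det = chartDet K x ν q z := by
  rw [det_eq_det_matrix, chartDet]
  congr 1
  ext r c
  rw [Matrix.of_apply, tubeDeriv_apply]
  refine Fin.cases ?_ (fun i => ?_) r
  · have h1 : tailL n (EuclideanSpace.single 0 1) = 0 := by
      ext i
      simp
    rw [h1, map_zero]
    simp [frame]
  · have h1 : tailL n (EuclideanSpace.single i.succ 1) = EuclideanSpace.single i 1 := by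
      ext j
      simp
    rw [h1]
    simp [frame, partialDeriv]

/-- The inverse function theorem for the tube map. -/
theorem exists_tube (hR : AdmissibleRadius K R) (hx : IsFreeBoundaryImmersion K R x ν)
    (q : M) {z : EuclideanSpace ℝ (Fin n)} (hz : z ∈ interior (chartDom q)) :
    ∃ e : OpenPartialHomeomorph (EuclideanSpace ℝ (Fin (n + 1))) (EuclideanSpace ℝ (Fin (n + 1))),
      (∀ v, e v = tubeMap K x ν q v) ∧ consE (0, z) ∈ e.source ∧
      e.source ⊆ tailL n ⁻¹' interior (chartDom q) ∧ ContDiffOn ℝ 1 e e.source ∧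
      ContDiffOn ℝ 1 e.symm e.target := by
  set D := tailL n ⁻¹' interior (chartDom q) with hD
  have hDo : IsOpen D := isOpen_interior.preimage (tailL n).continuous
  have hC : ContDiffOn ℝ 1 (tubeMap K x ν q) D :=
    (contDiffOn_tubeMap hR hx q).of_le (by exact_mod_cast le_top)
  have hmem : consE (0, z) ∈ D := hz
  have hdet0 : (tubeDeriv K x ν q z).det ≠ 0 := by
    rw [det_tubeDeriv]
    exact hx.chartDet_ne_zero hR q (interior_subset hz)
  have hCa := hC.contDiffAt (hDo.mem_nhds hmem)
  have hder := hasFDerivAt_tubeMap hR hx q hz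
  rw [← ContinuousLinearMap.coe_toContinuousLinearEquivOfDetNeZero _ hdet0] at hder
  set e₀ := hCa.toOpenPartialHomeomorph (tubeMap K x ν q) hder one_ne_zero with he₀
  have he₀c : ∀ v, e₀ v = tubeMap K x ν q v := fun v => rfl
  have hdetc : ContinuousOn (fun v => (fderiv ℝ (tubeMap K x ν q) v).det) D :=
    ContinuousLinearMap.continuous_det.comp_continuousOn (hC.continuousOn_fderiv_of_isOpen hDo le_rfl)
  -- Restricting to the open set where the derivative is invertible makes the inverse C¹ on the
  -- whole target instead of only at the image of the centre.
  have hS : IsOpen (D ∩ (fun v => (fderiv ℝ (tubeMap K x ν q) v).det) ⁻¹' {0}ᶜ) :=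
    hdetc.isOpen_inter_preimage hDo isOpen_compl_singleton
  set S := D ∩ (fun v => (fderiv ℝ (tubeMap K x ν q) v).det) ⁻¹' {0}ᶜ
  refine ⟨e₀.restrOpen S hS, fun v => rfl, ⟨hCa.mem_toOpenPartialHomeomorph_source hder one_ne_zero,
    hmem, ?_⟩, fun v hv => hv.2.1, hC.mono fun v hv => hv.2.1, ?_⟩
  · have := (hasFDerivAt_tubeMap hR hx q hz).fderiv
    rw [mem_preimage, this]
    exact hdet0
  · intro y hy
    have hv := (e₀.restrOpen S hS).map_target hy
    have hvD := hDo.mem_nhds hv.2.1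
    have hCv := hC.contDiffAt hvD
    have hd := (hCv.differentiableAt one_ne_zero).hasFDerivAt
    rw [← ContinuousLinearMap.coe_toContinuousLinearEquivOfDetNeZero _ hv.2.2] at hd
    exact ((e₀.restrOpen S hS).contDiffAt_symm hy hd hCv).contDiffWithinAt

end TubeMap

end SpaceForm

end

open Set Filter Topology MeasureTheory
open scoped Manifold ContDiff

noncomputable section

namespace SpaceForm

/-! ### The domain Ω near an interior point of the hypersurface. -/

section LocalGauss

variable {n : ℕ} [NeZero n] {M : Type*} [TopologicalSpace M]
  [ChartedSpace (EuclideanHalfSpace n) M]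

/-- A box around `consE (0, z)`. -/
def box (z : EuclideanSpace ℝ (Fin n)) (r : ℝ) : Set (EuclideanSpace ℝ (Fin (n + 1))) :=
  {v | (v 0, tailL n v) ∈ Metric.ball ((0 : ℝ), z) r}

theorem isOpen_box (z : EuclideanSpace ℝ (Fin n)) (r : ℝ) : IsOpen (box z r) :=
  Metric.isOpen_ball.preimage
    ((EuclideanSpace.proj (𝕜 := ℝ) (0 : Fin (n + 1))).continuous.prodMk (tailL n).continuous)

theorem mem_box {z : EuclideanSpace ℝ (Fin n)} {r : ℝ} {v : EuclideanSpace ℝ (Fin (n + 1))} :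
    v ∈ box z r ↔ |v 0| < r ∧ tailL n v ∈ Metric.ball z r := by
  rw [box, mem_ofPred_eq, ← ball_prod_same, mem_prod, Metric.mem_ball, Real.dist_eq, sub_zero]

theorem exists_box_subset {z : EuclideanSpace ℝ (Fin n)} {S : Set (EuclideanSpace ℝ (Fin (n + 1)))}
    (hS : S ∈ 𝓝 (consE (0, z))) : ∃ r > 0, box z r ⊆ S := by
  obtain ⟨r, hr, h⟩ := Metric.mem_nhds_iff.1 (continuous_consE.continuousAt.preimage_mem_nhds hS)
  refine ⟨r, hr, fun v hv => ?_⟩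
  have := h hv
  rwa [mem_preimage, consE_head_tail] at this

theorem box_mono (z : EuclideanSpace ℝ (Fin n)) {r s : ℝ} (h : r ≤ s) : box z r ⊆ box z s :=
  fun _ hv => Metric.ball_subset_ball h hv

theorem convex_box (z : EuclideanSpace ℝ (Fin n)) (r : ℝ) : Convex ℝ (box z r) := by
  have h : box z r = ((EuclideanSpace.proj (𝕜 := ℝ) (0 : Fin (n + 1))).prod (tailL n)) ⁻¹'
    Metric.ball ((0 : ℝ), z) r := rfl
  rw [h]
  exact (convex_ball _ _).linear_preimage
    ((EuclideanSpace.proj (𝕜 := ℝ) (0 : Fin (n + 1))).prod (tailL n)).toLinearMap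

theorem convex_box_neg (z : EuclideanSpace ℝ (Fin n)) (r : ℝ) :
    Convex ℝ (box z r ∩ {v | v 0 < 0}) :=
  (convex_box z r).inter (convex_halfSpace_lt
    (EuclideanSpace.proj (𝕜 := ℝ) (0 : Fin (n + 1))).toLinearMap.isLinear 0)

theorem convex_box_pos (z : EuclideanSpace ℝ (Fin n)) (r : ℝ) :
    Convex ℝ (box z r ∩ {v | 0 < v 0}) :=
  (convex_box z r).inter (convex_halfSpace_gt
    (EuclideanSpace.proj (𝕜 := ℝ) (0 : Fin (n + 1))).toLinearMap.isLinear 0)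

variable {K : SignType} {R : ℝ} {x ν : M → EuclideanSpace ℝ (Fin (n + 1))}
  {Ω : Set (EuclideanSpace ℝ (Fin (n + 1)))}

theorem interior_geodesicBall (m : ℕ) (hR : AdmissibleRadius K R) :
    interior (geodesicBall m K R) = Metric.ball 0 (modelRadius K R) := by
  rw [geodesicBall, interior_closedBall _ (modelRadius_pos hR).ne']

theorem IsEnclosedDomain.subset_diff (hΩ : IsEnclosedDomain K R x ν Ω) :
    Ω ⊆ geodesicBall (n + 1) K R \ range x := by
  obtain ⟨⟨y, hy, rfl⟩, -⟩ := hΩ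
  exact connectedComponentIn_subset _ _

/-- Maximality of a connected component, the only way in which connectedness of Ω is used. -/
theorem IsEnclosedDomain.subset_of_mem (hΩ : IsEnclosedDomain K R x ν Ω)
    {s : Set (EuclideanSpace ℝ (Fin (n + 1)))} (hs : IsPreconnected s)
    (hsub : s ⊆ geodesicBall (n + 1) K R \ range x) {y : EuclideanSpace ℝ (Fin (n + 1))}
    (hys : y ∈ s) (hy : y ∈ Ω) : s ⊆ Ω := by
  obtain ⟨⟨y₀, hy₀, rfl⟩, -⟩ := hΩ
  rw [connectedComponentIn_eq hy]
  exact hs.subset_connectedComponentIn hys hsub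

variable [IsManifold (𝓡∂ n) ∞ M]

/-- Near an interior point, the hypersurface has a tube in which it is the zero set of the first
coordinate and `Ω` is the part where the first coordinate is negative. -/
theorem IsEnclosedDomain.exists_tube (hR : AdmissibleRadius K R)
    (hx : IsFreeBoundaryImmersion K R x ν) (hemb : IsEmbedding x)
    (hΩ : IsEnclosedDomain K R x ν Ω) {q : M} (hq : q ∈ (𝓡∂ n).interior M) :
    ∃ e : OpenPartialHomeomorph (EuclideanSpace ℝ (Fin (n + 1))) (EuclideanSpace ℝ (Fin (n + 1))),
      (∀ v, e v = tubeMap K x ν q v) ∧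
      e.source ⊆ tailL n ⁻¹' interior (chartDom q) ∧ ContDiffOn ℝ 1 e e.source ∧
      ContDiffOn ℝ 1 e.symm e.target ∧ x q ∈ e.target ∧
      e.target ⊆ Metric.ball 0 (modelRadius K R) ∧
      (∀ p, x p ∈ e.target → p ∈ (extChartAt (𝓡∂ n) q).source ∧
        consE (0, extChartAt (𝓡∂ n) q p) ∈ e.source) ∧
      ∀ v ∈ e.source, e v ∈ Ω ↔ v 0 < 0 := by
  set z₀ := extChartAt (𝓡∂ n) q q with hz₀
  have hz₀i : z₀ ∈ interior (chartDom q) := ModelWithCorners.isInteriorPoint_iff.1 hq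
  obtain ⟨e, hec, hes, hesub, heC, heC'⟩ := SpaceForm.exists_tube hR hx q hz₀i
  have hez₀ : e (consE (0, z₀)) = x q := by
    rw [hec, tubeMap_consE_zero, inChart_extChartAt x (mem_extChartAt_source q)]
  obtain ⟨r₁, hr₁, hbox₁⟩ := exists_box_subset (e.open_source.mem_nhds hes)
  have hU₁ : IsOpen ((extChartAt (𝓡∂ n) q).source ∩
      extChartAt (𝓡∂ n) q ⁻¹' Metric.ball z₀ r₁) :=
    (continuousOn_extChartAt q).isOpen_inter_preimage (isOpen_extChartAt_source q)
      Metric.isOpen_ball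
  -- Here the embedding hypothesis enters: inside W₀ no point of Σ comes from outside the chosen
  -- piece of the chart, so no other sheet of Σ meets the tube.
  obtain ⟨W₀, hW₀, hW₀U⟩ := hemb.isInducing.isOpen_iff.1 hU₁
  have hqW₀ : x q ∈ W₀ := by
    have : q ∈ x ⁻¹' W₀ := by
      rw [hW₀U]
      exact ⟨mem_extChartAt_source q, Metric.mem_ball_self hr₁⟩
    exact this
  have hqB : x q ∈ Metric.ball 0 (modelRadius K R) := by
    rw [← interior_geodesicBall (n + 1) hR]
    exact hx.interior_mem q hq
  have hnh : e.source ∩ e ⁻¹' (W₀ ∩ Metric.ball 0 (modelRadius K R)) ∈ 𝓝 (consE (0, z₀)) := by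
    refine (e.isOpen_inter_preimage (hW₀.inter Metric.isOpen_ball)).mem_nhds ⟨hes, ?_⟩
    rw [mem_preimage, hez₀]
    exact ⟨hqW₀, hqB⟩
  obtain ⟨r₂, hr₂, hbox₂⟩ := exists_box_subset hnh
  obtain ⟨r, hr, hrr₁, hrr₂⟩ : ∃ r > 0, r ≤ r₁ ∧ r ≤ r₂ :=
    ⟨min r₁ r₂, lt_min hr₁ hr₂, min_le_left _ _, min_le_right _ _⟩
  have hbox : box z₀ r ⊆ e.source ∩ e ⁻¹' (W₀ ∩ Metric.ball 0 (modelRadius K R)) :=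
    (box_mono z₀ hrr₂).trans hbox₂
  -- A point of Σ in the tube already lies on the central slice, by injectivity of e on its source.
  have hkey : ∀ p, ∀ v ∈ box z₀ r, x p = e v → p ∈ (extChartAt (𝓡∂ n) q).source ∧
      v = consE (0, extChartAt (𝓡∂ n) q p) := by
    intro p v hv hpv
    have hpU : p ∈ (extChartAt (𝓡∂ n) q).source ∩
        extChartAt (𝓡∂ n) q ⁻¹' Metric.ball z₀ r₁ := by
      rw [← hW₀U, mem_preimage, hpv]
      exact (hbox hv).2.1
    refine ⟨hpU.1, e.injOn (hbox hv).1 (hbox₁ ?_) ?_⟩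
    · rw [mem_box]
      exact ⟨by simpa using hr₁, hpU.2⟩
    · rw [hec (consE _), tubeMap_consE_zero, inChart_extChartAt x hpU.1, ← hpv]
  have hzero : ∀ v ∈ box z₀ r, e v ∈ range x ↔ v 0 = 0 := by
    intro v hv
    constructor
    · rintro ⟨p, hp⟩
      rw [(hkey p v hv hp).2]
      rfl
    · intro h0
      have h1 : v = consE (0, tailL n v) := by
        rw [← h0, consE_head_tail]
      rw [h1, hec, tubeMap_consE_zero]
      exact ⟨_, rfl⟩
  have hballB : Metric.ball (0 : EuclideanSpace ℝ (Fin (n + 1))) (modelRadius K R)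
      ⊆ geodesicBall (n + 1) K R := Metric.ball_subset_closedBall
  have hcont : ContinuousOn e (box z₀ r) := e.continuousOn.mono fun v hv => (hbox hv).1
  have hneg : e '' (box z₀ r ∩ {v | v 0 < 0}) ⊆ geodesicBall (n + 1) K R \ range x := by
    rintro _ ⟨v, ⟨hv, hv0⟩, rfl⟩
    exact ⟨hballB (hbox hv).2.2, fun h => hv0.ne ((hzero v hv).1 h)⟩
  have hpos : e '' (box z₀ r ∩ {v | 0 < v 0}) ⊆ geodesicBall (n + 1) K R \ range x := by
    rintro _ ⟨v, ⟨hv, hv0⟩, rfl⟩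
    exact ⟨hballB (hbox hv).2.2, fun h => hv0.ne' ((hzero v hv).1 h)⟩
  have hnegc : IsPreconnected (e '' (box z₀ r ∩ {v | v 0 < 0})) :=
    (convex_box_neg z₀ r).isPreconnected.image _ (hcont.mono inter_subset_left)
  have hposc : IsPreconnected (e '' (box z₀ r ∩ {v | 0 < v 0})) :=
    (convex_box_pos z₀ r).isPreconnected.image _ (hcont.mono inter_subset_left)
  have hl := conformalFactor_pos (hx.mem_domain hR q)
  obtain ⟨s, hs0, hsr, hs1, hs2⟩ : ∃ s : ℝ, 0 < s ∧ s < r * conformalFactor K (x q) ∧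
      x q - s • ν q ∈ Ω ∧ x q + s • ν q ∉ Ω := by
    have h1 := hΩ.2 q hq
    have h2 : ∀ᶠ s in 𝓝[>] (0 : ℝ), s < r * conformalFactor K (x q) :=
      nhdsWithin_le_nhds (Iio_mem_nhds (mul_pos hr hl))
    obtain ⟨s, ⟨h3, h4⟩, h5⟩ := ((h1.and h2).and self_mem_nhdsWithin).exists
    exact ⟨s, h5, h4, h3.1, h3.2⟩
  -- Because N = λν, the displacement s ν corresponds to the tube coordinate s/λ.
  have hcurve : ∀ s : ℝ, e (consE (s * (conformalFactor K (x q))⁻¹, z₀)) = x q + s • ν q := by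
    intro s
    rw [hec, tubeMap, tailL_consE, consE_zero, inChart_extChartAt x (mem_extChartAt_source q),
      inChart_extChartAt _ (mem_extChartAt_source q), euclideanNormal, smul_smul]
    congr 2
    field_simp
  have hsl : s * (conformalFactor K (x q))⁻¹ < r := by
    rw [← div_eq_mul_inv, div_lt_iff₀ hl]
    exact hsr
  have hsl0 : 0 < s * (conformalFactor K (x q))⁻¹ := mul_pos hs0 (inv_pos.2 hl)
  -- Each half of the box is convex and its image avoids Σ, so one point of Ω puts the whole
  -- negative half inside Ω; likewise one point outside Ω keeps the positive half outside.
  have hnegΩ : e '' (box z₀ r ∩ {v | v 0 < 0}) ⊆ Ω := by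
    refine hΩ.subset_of_mem hnegc hneg (y := x q - s • ν q) ?_ hs1
    refine ⟨consE (-s * (conformalFactor K (x q))⁻¹, z₀), ⟨?_, ?_⟩, ?_⟩
    · rw [mem_box]
      refine ⟨?_, Metric.mem_ball_self hr⟩
      rw [consE_zero, neg_mul, abs_neg, abs_of_pos hsl0]
      exact hsl
    · simp only [mem_ofPred_eq, consE_zero]
      linarith
    · rw [hcurve, neg_smul, sub_eq_add_neg]
  have hposΩ : ∀ v ∈ box z₀ r ∩ {v | 0 < v 0}, e v ∉ Ω := by
    intro v hv hvΩ
    have h1 := hΩ.subset_of_mem hposc hpos (mem_image_of_mem e hv) hvΩ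
    refine hs2 (h1 ⟨consE (s * (conformalFactor K (x q))⁻¹, z₀), ⟨?_, hsl0⟩, hcurve s⟩)
    rw [mem_box]
    refine ⟨?_, Metric.mem_ball_self hr⟩
    rw [consE_zero, abs_of_pos hsl0]
    exact hsl
  have hsrc : (e.restrOpen (box z₀ r) (isOpen_box z₀ r)).source = box z₀ r := by
    rw [OpenPartialHomeomorph.restrOpen_source, inter_eq_right]
    exact fun v hv => (hbox hv).1
  have htgt : ∀ y ∈ (e.restrOpen (box z₀ r) (isOpen_box z₀ r)).target,
      ∃ v ∈ box z₀ r, e v = y := by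
    intro y hy
    have h1 := (e.restrOpen (box z₀ r) (isOpen_box z₀ r)).map_target hy
    rw [hsrc] at h1
    exact ⟨_, h1, (e.restrOpen (box z₀ r) (isOpen_box z₀ r)).right_inv hy⟩
  have hmem0 : consE (0, z₀) ∈ box z₀ r := by
    rw [mem_box]
    exact ⟨by simpa using hr, Metric.mem_ball_self hr⟩
  refine ⟨e.restrOpen (box z₀ r) (isOpen_box z₀ r), hec, ?_, ?_, ?_, ?_, ?_, ?_, ?_⟩
  · rw [hsrc]
    exact fun v hv => hesub (hbox hv).1
  · rw [hsrc]
    exact heC.mono fun v hv => (hbox hv).1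
  · exact heC'.mono fun y hy => hy.1
  · rw [← hez₀]
    have h1 : consE (0, z₀) ∈ (e.restrOpen (box z₀ r) (isOpen_box z₀ r)).source := by
      rw [hsrc]; exact hmem0
    exact (e.restrOpen (box z₀ r) (isOpen_box z₀ r)).map_source h1
  · intro y hy
    obtain ⟨v, hv, rfl⟩ := htgt y hy
    exact (hbox hv).2.2
  · intro p hp
    obtain ⟨v, hv, hvp⟩ := htgt _ hp
    have h1 := hkey p v hv hvp.symm
    refine ⟨h1.1, ?_⟩
    rw [hsrc, ← h1.2]
    exact hv
  · intro v hv
    rw [hsrc] at hv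
    change e v ∈ Ω ↔ v 0 < 0
    rcases lt_trichotomy (v 0) 0 with h | h | h
    · exact ⟨fun _ => h, fun _ => hnegΩ ⟨v, ⟨hv, h⟩, rfl⟩⟩
    · refine ⟨fun h1 => ?_, fun h1 => absurd h h1.ne⟩
      exact absurd ((hzero v hv).2 h) (hΩ.subset_diff h1).2
    · refine ⟨fun h1 => absurd h1 (hposΩ v ⟨hv, h⟩), fun h1 => absurd h1 h.le.not_gt⟩

end LocalGauss

end SpaceForm

end

open Set Filter Topology MeasureTheory
open scoped Manifold ContDiff

noncomputable section

namespace SpaceForm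

/-! ### The divergence theorem on Ω for compactly supported fields. -/

section Gauss

variable {n : ℕ} [NeZero n] {M : Type*} [TopologicalSpace M]
  [ChartedSpace (EuclideanHalfSpace n) M]

/-- The flux of `Z` through the hypersurface, as a density with respect to the area measure of the
conformal metric. -/
def normalFlux (K : SignType) (x ν : M → EuclideanSpace ℝ (Fin (n + 1)))
    (Z : EuclideanSpace ℝ (Fin (n + 1)) → EuclideanSpace ℝ (Fin (n + 1))) (p : M) : ℝ :=
  inner ℝ (Z (x p)) (euclideanNormal K x ν p) * (conformalFactor K (x p) ^ n)⁻¹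

variable {K : SignType} {R : ℝ} {x ν : M → EuclideanSpace ℝ (Fin (n + 1))}
  {Ω : Set (EuclideanSpace ℝ (Fin (n + 1)))}

variable [IsManifold (𝓡∂ n) ∞ M]

theorem continuous_normalFlux (hR : AdmissibleRadius K R) (hx : IsFreeBoundaryImmersion K R x ν)
    {Z : EuclideanSpace ℝ (Fin (n + 1)) → EuclideanSpace ℝ (Fin (n + 1))} (hZ : Continuous Z) :
    Continuous (normalFlux K x ν Z) := by
  have h1 : Continuous fun p => conformalFactor K (x p) := by
    rw [continuous_iff_continuousAt]
    intro p
    exact (differentiableAt_conformalFactor (hx.mem_domain hR p)).continuousAt.comp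
      hx.contMDiff.continuous.continuousAt
  exact ((hZ.comp hx.contMDiff.continuous).inner (hx.contMDiff_euclideanNormal hR).continuous).mul
    ((h1.pow n).inv₀ fun p => pow_ne_zero _ (conformalFactor_pos (hx.mem_domain hR p)).ne')

/-- On the central slice the derivative of e sends the basis to N and the tangent vectors ∂_i x. The
first coordinate of its inverse applied to Z is therefore ⟨Z, N⟩, and the Jacobian is the Euclidean
area density. -/
theorem tubeFlux_eq (hR : AdmissibleRadius K R) (hx : IsFreeBoundaryImmersion K R x ν) {q : M}
    {e : OpenPartialHomeomorph (EuclideanSpace ℝ (Fin (n + 1))) (EuclideanSpace ℝ (Fin (n + 1)))}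
    (hec : ∀ v, e v = tubeMap K x ν q v) (hsub : e.source ⊆ tailL n ⁻¹' interior (chartDom q))
    (hes : ContDiffOn ℝ 1 e.symm e.target)
    (Z : EuclideanSpace ℝ (Fin (n + 1)) → EuclideanSpace ℝ (Fin (n + 1)))
    {z : EuclideanSpace ℝ (Fin n)} (hz : consE (0, z) ∈ e.source) :
    tubeFlux e Z (consE (0, z)) = |chartDet K x ν q z| *
      inner ℝ (Z (inChart x q z)) (inChart (euclideanNormal K x ν) q z) := by
  have hzi : z ∈ interior (chartDom q) := hsub hz
  have hzU : z ∈ chartDom q := interior_subset hzi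
  have hp := hx.isPatch hR q
  have he : (e : EuclideanSpace ℝ (Fin (n + 1)) → _) = tubeMap K x ν q := funext hec
  have hd : HasFDerivAt e (tubeDeriv K x ν q z) (consE (0, z)) := by
    rw [he]
    exact hasFDerivAt_tubeMap hR hx q hzi
  have hy := e.map_source hz
  have hds : HasFDerivAt e.symm (fderiv ℝ e.symm (e (consE (0, z)))) (e (consE (0, z))) :=
    ((hes.contDiffAt (e.open_target.mem_nhds hy)).differentiableAt one_ne_zero).hasFDerivAt
  have hd' : HasFDerivAt e (tubeDeriv K x ν q z) (e.symm (e (consE (0, z)))) := by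
    rwa [e.left_inv hz]
  have hid : HasFDerivAt (fun y => y) ((tubeDeriv K x ν q z).comp
      (fderiv ℝ e.symm (e (consE (0, z))))) (e (consE (0, z))) := by
    refine (hd'.comp _ hds).congr_of_eventuallyEq ?_
    filter_upwards [e.open_target.mem_nhds hy] with y hy'
    exact (e.right_inv hy').symm
  have hL := hid.unique (hasFDerivAt_id _)
  have hez : e (consE (0, z)) = inChart x q z := by rw [hec, tubeMap_consE_zero]
  rw [tubeFlux, hd.fderiv, det_tubeDeriv]
  congr 1
  set u := fderiv ℝ e.symm (e (consE (0, z))) (Z (e (consE (0, z)))) with hu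
  have h1 : tubeDeriv K x ν q z u = Z (inChart x q z) := by
    rw [← hez]
    exact congrArg (fun L => L (Z (e (consE (0, z))))) hL
  rw [← h1, tubeDeriv_apply, inner_add_left, inner_smul_left, real_inner_comm, hp.normal z hzU,
    hp.unit z hzU]
  simp

variable [T2Space M] [CompactSpace M] [MeasurableSpace M] [BorelSpace M]

theorem integral_tubeFlux (hR : AdmissibleRadius K R) (hx : IsFreeBoundaryImmersion K R x ν) {q : M}
    {e : OpenPartialHomeomorph (EuclideanSpace ℝ (Fin (n + 1))) (EuclideanSpace ℝ (Fin (n + 1)))}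
    (hec : ∀ v, e v = tubeMap K x ν q v) (hsub : e.source ⊆ tailL n ⁻¹' interior (chartDom q))
    (hes : ContDiffOn ℝ 1 e.symm e.target)
    (hS : ∀ p, x p ∈ e.target → p ∈ (extChartAt (𝓡∂ n) q).source ∧
        consE (0, extChartAt (𝓡∂ n) q p) ∈ e.source)
    {Z : EuclideanSpace ℝ (Fin (n + 1)) → EuclideanSpace ℝ (Fin (n + 1))} (hZ : Continuous Z)
    (hZs : tsupport Z ⊆ e.target) :
    ∫ z, e.source.indicator (tubeFlux e Z) (consE (0, z))
      = ∫ p, normalFlux K x ν Z p ∂(areaMeasure K x) := by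
  have hout : ∀ y, y ∉ e.target → Z y = 0 := fun y hy =>
    image_eq_zero_of_notMem_tsupport fun h => hy (hZs h)
  rw [(hx.integral_eq_chart hR q (continuous_normalFlux hR hx hZ).continuousOn fun p hp => by
    rw [normalFlux, hout _ fun h => hp (hS p h).1]
    simp).2, ← integral_indicator (measurableSet_chartDom q)]
  congr 1
  ext1 z
  by_cases hz : consE (0, z) ∈ e.source
  · have hzU : z ∈ chartDom q := interior_subset (hsub hz : z ∈ interior (chartDom q))
    rw [indicator_of_mem hz, indicator_of_mem hzU, tubeFlux_eq hR hx hec hsub hes Z hz,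
      hx.chartDensity_eq hR q hzU]
    have hl := pow_ne_zero n (conformalFactor_pos ((hx.isPatch hR q).mem_domain hzU)).ne'
    change _ = _ * (inner ℝ (Z (inChart x q z)) (inChart (euclideanNormal K x ν) q z) *
      (conformalFactor K (inChart x q z) ^ n)⁻¹)
    field_simp
  · rw [indicator_of_notMem hz]
    by_cases hzU : z ∈ chartDom q
    · rw [indicator_of_mem hzU, inChart_apply, normalFlux, hout]
      · simp
      · intro h
        have h1 := (hS _ h).2
        rw [(extChartAt (𝓡∂ n) q).right_inv hzU] at h1
        exact hz h1
    · rw [indicator_of_notMem hzU]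

/-- A small ball around a point of Ω avoids the compact set Σ and is connected, so it lies in Ω.
Points of Ω on ∂B are excluded, as there Ω contains no full ball. -/
theorem IsEnclosedDomain.isOpen_inter_ball (hx : IsFreeBoundaryImmersion K R x ν)
    (hΩ : IsEnclosedDomain K R x ν Ω) : IsOpen (Ω ∩ Metric.ball 0 (modelRadius K R)) := by
  have hS : IsClosed (range x) := (isCompact_range hx.contMDiff.continuous).isClosed
  rw [isOpen_iff_mem_nhds]
  rintro y ⟨hy, hyB⟩
  have hyS := (hΩ.subset_diff hy).2
  obtain ⟨r, hr, hsub⟩ := Metric.mem_nhds_iff.1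
    ((Metric.isOpen_ball.inter hS.isOpen_compl).mem_nhds ⟨hyB, hyS⟩)
  filter_upwards [Metric.ball_mem_nhds y hr] with z hz
  refine ⟨hΩ.subset_of_mem (convex_ball y r).isPreconnected (fun w hw => ?_)
    (Metric.mem_ball_self hr) hy hz, (hsub hz).1⟩
  exact ⟨Metric.ball_subset_closedBall (hsub hw).1, (hsub hw).2⟩

/-- The divergence theorem holds locally. -/
theorem IsEnclosedDomain.exists_nhds_gauss (hR : AdmissibleRadius K R)
    (hx : IsFreeBoundaryImmersion K R x ν) (hemb : IsEmbedding x)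
    (hΩ : IsEnclosedDomain K R x ν Ω) {y : EuclideanSpace ℝ (Fin (n + 1))}
    (hy : y ∈ Metric.ball 0 (modelRadius K R)) :
    ∃ W : Set (EuclideanSpace ℝ (Fin (n + 1))), IsOpen W ∧ y ∈ W ∧
      ∀ Z : EuclideanSpace ℝ (Fin (n + 1)) → EuclideanSpace ℝ (Fin (n + 1)), ContDiff ℝ 1 Z →
        HasCompactSupport Z → tsupport Z ⊆ W →
        ∫ y in Ω ∩ Metric.ball 0 (modelRadius K R), divergence Z y
          = ∫ p, normalFlux K x ν Z p ∂(areaMeasure K x) := by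
  have hΩm := (hΩ.isOpen_inter_ball hx).measurableSet
  by_cases hyS : y ∈ range x
  · obtain ⟨q, rfl⟩ := hyS
    -- Boundary points of M are mapped to the sphere, not into the open ball.
    have hq : q ∈ (𝓡∂ n).interior M := by
      rcases (𝓡∂ n).isInteriorPoint_or_isBoundaryPoint q with h | h
      · exact h
      · have h1 := hx.boundary_mem q h
        rw [geodesicBall, frontier_closedBall _ (modelRadius_pos hR).ne'] at h1
        rw [Metric.mem_ball] at hy
        exact absurd h1 hy.ne
    obtain ⟨e, hec, hsub, he, hes, hqt, htB, hS, hside⟩ := hΩ.exists_tube hR hx hemb hq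
    refine ⟨e.target, e.open_target, hqt, fun Z hZ hc hZs => ?_⟩
    rw [← integral_tubeFlux hR hx hec hsub hes hS hZ.continuous hZs,
      ← integral_divergence_tube e he hes hZ hc hZs]
    have h3 : ContinuousOn (fun y => e.symm y 0) e.target :=
      (EuclideanSpace.proj (𝕜 := ℝ) (0 : Fin (n + 1))).continuous.comp_continuousOn
        e.continuousOn_symm
    have hmT : MeasurableSet (e.target ∩ {y | e.symm y 0 < 0}) :=
      (h3.isOpen_inter_preimage e.open_target isOpen_Iio).measurableSet
    rw [← integral_indicator hΩm, ← integral_indicator hmT]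
    congr 1
    ext1 y
    by_cases hyt : y ∈ e.target
    · have h4 := hside (e.symm y) (e.map_target hyt)
      rw [e.right_inv hyt] at h4
      by_cases hy0 : e.symm y 0 < 0
      · rw [indicator_of_mem (show y ∈ Ω ∩ _ from ⟨h4.2 hy0, htB hyt⟩),
          indicator_of_mem (show y ∈ e.target ∩ {y | e.symm y 0 < 0} from ⟨hyt, hy0⟩)]
      · rw [indicator_of_notMem fun h => hy0 (h4.1 h.1), indicator_of_notMem fun h => hy0 h.2]
    · have h5 : divergence Z y = 0 := divergence_eq_zero fun h => hyt (hZs h)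
      rw [indicator_apply_eq_zero.2 fun _ => h5, indicator_apply_eq_zero.2 fun _ => h5]
  · have hS : IsClosed (range x) := (isCompact_range hx.contMDiff.continuous).isClosed
    obtain ⟨r, hr, hsub⟩ := Metric.mem_nhds_iff.1
      ((Metric.isOpen_ball.inter hS.isOpen_compl).mem_nhds ⟨hy, hyS⟩)
    refine ⟨Metric.ball y r, Metric.isOpen_ball, Metric.mem_ball_self hr, fun Z hZ hc hZs => ?_⟩
    have h1 : ∀ p, normalFlux K x ν Z p = 0 := by
      intro p
      have h2 : Z (x p) = 0 := image_eq_zero_of_notMem_tsupport fun h =>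
        (hsub (hZs h)).2 ⟨p, rfl⟩
      rw [normalFlux, h2]
      simp
    simp only [h1, integral_zero]
    have hsub' : Metric.ball y r ⊆ geodesicBall (n + 1) K R \ range x := fun w hw =>
      ⟨Metric.ball_subset_closedBall (hsub hw).1, (hsub hw).2⟩
    -- Away from Σ a small ball lies either inside Ω or outside it; both sides of the formula are
    -- then zero.
    by_cases hne : ∃ w ∈ Metric.ball y r, w ∈ Ω
    · obtain ⟨w, hw, hwΩ⟩ := hne
      have hbΩ := hΩ.subset_of_mem (convex_ball y r).isPreconnected hsub' hw hwΩ
      rw [← integral_divergence_eq_zero hZ hc]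
      refine setIntegral_eq_integral_of_forall_compl_eq_zero fun w hw => ?_
      exact divergence_eq_zero fun h => hw ⟨hbΩ (hZs h), (hsub (hZs h)).1⟩
    · push Not at hne
      refine setIntegral_eq_zero_of_forall_eq_zero fun w hw => ?_
      exact divergence_eq_zero fun h => hne w (hZs h) hw.1

/-- The divergence theorem for `Ω` and vector fields with compact support in the open ball. -/
theorem IsEnclosedDomain.integral_divergence (hR : AdmissibleRadius K R)
    (hx : IsFreeBoundaryImmersion K R x ν) (hemb : IsEmbedding x)
    (hΩ : IsEnclosedDomain K R x ν Ω)
    {Z : EuclideanSpace ℝ (Fin (n + 1)) → EuclideanSpace ℝ (Fin (n + 1))} (hZ : ContDiff ℝ 1 Z)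
    (hc : HasCompactSupport Z) (hZs : tsupport Z ⊆ Metric.ball 0 (modelRadius K R)) :
    ∫ y in Ω ∩ Metric.ball 0 (modelRadius K R), divergence Z y
      = ∫ p, normalFlux K x ν Z p ∂(areaMeasure K x) := by
  choose! W hWo hyW hW using fun y (hy : y ∈ Metric.ball 0 (modelRadius K R)) =>
    hΩ.exists_nhds_gauss hR hx hemb hy
  obtain ⟨f, hf⟩ := SmoothPartitionOfUnity.exists_isSubordinate
    𝓘(ℝ, EuclideanSpace ℝ (Fin (n + 1))) (isClosed_tsupport Z)
    (fun y : tsupport Z => W y) (fun y => hWo y (hZs y.2))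
    (fun y hy => mem_iUnion.2 ⟨⟨y, hy⟩, hyW y (hZs hy)⟩)
  have hfin : {i | (Function.support (f i) ∩ tsupport Z).Nonempty}.Finite :=
    f.locallyFinite.finite_nonempty_inter_compact hc
  set s := hfin.toFinset with hs
  have hfs : ∀ i, ContDiff ℝ 1 (f i) := fun i => (f i).contMDiff.contDiff.of_le
    (by exact_mod_cast le_top)
  have hsum : ∀ y ∈ tsupport Z, ∑ i ∈ s, f i y = 1 := by
    intro y hy
    rw [← f.sum_eq_one hy, finsum_eq_sum_of_support_subset]
    intro i hi
    simp only [hs, Finite.coe_toFinset, mem_ofPred_eq]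
    exact ⟨y, hi, hy⟩
  have hZsum : Z = fun y => ∑ i ∈ s, f i y • Z y := by
    ext1 y
    by_cases hy : y ∈ tsupport Z
    · rw [← Finset.sum_smul, hsum y hy, one_smul]
    · simp [image_eq_zero_of_notMem_tsupport hy]
  have hC : ∀ i, ContDiff ℝ 1 fun y => f i y • Z y := fun i => (hfs i).smul hZ
  have hCc : ∀ i, HasCompactSupport fun y => f i y • Z y := fun i =>
    HasCompactSupport.intro hc fun y hy => by
      rw [image_eq_zero_of_notMem_tsupport hy, smul_zero]
  have hCs : ∀ i, tsupport (fun y => f i y • Z y) ⊆ W i := fun i =>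
    (closure_mono (Function.support_smul_subset_left (f i) Z)).trans (hf i)
  have hdiv : ∀ y, divergence Z y = ∑ i ∈ s, divergence (fun y => f i y • Z y) y := by
    intro y
    have h1 : fderiv ℝ Z y = ∑ i ∈ s, fderiv ℝ (fun y => f i y • Z y) y := by
      conv_lhs => rw [hZsum]
      exact fderiv_fun_sum fun i _ => (hC i).differentiable one_ne_zero y
    simp only [divergence, h1]
    rw [Finset.sum_comm]
    refine Finset.sum_congr rfl fun j _ => ?_
    simp [_root_.sum_apply]
  have hflux : ∀ p, normalFlux K x ν Z p = ∑ i ∈ s, normalFlux K x ν (fun y => f i y • Z y) p := by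
    intro p
    have h1 : Z (x p) = ∑ i ∈ s, f i (x p) • Z (x p) := congrFun hZsum (x p)
    simp only [normalFlux]
    rw [← Finset.sum_mul, ← sum_inner, ← h1]
  have hint1 : ∀ i, Integrable (divergence fun y => f i y • Z y)
      (volume.restrict (Ω ∩ Metric.ball 0 (modelRadius K R))) := fun i =>
    ((continuous_divergence (hC i)).integrable_of_hasCompactSupport
      (hasCompactSupport_divergence (hCc i))).integrableOn
  have hint2 : ∀ i, Integrable (normalFlux K x ν fun y => f i y • Z y) (areaMeasure K x) :=
    fun i => hx.integrable_of_continuous hR (continuous_normalFlux hR hx (hC i).continuous)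
  simp only [hdiv, hflux]
  rw [integral_finsetSum _ fun i _ => hint1 i, integral_finsetSum _ fun i _ => hint2 i]
  exact Finset.sum_congr rfl fun i _ => hW i (hZs i.2) _ (hC i) (hCc i) (hCs i)

end Gauss

end SpaceForm

end

open Set Filter Topology MeasureTheory
open scoped Manifold ContDiff

noncomputable section

namespace SpaceForm

/-! ### The volume measure, the divergence of λ^m X_a, and the cutoff near ∂B. -/

section Volume

variable {m : ℕ} {K : SignType} {R : ℝ}

theorem sqrt_det_metric {y : EuclideanSpace ℝ (Fin m)} (hy : y ∈ modelDomain m K) :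
    Real.sqrt (Matrix.of fun i j : Fin m =>
      metric K y (EuclideanSpace.single i 1) (EuclideanSpace.single j 1)).det
      = conformalFactor K y ^ m := by
  have h : (Matrix.of fun i j : Fin m =>
      metric K y (EuclideanSpace.single i 1) (EuclideanSpace.single j 1))
      = conformalFactor K y ^ 2 • (1 : Matrix (Fin m) (Fin m) ℝ) := by
    ext i j
    simp [metric, Matrix.one_apply, EuclideanSpace.inner_single_left]
  rw [h, Matrix.det_smul, Matrix.det_one, mul_one, Fintype.card_fin, ← pow_mul, mul_comm 2 m,
    pow_mul, Real.sqrt_sq (pow_nonneg (conformalFactor_pos hy).le m)]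

theorem continuousOn_conformalFactor_domain :
    ContinuousOn (conformalFactor (m := m) K) (modelDomain m K) := fun _ hy =>
  (differentiableAt_conformalFactor hy).continuousAt.continuousWithinAt

theorem restrict_volumeMeasure {s : Set (EuclideanSpace ℝ (Fin m))} (hs : MeasurableSet s)
    (hsub : s ⊆ modelDomain m K) :
    (volumeMeasure (m := m) K).restrict s = (volume.restrict s).withDensity
      fun y => ((conformalFactor K y ^ m).toNNReal : ENNReal) := by
  rw [volumeMeasure, restrict_withDensity hs]
  refine withDensity_congr_ae ?_
  filter_upwards [ae_restrict_mem hs] with y hy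
  rw [sqrt_det_metric (hsub hy)]
  rfl

theorem integrableOn_volumeMeasure {s : Set (EuclideanSpace ℝ (Fin m))} (hs : MeasurableSet s)
    (hsub : s ⊆ modelDomain m K) (f : EuclideanSpace ℝ (Fin m) → ℝ) :
    (IntegrableOn f s (volumeMeasure K) ↔
      IntegrableOn (fun y => conformalFactor K y ^ m * f y) s) ∧
    ∫ y in s, f y ∂(volumeMeasure K) = ∫ y in s, conformalFactor K y ^ m * f y := by
  have hdens : AEMeasurable (fun y => (conformalFactor (m := m) K y ^ m).toNNReal)
      (volume.restrict s) :=
    (((continuousOn_conformalFactor_domain.mono hsub).pow m).aemeasurable hs).real_toNNReal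
  have hpt : ∀ y ∈ s, ((conformalFactor K y ^ m).toNNReal : ℝ) • f y
      = conformalFactor K y ^ m * f y := fun y hy => by
    rw [Real.coe_toNNReal _ (pow_nonneg (conformalFactor_pos (hsub hy)).le m), smul_eq_mul]
  constructor
  · rw [IntegrableOn, restrict_volumeMeasure hs hsub,
      integrable_withDensity_iff_integrable_coe_smul₀ hdens]
    exact integrableOn_congr_fun hpt hs
  · rw [restrict_volumeMeasure hs hsub, integral_withDensity_eq_integral_smul₀ hdens]
    exact setIntegral_congr_fun hs hpt

theorem divergence_X (hR : AdmissibleRadius K R) (a y : EuclideanSpace ℝ (Fin m)) :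
    divergence (X K R a) y = fieldConst K R * (m * inner ℝ y a) := by
  have h1 : ∑ i, a i * y i = inner ℝ y a := by
    simp [PiLp.inner_apply]
  have h2 : ∑ i, y i * a i = inner ℝ y a := by
    rw [← h1]
    exact Finset.sum_congr rfl fun i _ => mul_comm _ _
  have h3 : ∀ i, (fieldConst K R • ((innerSL ℝ a).smulRight y
      + (inner ℝ y a : ℝ) • ContinuousLinearMap.id ℝ (EuclideanSpace ℝ (Fin m))
      - (innerSL ℝ y).smulRight a)) (EuclideanSpace.single i 1) i
      = fieldConst K R * (a i * y i + inner ℝ y a - y i * a i) := by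
    intro i
    simp [EuclideanSpace.inner_single_right]
  rw [divergence, (hasFDerivAt_X hR a y).fderiv, Finset.sum_congr rfl fun i _ => h3 i,
    ← Finset.mul_sum, Finset.sum_sub_distrib, Finset.sum_add_distrib, h1, h2]
  simp

/-- `div (λ^m X) = m λ^m V`. -/
theorem divergence_conformal_X (hR : AdmissibleRadius K R) (a : EuclideanSpace ℝ (Fin m))
    {y : EuclideanSpace ℝ (Fin m)} (hy : y ∈ modelDomain m K) :
    divergence (fun y => conformalFactor K y ^ m • X K R a y) y
      = m * (conformalFactor K y ^ m * V K a y) := by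
  have hd := differentiableAt_conformalFactor hy
  have hdm : DifferentiableAt ℝ (fun y => conformalFactor (m := m) K y ^ m) y := hd.pow m
  rw [divergence_smul hdm ((contDiff_X hR a).differentiable (by simp) y),
    divergence_X hR, V_eq hR hy]
  have h1 : fderiv ℝ (fun y => conformalFactor (m := m) K y ^ m) y (X K R a y)
      = m * conformalFactor K y ^ (m - 1) * (-curv K * conformalFactor K y ^ 2 *
        inner ℝ (X K R a y) y) := by
    rw [(hd.hasFDerivAt.pow m).fderiv, _root_.smul_apply, fderiv_conformalFactor hy,
      real_inner_comm y]
    simp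
  rw [h1]
  rcases m with _ | m
  · simp
  · rw [Nat.add_sub_cancel]
    ring

/-- A smooth cutoff function, equal to `1` where `2 ≤ (k + 1) (r² - |y|²)` and to `0` where
`(k + 1) (r² - |y|²) ≤ 1`. -/
def cutoff (r : ℝ) (k : ℕ) (y : EuclideanSpace ℝ (Fin m)) : ℝ :=
  Real.smoothTransition ((k + 1) * (r ^ 2 - ‖y‖ ^ 2) - 1)

theorem contDiff_cutoff (r : ℝ) (k : ℕ) : ContDiff ℝ 1 (cutoff (m := m) r k) := by
  have h : ContDiff ℝ 1 fun y : EuclideanSpace ℝ (Fin m) => ‖y‖ ^ 2 := contDiff_norm_sq ℝ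
  have h1 : ContDiff ℝ 1 fun y : EuclideanSpace ℝ (Fin m) => (k + 1) * (r ^ 2 - ‖y‖ ^ 2) - 1 :=
    (contDiff_const.mul (contDiff_const.sub h)).sub contDiff_const
  have h2 : ContDiff ℝ 1 Real.smoothTransition := Real.smoothTransition.contDiff
  exact h2.comp h1

theorem fderiv_cutoff (r : ℝ) (k : ℕ) (y v : EuclideanSpace ℝ (Fin m)) :
    fderiv ℝ (cutoff r k) y v
      = deriv Real.smoothTransition ((k + 1) * (r ^ 2 - ‖y‖ ^ 2) - 1) *
        (-(2 * (k + 1)) * inner ℝ y v) := by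
  have hn : HasFDerivAt (fun z : EuclideanSpace ℝ (Fin m) => ‖z‖ ^ 2) (2 • innerSL ℝ y) y :=
    (hasStrictFDerivAt_norm_sq y).hasFDerivAt
  have h1 := ((hn.const_sub (r ^ 2)).const_mul ((k : ℝ) + 1)).sub_const 1
  have h2 : ContDiff ℝ 1 Real.smoothTransition := Real.smoothTransition.contDiff
  have h3 := hasFDerivAt_of_eq_comp (T := cutoff r k) h2 h1 fun _ => rfl
  rw [h3.fderiv]
  change _ * ((k + 1) * -(2 • inner ℝ y v)) = _
  rw [nsmul_eq_mul]
  push_cast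
  ring

theorem cutoff_eq_zero {r : ℝ} {k : ℕ} {y : EuclideanSpace ℝ (Fin m)}
    (h : (k + 1) * (r ^ 2 - ‖y‖ ^ 2) ≤ 1) : cutoff r k y = 0 :=
  Real.smoothTransition.zero_of_nonpos (by linarith)

theorem isCompact_cutoff (r : ℝ) (k : ℕ) :
    IsCompact {y : EuclideanSpace ℝ (Fin m) | 1 ≤ (k + 1) * (r ^ 2 - ‖y‖ ^ 2)} := by
  refine (isCompact_closedBall (0 : EuclideanSpace ℝ (Fin m)) |r|).of_isClosed_subset
    (isClosed_le continuous_const (by fun_prop)) fun y hy => ?_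
  rw [mem_closedBall_zero_iff]
  have hk : (0 : ℝ) < k + 1 := by positivity
  have h1 : 0 < r ^ 2 - ‖y‖ ^ 2 := pos_of_mul_pos_right (one_pos.trans_le hy) hk.le
  rw [← abs_of_nonneg (norm_nonneg y)]
  exact sq_le_sq.1 (by linarith)

theorem cutoff_subset_ball {r : ℝ} (hr : 0 < r) (k : ℕ) :
    {y : EuclideanSpace ℝ (Fin m) | 1 ≤ (k + 1) * (r ^ 2 - ‖y‖ ^ 2)} ⊆ Metric.ball 0 r := by
  intro y hy
  rw [mem_ball_zero_iff]
  have hk : (0 : ℝ) < k + 1 := by positivity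
  have h1 : 0 < r ^ 2 - ‖y‖ ^ 2 := pos_of_mul_pos_right (one_pos.trans_le hy) hk.le
  exact lt_of_pow_lt_pow_left₀ 2 hr.le (by linarith)

theorem eventually_cutoff {r : ℝ} {y : EuclideanSpace ℝ (Fin m)} (hy : y ∈ Metric.ball 0 r) :
    ∀ᶠ k : ℕ in atTop, 2 < ((k : ℝ) + 1) * (r ^ 2 - ‖y‖ ^ 2) := by
  rw [mem_ball_zero_iff] at hy
  have h1 : 0 < r ^ 2 - ‖y‖ ^ 2 := by nlinarith [norm_nonneg y]
  have h2 : Tendsto (fun k : ℕ => ((k : ℝ) + 1) * (r ^ 2 - ‖y‖ ^ 2)) atTop atTop :=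
    (tendsto_natCast_atTop_atTop.atTop_add tendsto_const_nhds).atTop_mul_const h1
  exact h2.eventually_gt_atTop 2

theorem deriv_smoothTransition_of_one_lt {s : ℝ} (hs : 1 < s) :
    deriv Real.smoothTransition s = 0 := by
  have h : Real.smoothTransition =ᶠ[𝓝 s] fun _ => 1 := by
    filter_upwards [Ioi_mem_nhds hs] with t ht
    exact Real.smoothTransition.one_of_one_le (le_of_lt ht)
  rw [h.deriv_eq, deriv_const]

theorem deriv_smoothTransition_of_neg {s : ℝ} (hs : s < 0) :
    deriv Real.smoothTransition s = 0 := by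
  have h : Real.smoothTransition =ᶠ[𝓝 s] fun _ => 0 := by
    filter_upwards [Iio_mem_nhds hs] with t ht
    exact Real.smoothTransition.zero_of_nonpos (le_of_lt ht)
  rw [h.deriv_eq, deriv_const]

/-- The derivative of the transition function vanishes outside [0, 1]. With s + 1 = (k + 1)(ρ² -
|y|²), this bounds the gradient term of the cutoff uniformly in k. -/
theorem exists_bound_deriv_smoothTransition :
    ∃ C : ℝ, ∀ s : ℝ, |deriv Real.smoothTransition s * (s + 1)| ≤ C := by
  have h2 : ContDiff ℝ 1 Real.smoothTransition := Real.smoothTransition.contDiff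
  have hc : Continuous fun s => deriv Real.smoothTransition s * (s + 1) :=
    (h2.continuous_deriv le_rfl).mul (by fun_prop)
  obtain ⟨C, hC⟩ := hc.bounded_above_of_compact_support
    (HasCompactSupport.intro (isCompact_Icc (a := (0 : ℝ)) (b := 1)) fun s hs => by
      rw [mem_Icc, not_and_or, not_le, not_le] at hs
      rcases hs with hs | hs
      · rw [deriv_smoothTransition_of_neg hs, zero_mul]
      · rw [deriv_smoothTransition_of_one_lt hs, zero_mul])
  exact ⟨C, hC⟩

/-- The field `λ^m X`, cut off near the boundary of the ball. -/
def cutoffField (K : SignType) (R : ℝ) (a : EuclideanSpace ℝ (Fin m)) (k : ℕ)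
    (y : EuclideanSpace ℝ (Fin m)) : EuclideanSpace ℝ (Fin m) :=
  cutoff (modelRadius K R) k y • (conformalFactor K y ^ m • X K R a y)

theorem cutoffField_eq_zero (a : EuclideanSpace ℝ (Fin m)) (k : ℕ) {y : EuclideanSpace ℝ (Fin m)}
    (h : y ∉ {y | 1 ≤ (k + 1) * (modelRadius K R ^ 2 - ‖y‖ ^ 2)}) :
    cutoffField K R a k y = 0 := by
  rw [cutoffField, cutoff_eq_zero (not_le.1 h).le, zero_smul]

theorem tsupport_cutoffField (a : EuclideanSpace ℝ (Fin m)) (k : ℕ) :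
    tsupport (cutoffField K R a k) ⊆ {y | 1 ≤ (k + 1) * (modelRadius K R ^ 2 - ‖y‖ ^ 2)} :=
  closure_minimal (fun y hy => by
    by_contra h
    exact hy (cutoffField_eq_zero a k h)) (isCompact_cutoff _ k).isClosed

theorem hasCompactSupport_cutoffField (a : EuclideanSpace ℝ (Fin m)) (k : ℕ) :
    HasCompactSupport (cutoffField K R a k) :=
  HasCompactSupport.intro (isCompact_cutoff _ k) fun _ h => cutoffField_eq_zero a k h

theorem ball_subset_modelDomain (m : ℕ) (K : SignType) (R : ℝ) :
    Metric.ball 0 (modelRadius K R) ⊆ modelDomain m K :=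
  Metric.ball_subset_closedBall.trans (geodesicBall_subset_modelDomain m K R)

theorem contDiffAt_conformal_X (hR : AdmissibleRadius K R) (a : EuclideanSpace ℝ (Fin m))
    {y : EuclideanSpace ℝ (Fin m)} (hy : y ∈ modelDomain m K) :
    ContDiffAt ℝ 1 (fun y => conformalFactor K y ^ m • X K R a y) y := by
  have h1 : ContDiffAt ℝ 1 (conformalFactor (m := m) K) y :=
    (contDiffAt_conformalFactor hy).of_le (by exact_mod_cast le_top)
  have h2 : ContDiffAt ℝ 1 (X K R a) y :=
    (contDiff_X hR a).contDiffAt.of_le (by exact_mod_cast le_top)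
  exact (h1.pow m).smul h2

theorem contDiff_cutoffField (hR : AdmissibleRadius K R) (a : EuclideanSpace ℝ (Fin m)) (k : ℕ) :
    ContDiff ℝ 1 (cutoffField K R a k) := by
  rw [contDiff_iff_contDiffAt]
  intro y
  by_cases hy : y ∈ tsupport (cutoffField K R a k)
  · have hyB := cutoff_subset_ball (modelRadius_pos hR) k (tsupport_cutoffField a k hy)
    exact (contDiff_cutoff _ k).contDiffAt.smul
      (contDiffAt_conformal_X hR a (ball_subset_modelDomain m K R hyB))
  · refine (contDiffAt_const (c := 0)).congr_of_eventuallyEq ?_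
    exact notMem_tsupport_iff_eventuallyEq.1 hy

/-- The gradient of the cutoff is radial of size about k + 1, and ⟨X_a, y⟩ is a multiple of |y|² -
ρ²; their product depends on k only through the combination bounded in
`exists_bound_deriv_smoothTransition`. -/
theorem divergence_cutoffField (hR : AdmissibleRadius K R) (a : EuclideanSpace ℝ (Fin m)) (k : ℕ)
    {y : EuclideanSpace ℝ (Fin m)} (hy : y ∈ modelDomain m K) :
    divergence (cutoffField K R a k) y
      = cutoff (modelRadius K R) k y * (m * (conformalFactor K y ^ m * V K a y))
        + deriv Real.smoothTransition ((k + 1) * (modelRadius K R ^ 2 - ‖y‖ ^ 2) - 1) *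
          (((k + 1) * (modelRadius K R ^ 2 - ‖y‖ ^ 2) - 1) + 1) *
          (fieldConst K R * inner ℝ y a * conformalFactor K y ^ m) := by
  have h1 := divergence_smul ((contDiff_cutoff (modelRadius K R) k).differentiable one_ne_zero y)
    ((contDiffAt_conformal_X hR a hy).differentiableAt one_ne_zero)
  rw [divergence_conformal_X hR a hy, fderiv_cutoff, inner_smul_right,
    real_inner_comm (X K R a y) y, inner_X hR] at h1
  refine Eq.trans h1 ?_
  ring

end Volume

end SpaceForm

end

open Set Filter Topology MeasureTheory
open scoped Manifold ContDiff

noncomputable section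

namespace SpaceForm

/-! ### Removal of the cutoff and the volume formula. -/

section Enclosed

variable {n : ℕ} [NeZero n] {M : Type*} [TopologicalSpace M] [T2Space M] [CompactSpace M]
  [ChartedSpace (EuclideanHalfSpace n) M] [IsManifold (𝓡∂ n) ∞ M]
  [MeasurableSpace M] [BorelSpace M]
  {K : SignType} {R : ℝ} {x ν : M → EuclideanSpace ℝ (Fin (n + 1))}
  {Ω : Set (EuclideanSpace ℝ (Fin (n + 1)))}

theorem volume_hyperplane (n : ℕ) [NeZero n] :
    volume {y : EuclideanSpace ℝ (Fin n) | y 0 = 0} = 0 := by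
  set L : EuclideanSpace ℝ (Fin n) →ₗ[ℝ] ℝ :=
    (EuclideanSpace.proj (0 : Fin n) : EuclideanSpace ℝ (Fin n) →L[ℝ] ℝ).toLinearMap with hL
  have h : LinearMap.ker L ≠ ⊤ := by
    intro htop
    have h1 : EuclideanSpace.single (0 : Fin n) (1 : ℝ) ∈ LinearMap.ker L := by
      rw [htop]
      exact Submodule.mem_top
    have h2 : (EuclideanSpace.single (0 : Fin n) (1 : ℝ)) 0 = 0 := LinearMap.mem_ker.1 h1
    simp at h2
  exact Measure.addHaar_submodule volume _ h

/-- Up to a set of area zero, `M` is mapped into the open ball. -/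
theorem IsFreeBoundaryImmersion.ae_mem_ball (hR : AdmissibleRadius K R)
    (hx : IsFreeBoundaryImmersion K R x ν) :
    ∀ᵐ p ∂(areaMeasure K x), x p ∈ Metric.ball 0 (modelRadius K R) := by
  have : SecondCountableTopology (EuclideanHalfSpace n) :=
    inferInstanceAs (SecondCountableTopology {y : EuclideanSpace ℝ (Fin n) // 0 ≤ y 0})
  have := ChartedSpace.secondCountable_of_sigmaCompact (EuclideanHalfSpace n) M
  have hS : IsClosed {p | x p ∉ Metric.ball 0 (modelRadius K R)} :=
    Metric.isOpen_ball.isClosed_compl.preimage hx.contMDiff.continuous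
  refine measure_null_of_locally_null _ fun q _ => ?_
  have hU := isOpen_extChartAt_source (I := 𝓡∂ n) q
  refine ⟨{p | x p ∉ Metric.ball 0 (modelRadius K R)} ∩ (extChartAt (𝓡∂ n) q).source,
    inter_mem self_mem_nhdsWithin
      (mem_nhdsWithin_of_mem_nhds (hU.mem_nhds (mem_extChartAt_source q))), ?_⟩
  have hm := hS.measurableSet.inter hU.measurableSet
  rw [hx.areaMeasure_apply hR q hm inter_subset_right, chartArea_apply K x q hm]
  refine setLIntegral_measure_zero _ _ (measure_mono_null ?_ (volume_hyperplane n))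
  rintro y ⟨hy, hy', -⟩
  have h0 : 0 ≤ y 0 := by
    rw [chartDom_eq] at hy
    exact hy.2
  -- A chart point with positive first coordinate is interior and is mapped into the open ball, so
  -- the exceptional set lies in a hyperplane.
  by_contra hne
  have h1 := hx.interior_mem _ (mem_interior_of_chart hy (lt_of_le_of_ne h0 (Ne.symm hne)))
  rw [interior_geodesicBall (n + 1) hR] at h1
  exact hy' h1

/-- Ω is a component in the closed ball and may contain points of ∂B, but the sphere is a null set.
-/
theorem IsEnclosedDomain.ae_eq_inter_ball (hΩ : IsEnclosedDomain K R x ν Ω) :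
    Ω =ᵐ[volume] (Ω ∩ Metric.ball 0 (modelRadius K R) : Set _) := by
  have h := Measure.addHaar_sphere (volume : Measure (EuclideanSpace ℝ (Fin (n + 1)))) 0
    (modelRadius K R)
  have h' : ∀ᵐ y, y ∉ Metric.sphere (0 : EuclideanSpace ℝ (Fin (n + 1))) (modelRadius K R) :=
    measure_eq_zero_iff_ae_notMem.1 h
  refine eventuallyEq_set.2 ?_
  filter_upwards [h'] with y hy
  refine ⟨fun hyΩ => ⟨hyΩ, ?_⟩, fun hyΩ => hyΩ.1⟩
  have h1 : y ∈ Metric.closedBall 0 (modelRadius K R) := (hΩ.subset_diff hyΩ).1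
  exact lt_of_le_of_ne h1 hy

variable (a : EuclideanSpace ℝ (Fin (n + 1)))

theorem normalFlux_cutoffField (hR : AdmissibleRadius K R) (hx : IsFreeBoundaryImmersion K R x ν)
    (k : ℕ) (p : M) :
    normalFlux K x ν (cutoffField K R a k) p
      = cutoff (modelRadius K R) k (x p) * metric K (x p) (X K R a (x p)) (ν p) := by
  have h := (conformalFactor_pos (hx.mem_domain hR p)).ne'
  rw [normalFlux, cutoffField, metric_normal_eq, inner_smul_left, inner_smul_left]
  simp only [conj_trivial]
  field_simp
  ring

theorem eventually_cutoff_eq_one {m : ℕ} {r : ℝ} {y : EuclideanSpace ℝ (Fin m)}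
    (hy : y ∈ Metric.ball 0 r) : ∀ᶠ k : ℕ in atTop, cutoff r k y = 1 := by
  filter_upwards [eventually_cutoff hy] with k hk
  exact Real.smoothTransition.one_of_one_le (by linarith)

theorem abs_cutoff_le_one {m : ℕ} (r : ℝ) (k : ℕ) (y : EuclideanSpace ℝ (Fin m)) :
    |cutoff r k y| ≤ 1 := by
  rw [cutoff, abs_of_nonneg (Real.smoothTransition.nonneg _)]
  exact Real.smoothTransition.le_one _

theorem tendsto_integral_normalFlux (hR : AdmissibleRadius K R)
    (hx : IsFreeBoundaryImmersion K R x ν) :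
    Tendsto (fun k => ∫ p, normalFlux K x ν (cutoffField K R a k) p ∂(areaMeasure K x)) atTop
      (𝓝 (∫ p, metric K (x p) (X K R a (x p)) (ν p) ∂(areaMeasure K x))) := by
  refine tendsto_integral_of_dominated_convergence
    (fun p => ‖metric K (x p) (X K R a (x p)) (ν p)‖) (fun k => ?_)
    (hx.integrable_of_continuous hR (continuous_metric_X hR hx a)).norm (fun k => ?_) ?_
  · exact (hx.integrable_of_continuous hR (continuous_normalFlux hR hx
      (contDiff_cutoffField hR a k).continuous)).aestronglyMeasurable
  · refine Eventually.of_forall fun p => ?_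
    rw [normalFlux_cutoffField a hR hx, norm_mul]
    exact mul_le_of_le_one_left (norm_nonneg _) (abs_cutoff_le_one _ k _)
  · filter_upwards [hx.ae_mem_ball hR] with p hp
    refine tendsto_const_nhds.congr' ?_
    filter_upwards [eventually_cutoff_eq_one hp] with k hk
    rw [normalFlux_cutoffField a hR hx, hk, one_mul]

theorem integrableOn_of_continuousOn_domain {m : ℕ} {f : EuclideanSpace ℝ (Fin m) → ℝ}
    (hf : ContinuousOn f (modelDomain m K)) (R : ℝ) {s : Set (EuclideanSpace ℝ (Fin m))}
    (hs : s ⊆ Metric.ball 0 (modelRadius K R)) : IntegrableOn f s := by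
  refine IntegrableOn.mono_set (t := geodesicBall m K R) ?_
    (hs.trans Metric.ball_subset_closedBall)
  exact (hf.mono (geodesicBall_subset_modelDomain m K R)).integrableOn_compact
    (isCompact_closedBall _ _)

/-- Dominated convergence: the term with the derivative of the cutoff is bounded uniformly in k, and
at each point of the open ball it vanishes for large k. -/
theorem tendsto_integral_divergence {m : ℕ} (hR : AdmissibleRadius K R)
    (a : EuclideanSpace ℝ (Fin m)) {s : Set (EuclideanSpace ℝ (Fin m))} (hs : MeasurableSet s)
    (hsB : s ⊆ Metric.ball 0 (modelRadius K R)) :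
    Tendsto (fun k => ∫ y in s, divergence (cutoffField K R a k) y) atTop
      (𝓝 (∫ y in s, m * (conformalFactor K y ^ m * V K a y))) := by
  obtain ⟨C, hC⟩ := exists_bound_deriv_smoothTransition
  have hcf := continuousOn_conformalFactor_domain (m := m) (K := K)
  have h1 : IntegrableOn (fun y => (m : ℝ) * (conformalFactor K y ^ m * V K a y)) s :=
    integrableOn_of_continuousOn_domain
      (continuousOn_const.mul ((hcf.pow m).mul (continuousOn_V K a))) R hsB
  have h2 : IntegrableOn
      (fun y => fieldConst K R * inner ℝ y a * conformalFactor K y ^ m) s :=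
    integrableOn_of_continuousOn_domain
      ((by fun_prop : Continuous fun y => fieldConst K R * inner ℝ y a).continuousOn.mul
        (hcf.pow m)) R hsB
  refine tendsto_integral_of_dominated_convergence
    (fun y => ‖(m : ℝ) * (conformalFactor K y ^ m * V K a y)‖ +
      C * ‖fieldConst K R * inner ℝ y a * conformalFactor K y ^ m‖) (fun k => ?_)
    (h1.norm.add (h2.norm.const_mul C)) (fun k => ?_) ?_
  · exact (continuous_divergence (contDiff_cutoffField hR a k)).aestronglyMeasurable
  · filter_upwards [ae_restrict_mem hs] with y hy
    rw [divergence_cutoffField hR a k (ball_subset_modelDomain m K R (hsB hy))]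
    refine (norm_add_le _ _).trans (add_le_add ?_ ?_)
    · rw [norm_mul]
      exact mul_le_of_le_one_left (norm_nonneg _) (abs_cutoff_le_one _ k _)
    · rw [norm_mul]
      exact mul_le_mul_of_nonneg_right (hC _) (norm_nonneg _)
  · filter_upwards [ae_restrict_mem hs] with y hy
    refine tendsto_const_nhds.congr' ?_
    filter_upwards [eventually_cutoff_eq_one (hsB hy), eventually_cutoff (hsB hy)] with k hk hk'
    rw [divergence_cutoffField hR a k (ball_subset_modelDomain m K R (hsB hy)), hk,
      deriv_smoothTransition_of_one_lt (by linarith)]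
    ring

/-- The volume formula for the domain enclosed by an embedded free boundary hypersurface. -/
theorem IsEnclosedDomain.integral_V (hR : AdmissibleRadius K R)
    (hx : IsFreeBoundaryImmersion K R x ν) (hemb : IsEmbedding x)
    (hΩ : IsEnclosedDomain K R x ν Ω) :
    IntegrableOn (V K a) Ω (volumeMeasure K) ∧
    Integrable (fun p => metric K (x p) (X K R a (x p)) (ν p)) (areaMeasure K x) ∧
    ∫ y in Ω, V K a y ∂(volumeMeasure K) =
      1 / ((n : ℝ) + 1) * ∫ p, metric K (x p) (X K R a (x p)) (ν p) ∂(areaMeasure K x) := by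
  set s := Ω ∩ Metric.ball 0 (modelRadius K R) with hs
  have hsm : MeasurableSet s := (hΩ.isOpen_inter_ball hx).measurableSet
  have hsd : s ⊆ modelDomain (n + 1) K := inter_subset_right.trans
    (ball_subset_modelDomain (n + 1) K R)
  have hae : Ω =ᵐ[volumeMeasure K] s :=
    (withDensity_absolutelyContinuous volume _).ae_le (hΩ.ae_eq_inter_ball)
  have hvol := integrableOn_volumeMeasure hsm hsd (V K a)
  have hint : IntegrableOn (fun y => conformalFactor K y ^ (n + 1) * V K a y) s :=
    integrableOn_of_continuousOn_domain
      ((continuousOn_conformalFactor_domain.pow _).mul (continuousOn_V K a)) R inter_subset_right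
  have hlim := tendsto_integral_divergence hR a hsm inter_subset_right
  simp only [hs, hΩ.integral_divergence hR hx hemb (contDiff_cutoffField hR a _)
    (hasCompactSupport_cutoffField a _) ((tsupport_cutoffField a _).trans
      (cutoff_subset_ball (modelRadius_pos hR) _))] at hlim
  -- For each k the divergence theorem equates the volume and area integrals of the cut-off field,
  -- so their limits agree.
  have heq := tendsto_nhds_unique hlim (tendsto_integral_normalFlux a hR hx)
  refine ⟨?_, hx.integrable_of_continuous hR (continuous_metric_X hR hx a), ?_⟩
  · exact (hvol.1.2 hint).congr_set_ae hae
  · rw [setIntegral_congr_set hae, hvol.2, ← heq, integral_const_mul, ← mul_assoc]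
    push_cast
    rw [one_div_mul_cancel (by positivity), one_mul]

end Enclosed

end SpaceForm

end

theorem mainTheorem9 {n : ℕ} [NeZero n] {M : Type*} [TopologicalSpace M] [T2Space M]
    [CompactSpace M] [ChartedSpace (EuclideanHalfSpace n) M] [IsManifold (𝓡∂ n) ∞ M]
    [MeasurableSpace M] [BorelSpace M]
    (K : SignType) (R : ℝ) (hR : SpaceForm.AdmissibleRadius K R)
    (x ν : M → EuclideanSpace ℝ (Fin (n + 1)))
    (hx : SpaceForm.IsFreeBoundaryImmersion K R x ν)
    (a : EuclideanSpace ℝ (Fin (n + 1))) :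
    (Topology.IsEmbedding x →
      ∀ Ω : Set (EuclideanSpace ℝ (Fin (n + 1))), SpaceForm.IsEnclosedDomain K R x ν Ω →
        IntegrableOn (SpaceForm.V K a) Ω (SpaceForm.volumeMeasure K) ∧
        Integrable (fun p => SpaceForm.metric K (x p) (SpaceForm.X K R a (x p)) (ν p))
          (SpaceForm.areaMeasure K x) ∧
        ∫ y in Ω, SpaceForm.V K a y ∂(SpaceForm.volumeMeasure K) =
          1 / ((n : ℝ) + 1) *
            ∫ p, SpaceForm.metric K (x p) (SpaceForm.X K R a (x p)) (ν p)
              ∂(SpaceForm.areaMeasure K x)) ∧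
    (∀ k : ℕ, 1 ≤ k → k ≤ n →
      Integrable (fun p => SpaceForm.V K a (x p) * SpaceForm.sigma K x ν (k - 1) p)
        (SpaceForm.areaMeasure K x) ∧
      Integrable (fun p => SpaceForm.sigma K x ν k p *
          SpaceForm.metric K (x p) (SpaceForm.X K R a (x p)) (ν p))
        (SpaceForm.areaMeasure K x) ∧
      ∫ p, SpaceForm.V K a (x p) * SpaceForm.sigma K x ν (k - 1) p
          ∂(SpaceForm.areaMeasure K x) =
        (k : ℝ) / ((n : ℝ) + 1 - k) *
          ∫ p, SpaceForm.sigma K x ν k p *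
            SpaceForm.metric K (x p) (SpaceForm.X K R a (x p)) (ν p)
              ∂(SpaceForm.areaMeasure K x)) := by
  exact ⟨fun hemb _ hΩ => hΩ.integral_V a hR hx hemb,
    fun k hk1 hk => SpaceForm.minkowski_formula hR hx a hk1 hk⟩
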